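/- A *$k$-separator* of a graph $G$ is a set $S$ of $k' \le k$ vertices such that every connected component of $G - S$ has at most $k - k'$ vertices. The *girth* of $G$ is the length of a shortest cycle of $G$ (the value $0$ is output if $G$ has no cycle). The model of computation is the unit-cost word RAM with word size $O(\log n)$; a graph with vertices $0, \dots, n-1$ is given by its adjacency lists, and a vertex set by its indicator vector. We say that $n \times n$ matrices can be multiplied in $O(n^{\omega})$ time if, for every constant $d$, there is a program on this model that multiplies any two $n \times n$ matrices with entries in $\{0, 1, \dots, n^d\}$ in $O(n^{\omega})$ steps. **Proposition.** Let $\omega$ be a real number such that $n \times n$ matrices can be multiplied in $O(n^{\omega})$ time. Then there is a deterministic algorithm that, given a graph $G$ with $n \ge 1$ vertices and a set $S$ of its vertices, computes the girth of $G$ in $O(k^{\omega - 1} n)$ time for every $k$ such that $S$ is a $k$-separator of $G$, with a constant that depends only on the algorithm. Consequently, if $\omega$ denotes the matrix multiplication exponent, that is, the infimum of all such real numbers, then for every $\varepsilon > 0$ the girth can be computed in $O(k^{\omega + \varepsilon - 1} n)$ time. -/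

import Mathlib

namespace WordRAM

/-! ## A word RAM with unit cost

A program uses finitely many registers and finitely many random-access arrays.  All of them hold
natural numbers of at most `w` bits, where `w` is the word size. -/

/-- Binary operations on words.  Comparisons return `0` or `1`, and `sub` is truncated. -/
inductive BinOp where
  | add | sub | mul | div | mod | lt | eq | land | lor | xor | shl | shr

/-- The value of a binary operation, before the check that it fits into a word. -/
def BinOp.eval : BinOp → ℕ → ℕ → ℕ
  | .add, a, b => a + b
  | .sub, a, b => a - b
  | .mul, a, b => a * b
  | .div, a, b => a / b
  | .mod, a, b => a % b
  | .lt, a, b => if a < b then 1 else 0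
  | .eq, a, b => if a = b then 1 else 0
  | .land, a, b => a &&& b
  | .lor, a, b => a ||| b
  | .xor, a, b => a ^^^ b
  | .shl, a, b => a <<< b
  | .shr, a, b => a >>> b

/-- Programs.  Registers and arrays are named by natural numbers that occur literally in the
program text, so that a program refers to finitely many of them. -/
inductive Program where
  /-- Do nothing. -/
  | skip
  /-- `r := c`. -/
  | const (r c : ℕ)
  /-- `r := a o b`, for registers `a` and `b`. -/
  | op (o : BinOp) (r a b : ℕ)
  /-- `r := x[i]`, for an array `x` and a register `i`. -/
  | load (r x i : ℕ)
  /-- `x[i] := r`, for an array `x` and registers `i` and `r`. -/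
  | store (x i r : ℕ)
  /-- Sequential composition. -/
  | seq (p q : Program)
  /-- If register `r` is nonzero then `p` else `q`. -/
  | ite (r : ℕ) (p q : Program)
  /-- While register `r` is nonzero do `p`. -/
  | loop (r : ℕ) (p : Program)

/-- A memory state: `reg r` is the content of register `r`, and `mem x i` is the entry with
index `i` of the array `x`. -/
structure State where
  reg : ℕ → ℕ
  mem : ℕ → ℕ → ℕ

/-- Write `v` into register `r`. -/
def State.setReg (s : State) (r v : ℕ) : State :=
  { s with reg := Function.update s.reg r v }

/-- Write `v` into the entry with index `i` of the array `x`. -/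
def State.setMem (s : State) (x i v : ℕ) : State :=
  { s with mem := Function.update s.mem x (Function.update (s.mem x) i v) }

/-- `Exec w p s t s'`: on the machine with word size `w`, the program `p` started in the state `s`
halts after exactly `t` steps in the state `s'`, and no result exceeds the word size (a program
whose computation overflows is stuck).  Every instruction and every test costs one step. -/
inductive Exec (w : ℕ) : Program → State → ℕ → State → Prop where
  | skip (s : State) : Exec w .skip s 1 s
  | const (s : State) (r c : ℕ) (hc : c < 2 ^ w) : Exec w (.const r c) s 1 (s.setReg r c)
  | op (s : State) (o : BinOp) (r a b : ℕ) (ho : o.eval (s.reg a) (s.reg b) < 2 ^ w) :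
      Exec w (.op o r a b) s 1 (s.setReg r (o.eval (s.reg a) (s.reg b)))
  | load (s : State) (r x i : ℕ) : Exec w (.load r x i) s 1 (s.setReg r (s.mem x (s.reg i)))
  | store (s : State) (x i r : ℕ) : Exec w (.store x i r) s 1 (s.setMem x (s.reg i) (s.reg r))
  | seq {p q : Program} {s s₁ s₂ : State} {t₁ t₂ : ℕ}
      (hp : Exec w p s t₁ s₁) (hq : Exec w q s₁ t₂ s₂) : Exec w (.seq p q) s (t₁ + t₂) s₂
  | ite_true {r : ℕ} {p q : Program} {s s₁ : State} {t : ℕ}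
      (hr : s.reg r ≠ 0) (hp : Exec w p s t s₁) : Exec w (.ite r p q) s (1 + t) s₁
  | ite_false {r : ℕ} {p q : Program} {s s₁ : State} {t : ℕ}
      (hr : s.reg r = 0) (hq : Exec w q s t s₁) : Exec w (.ite r p q) s (1 + t) s₁
  | loop_true {r : ℕ} {p : Program} {s s₁ s₂ : State} {t₁ t₂ : ℕ}
      (hr : s.reg r ≠ 0) (hp : Exec w p s t₁ s₁) (hl : Exec w (.loop r p) s₁ t₂ s₂) :
      Exec w (.loop r p) s (1 + t₁ + t₂) s₂
  | loop_false {r : ℕ} {p : Program} {s : State}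
      (hr : s.reg r = 0) : Exec w (.loop r p) s 1 s

/-- The word size `c * (⌊log₂ n⌋ + 1)`, that is, `O(log n)` for a constant `c`. -/
def wordSize (c n : ℕ) : ℕ := c * (Nat.log 2 n + 1)

end WordRAM

/-! ## The matrix multiplication exponent -/

/-- The input of a matrix multiplication program: register `0` holds `n`, the arrays `0` and `1`
hold the two matrices row by row, and everything else is zero. -/
def matMulInput {n : ℕ} (A B : Matrix (Fin n) (Fin n) ℕ) : WordRAM.State where
  reg r := if r = 0 then n else 0
  mem x p :=
    if h : p < n * n then
      let ij := finProdFinEquiv.symm (⟨p, h⟩ : Fin (n * n))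
      if x = 0 then A ij.1 ij.2 else if x = 1 then B ij.1 ij.2 else 0
    else 0

/-- Two `n × n` matrices can be multiplied in `O(n ^ τ)` time: for every `d` there is a program
that, on a word RAM with word size `O(log n)`, computes the product of any two matrices whose
entries are natural numbers of size at most `n ^ d`, and leaves it row by row in array `2`. -/
def MatMulInTime (τ : ℝ) : Prop :=
  ∀ d : ℕ, ∃ (P : WordRAM.Program) (c : ℕ) (C : ℝ),
    ∀ (n : ℕ), 0 < n → ∀ A B : Matrix (Fin n) (Fin n) ℕ,
      (∀ i j, A i j ≤ n ^ d) → (∀ i j, B i j ≤ n ^ d) →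
      ∃ (t : ℕ) (s : WordRAM.State),
        WordRAM.Exec (WordRAM.wordSize c n) P (matMulInput A B) t s ∧
        (t : ℝ) ≤ C * (n : ℝ) ^ τ ∧
        ∀ i j : Fin n, s.mem 2 (finProdFinEquiv (i, j)) = (A * B) i j

/-- The matrix multiplication exponent. -/
noncomputable def matMulExponent : ℝ := sInf {τ : ℝ | MatMulInTime τ}

/-! ## Separators, and graphs as inputs -/

/-- `S` is a `k`-separator of `G`: it has `k' ≤ k` vertices, and every connected component of
`G - S` has at most `k - k'` vertices. -/
def IsKSeparator {V : Type*} (G : SimpleGraph V) (S : Finset V) (k : ℕ) : Prop :=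
  S.card ≤ k ∧
    ∀ K : (G.induce {v : V | v ∉ S}).ConnectedComponent, K.supp.ncard ≤ k - S.card

/-- `adj` is a representation of `G` by adjacency lists (in an arbitrary order). -/
def IsAdjLists {n : ℕ} (G : SimpleGraph (Fin n)) (adj : Fin n → List (Fin n)) : Prop :=
  ∀ v, (adj v).Nodup ∧ ∀ u, u ∈ adj v ↔ G.Adj v u

/-- The input that consists of a graph, given by its adjacency lists, and a set `S` of vertices.
Register `0` holds `n`.  Array `1` is the concatenation of the adjacency lists of the vertices
`0, …, n - 1`, and the list of `v` occupies there the positions from `x₀[v]` to `x₀[v + 1] - 1`,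
where `x₀` is array `0`.  Array `2` is the indicator vector of `S`.  Everything else is zero. -/
def graphInput {n : ℕ} (adj : Fin n → List (Fin n)) (S : Finset (Fin n)) : WordRAM.State where
  reg r := if r = 0 then n else 0
  mem x p :=
    if x = 0 then
      if p ≤ n then ∑ u : Fin n, if (u : ℕ) < p then (adj u).length else 0 else 0
    else if x = 1 then
      ((List.ofFn adj).flatten.map Fin.val).getD p 0
    else if x = 2 then
      if h : p < n then (if (⟨p, h⟩ : Fin n) ∈ S then 1 else 0) else 0
    else 0

/-- Given a graph with `n ≥ 1` vertices and a `k`-separator of it, the girth can be computed in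
`O(k ^ (τ - 1) * n)` time on a word RAM with word size `O(log n)`.  The girth is left in
register `0`, where the output `0` means that the graph has no cycle. -/
def GirthInTime (τ : ℝ) : Prop :=
  ∃ (P : WordRAM.Program) (c : ℕ) (C : ℝ),
    ∀ (n : ℕ), 0 < n → ∀ (G : SimpleGraph (Fin n)) (adj : Fin n → List (Fin n)),
      IsAdjLists G adj → ∀ (S : Finset (Fin n)) (k : ℕ), IsKSeparator G S k →
      ∃ (t : ℕ) (s : WordRAM.State),
        WordRAM.Exec (WordRAM.wordSize c n) P (graphInput adj S) t s ∧
        (t : ℝ) ≤ C * ((k : ℝ) ^ (τ - 1) * n) ∧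
        s.reg 0 = G.girth

namespace WordRAM

/-! ## Expressions and weakest preconditions with time credits -/

/-! The algorithm is a truncated breadth-first search from every vertex, followed by one test by
matrix multiplication. A search from `u` runs in all of `G` if `u ∈ S`, and in `G - S` otherwise.
Every cycle either meets `S` or survives in `G - S`, so it passes through a root whose search graph
contains it (`exists_cycle_modeGraph`). A search stops at the first edge that is not a tree edge.
Such an edge closes a cycle, and all vertices of smaller depth than its scanned end have then been
scanned (`BfsInv.closing_edge`). Until then only tree edges are seen, so the cost is linear in the
number of vertices reached: at most `n` for each of the at most `k` roots in `S`, and at most `k`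
for every other root. In total this is `O(k * n)`.

Let `b` be the least bound on a cycle found in this way, and `g` the girth. Then `g ≤ b`, and a
shortest cycle through a root would have consisted of tree edges alone if `b` were larger than `g`
rounded up to an even number (`IsLevelTree.antipodal_edge`, `IsBfsRow.le_of_isCycle`). Hence `b =
g`, or `g` is odd and `b = g + 1`. If `b` is `0` or odd, it is the answer. If `b` is even, the girth
is `b - 1` exactly if there are a root `u` and adjacent `v`, `w` with `d v = d w = b / 2` in the
search from `u`, where `d` is depth plus one (`girth_eq_of_isBfsRow`).

To look for such a triple, order the vertices with `S` first and then component by component, and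
let `K` be the size of `S` plus that of the largest component of `G - S`. Then `K ≤ k` for every
admissible `k`, so the program need not know `k`. The members of a triple outside `S` lie in one
component, so they occupy fewer than `K` consecutive positions. The first `K` positions together
with `2 * K` consecutive ones starting at a multiple of `K` therefore contain the triple
(`HasOrder.exists_window`). For each of the `O(n / K)` windows one multiplies the 0/1 matrix of
pairs at distance value `b / 2` by the adjacency matrix, both of size `3 * K`, and compares the
supports. This costs `O(K ^ ω * n / K)`. The bound `2 ≤ ω` (`MatMulInTime.two_le`) absorbs all lower
terms.

On the machine, programs are written with nested expressions and verified by a weakest precondition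
`WP` that carries time credits, so that correctness, running time and termination are proved
together. The given multiplication program expects memory that is zero apart from its input. It is
therefore translated (`embed`) so that run number `j` uses only its own residue class of array
indices, and no memory ever has to be cleared (`Exec.wp_embed`). -/

/-- Arithmetic expressions over variables and array entries. -/
inductive Ex where
  | lit (c : ℕ)
  | var (i : ℕ)
  | op (o : BinOp) (a b : Ex)
  | ld (x : ℕ) (a : Ex)

infixl:65 " +ₑ " => Ex.op BinOp.add
infixl:65 " -ₑ " => Ex.op BinOp.sub
infixl:70 " *ₑ " => Ex.op BinOp.mul
infixl:70 " /ₑ " => Ex.op BinOp.div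
infixl:70 " %ₑ " => Ex.op BinOp.mod
infix:50 " <ₑ " => Ex.op BinOp.lt
infix:50 " =ₑ " => Ex.op BinOp.eq

namespace Ex

/-- The value of an expression. -/
def eval (s : State) : Ex → ℕ
  | lit c => c
  | var i => s.reg i
  | op o a b => o.eval (a.eval s) (b.eval s)
  | ld x a => s.mem x (a.eval s)

/-- All intermediate results are less than `B`. -/
def Fits (B : ℕ) (s : State) : Ex → Prop
  | lit c => c < B
  | var _ => True
  | op o a b => a.Fits B s ∧ b.Fits B s ∧ o.eval (a.eval s) (b.eval s) < B
  | ld _ a => a.Fits B s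

/-- The number of steps that the evaluation of an expression takes. -/
def cost : Ex → ℕ
  | lit _ => 1
  | var _ => 1
  | op _ a b => a.cost + (b.cost + 1)
  | ld _ a => a.cost + 1

/-- The register that holds the value of an expression evaluated at stack depth `d`.  Variable `i`
lives in register `2 * i`, and temporary results live in odd registers. -/
def loc : Ex → ℕ → ℕ
  | var i, _ => 2 * i
  | _, d => 2 * d + 1

/-- Code that evaluates an expression into the register `loc`. -/
def pre : Ex → ℕ → Program
  | lit c, d => .const (2 * d + 1) c
  | var _, _ => .skip
  | op o a b, d =>
    .seq (a.pre d) (.seq (b.pre (d + 1)) (.op o (2 * d + 1) (a.loc d) (b.loc (d + 1))))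
  | ld x a, d => .seq (a.pre d) (.load (2 * d + 1) x (a.loc d))

end Ex

/-- Assign the value of an expression to a variable. -/
def asg (v : ℕ) : Ex → Program
  | .lit c => .const (2 * v) c
  -- There is no move instruction; a bitwise disjunction of a register with itself copies it.
  | .var i => .op .lor (2 * v) (2 * i) (2 * i)
  | .op o a b => .seq (a.pre 0) (.seq (b.pre 1) (.op o (2 * v) (a.loc 0) (b.loc 1)))
  | .ld x a => .seq (a.pre 0) (.load (2 * v) x (a.loc 0))

/-- All intermediate results of an assignment are less than `B`. -/
def AsgFits (B : ℕ) (s : State) : Ex → Prop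
  | .var i => s.reg i < B
  | e => e.Fits B s

/-- Write the value of `b` into the entry with index `a` of the array `x`. -/
def st (x : ℕ) (a b : Ex) : Program :=
  .seq (a.pre 0) (.seq (b.pre 1) (.store x (a.loc 0) (b.loc 1)))

/-- If `e` is nonzero then `p` else `q`. -/
def cond (e : Ex) (p q : Program) : Program := .seq (e.pre 0) (.ite (e.loc 0) p q)

/-- While `e` is nonzero do `p`. -/
def loopWhile (e : Ex) (p : Program) : Program :=
  .seq (e.pre 0) (.loop (e.loc 0) (.seq p (e.pre 0)))

infixr:40 " ;; " => Program.seq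

/-- The variables and arrays of a machine state, without the temporary registers. -/
def view (σ : State) : State := ⟨fun i => σ.reg (2 * i), σ.mem⟩

@[ext] theorem State.ext' {s s' : State} (h : ∀ r, s.reg r = s'.reg r)
    (h' : ∀ x i, s.mem x i = s'.mem x i) : s = s' := by
  cases s; cases s'
  simp only [State.mk.injEq]
  exact ⟨funext h, funext fun x => funext (h' x)⟩

theorem State.reg_setReg (s : State) (r v r' : ℕ) :
    (s.setReg r v).reg r' = if r' = r then v else s.reg r' := by
  simp [State.setReg, Function.update_apply]

theorem State.mem_setReg (s : State) (r v : ℕ) : (s.setReg r v).mem = s.mem := rfl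

theorem State.reg_setMem (s : State) (x i v : ℕ) : (s.setMem x i v).reg = s.reg := rfl

theorem State.mem_setMem (s : State) (x i v x' i' : ℕ) :
    (s.setMem x i v).mem x' i' = if x' = x ∧ i' = i then v else s.mem x' i' := by
  simp only [State.setMem, Function.update_apply]
  split_ifs <;> simp_all

theorem view_setReg (σ : State) (v a : ℕ) : view (σ.setReg (2 * v) a) = (view σ).setReg v a := by
  ext <;> simp [view, State.reg_setReg, State.mem_setReg]

theorem view_setReg_odd (σ : State) (d a : ℕ) : view (σ.setReg (2 * d + 1) a) = view σ := by
  ext r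
  · have : 2 * r ≠ 2 * d + 1 := by omega
    simp [view, State.reg_setReg, this]
  · rfl

/-- Evaluation at depth `d` leaves the temporaries below `d` alone. The last clause records this, so
that the value of a left operand survives the evaluation of the right one; if the left operand is a
variable, it survives because the view is unchanged. -/
theorem Ex.pre_exec {w : ℕ} (e : Ex) (d : ℕ) (σ : State) (h : e.Fits (2 ^ w) (view σ)) :
    ∃ σ', Exec w (e.pre d) σ e.cost σ' ∧ view σ' = view σ ∧
      σ'.reg (e.loc d) = e.eval (view σ) ∧ ∀ d' < d, σ'.reg (2 * d' + 1) = σ.reg (2 * d' + 1) := by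
  induction e generalizing d σ with
  | lit c =>
    refine ⟨_, .const σ _ c h, view_setReg_odd .., ?_, fun d' hd => ?_⟩
    · simp [loc, eval, State.reg_setReg]
    · have : d' ≠ d := by omega
      simp [State.reg_setReg, this]
  | var i => exact ⟨σ, .skip σ, rfl, rfl, fun _ _ => rfl⟩
  | op o a b iha ihb =>
    obtain ⟨ha, hb, ho⟩ := h
    obtain ⟨σ₁, e₁, v₁, l₁, t₁⟩ := iha d σ ha
    obtain ⟨σ₂, e₂, v₂, l₂, t₂⟩ := ihb (d + 1) σ₁ (v₁ ▸ hb)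
    have hl : σ₂.reg (a.loc d) = a.eval (view σ) := by
      rw [← l₁]
      cases a with
      | var i => exact congrFun (congrArg State.reg v₂) i
      | _ => exact t₂ d (by omega)
    rw [v₁] at l₂
    have e₃ := Exec.op (w := w) σ₂ o (2 * d + 1) (a.loc d) (b.loc (d + 1))
      (by rw [hl, l₂]; exact ho)
    rw [hl, l₂] at e₃
    refine ⟨_, .seq e₁ (.seq e₂ e₃), by rw [view_setReg_odd, v₂, v₁], ?_, fun d' hd => ?_⟩
    · simp [loc, eval, State.reg_setReg]
    · have : d' ≠ d := by omega
      simp [State.reg_setReg, this, t₂ d' (by omega), t₁ d' hd]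
  | ld x a iha =>
    obtain ⟨σ₁, e₁, v₁, l₁, t₁⟩ := iha d σ h
    refine ⟨_, .seq e₁ (.load σ₁ _ _ _), by rw [view_setReg_odd, v₁], ?_, fun d' hd => ?_⟩
    · rw [l₁, ← v₁]
      simp only [loc, State.reg_setReg, if_true, eval]
      rfl
    · have : d' ≠ d := by omega
      simp [State.reg_setReg, this, t₁ d' hd]

theorem Ex.pre_exec₂ {w : ℕ} (a b : Ex) (σ : State) (ha : a.Fits (2 ^ w) (view σ))
    (hb : b.Fits (2 ^ w) (view σ)) :
    ∃ σ₁ σ₂, Exec w (a.pre 0) σ a.cost σ₁ ∧ Exec w (b.pre 1) σ₁ b.cost σ₂ ∧ view σ₂ = view σ ∧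
      σ₂.reg (a.loc 0) = a.eval (view σ) ∧ σ₂.reg (b.loc 1) = b.eval (view σ) := by
  obtain ⟨σ₁, e₁, v₁, l₁, t₁⟩ := a.pre_exec 0 σ ha
  obtain ⟨σ₂, e₂, v₂, l₂, t₂⟩ := b.pre_exec 1 σ₁ (v₁ ▸ hb)
  refine ⟨σ₁, σ₂, e₁, e₂, v₂.trans v₁, ?_, v₁ ▸ l₂⟩
  rw [← l₁]
  cases a with
  | var i => exact congrFun (congrArg State.reg v₂) i
  | _ => exact t₂ 0 (by omega)

/-- If words are the numbers below `B`, then the program `p`, started in a state with view `s` and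
with `T` credits, halts in a state and with a number of unused credits that satisfy `Q`.  Every step
consumes a credit. -/
def WP (B : ℕ) (p : Program) (Q : State → ℕ → Prop) (s : State) (T : ℕ) : Prop :=
  ∀ w, 2 ^ w = B → ∀ σ, view σ = s → ∃ t σ' T', Exec w p σ t σ' ∧ t + T' ≤ T ∧ Q (view σ') T'

namespace WP

variable {B : ℕ} {p q : Program} {Q Q' : State → ℕ → Prop} {s : State} {T T' : ℕ} {e : Ex}

theorem mono (h : WP B p Q s T) (hQ : ∀ s T, Q s T → Q' s T) : WP B p Q' s T := fun w hw σ hσ =>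
  let ⟨t, σ', T', h₁, h₂, h₃⟩ := h w hw σ hσ
  ⟨t, σ', T', h₁, h₂, hQ _ _ h₃⟩

theorem weaken (h : WP B p Q s T') (hT : T' ≤ T) : WP B p Q s T := fun w hw σ hσ =>
  let ⟨t, σ', T', h₁, h₂, h₃⟩ := h w hw σ hσ
  ⟨t, σ', T', h₁, h₂.trans hT, h₃⟩

theorem seq (h : WP B p (WP B q Q) s T) : WP B (p ;; q) Q s T := fun w hw σ hσ => by
  obtain ⟨t, σ', T', h₁, h₂, h₃⟩ := h w hw σ hσ
  obtain ⟨t', σ'', T'', h₁', h₂', h₃'⟩ := h₃ w hw σ' rfl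
  exact ⟨_, _, T'', .seq h₁ h₁', by omega, h₃'⟩

theorem skip (hT : 1 ≤ T) (h : Q s (T - 1)) : WP B .skip Q s T := fun w hw σ hσ =>
  ⟨_, _, T - 1, .skip σ, by omega, by rwa [hσ]⟩

theorem asg {v : ℕ} (a : ℕ) (ha : e.eval s = a) (hf : AsgFits B s e) (hT : e.cost ≤ T)
    (h : Q (s.setReg v a) (T - e.cost)) : WP B (asg v e) Q s T := by
  rintro w rfl σ rfl
  subst ha
  suffices ∃ σ', Exec w (WordRAM.asg v e) σ e.cost σ' ∧
      view σ' = (view σ).setReg v (e.eval (view σ)) by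
    obtain ⟨σ', h₁, h₂⟩ := this
    exact ⟨_, σ', T - e.cost, h₁, by omega, by rwa [h₂]⟩
  clear h hT
  cases e with
  | lit c => exact ⟨_, .const _ _ _ hf, view_setReg ..⟩
  | var i =>
    have := Exec.op (w := w) σ .lor (2 * v) (2 * i) (2 * i)
      (by simpa [BinOp.eval, AsgFits, view] using hf)
    exact ⟨_, this, by rw [view_setReg]; simp [BinOp.eval, Ex.eval, view]⟩
  | op o a b =>
    obtain ⟨σ₁, σ₂, e₁, e₂, hv, ha, hb⟩ := a.pre_exec₂ b σ hf.1 hf.2.1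
    have e₃ := Exec.op (w := w) σ₂ o (2 * v) (a.loc 0) (b.loc 1) (by rw [ha, hb]; exact hf.2.2)
    rw [ha, hb] at e₃
    exact ⟨_, .seq e₁ (.seq e₂ e₃), by rw [view_setReg, hv]; rfl⟩
  | ld x a =>
    obtain ⟨σ₁, e₁, hv, ha, -⟩ := a.pre_exec 0 σ hf
    refine ⟨_, .seq e₁ (.load σ₁ _ _ _), ?_⟩
    rw [ha, view_setReg, ← hv]
    rfl

theorem st {x : ℕ} {e' : Ex} (i a : ℕ) (hi : e.eval s = i) (ha : e'.eval s = a) (hf : e.Fits B s)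
    (hf' : e'.Fits B s) (hT : e.cost + (e'.cost + 1) ≤ T)
    (h : Q (s.setMem x i a) (T - (e.cost + (e'.cost + 1)))) : WP B (st x e e') Q s T := by
  rintro w rfl σ rfl
  subst hi ha
  obtain ⟨σ₁, σ₂, e₁, e₂, hv, ha, hb⟩ := e.pre_exec₂ e' σ hf hf'
  refine ⟨_, _, T - (e.cost + (e'.cost + 1)),
    .seq e₁ (.seq e₂ (.store σ₂ x (e.loc 0) (e'.loc 1))), by omega, ?_⟩
  have hm (i v : ℕ) : view (σ₂.setMem x i v) = (view σ₂).setMem x i v := rfl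
  rwa [ha, hb, hm, hv]

theorem cond (hf : e.Fits B s) (hT : e.cost + 1 ≤ T)
    (h₁ : e.eval s ≠ 0 → WP B p Q s (T - (e.cost + 1)))
    (h₂ : e.eval s = 0 → WP B q Q s (T - (e.cost + 1))) : WP B (cond e p q) Q s T := by
  rintro w rfl σ rfl
  obtain ⟨σ₁, e₁, hv, ha, -⟩ := e.pre_exec 0 σ hf
  by_cases he : e.eval (view σ) = 0
  · obtain ⟨t, σ', T', h₁, h₂, h₃⟩ := h₂ he w rfl σ₁ hv
    exact ⟨_, _, T', .seq e₁ (.ite_false (ha.trans he) h₁), by omega, h₃⟩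
  · obtain ⟨t, σ', T', h₁, h₂, h₃⟩ := h₁ he w rfl σ₁ hv
    exact ⟨_, _, T', .seq e₁ (.ite_true (fun h => he (ha.symm.trans h)) h₁), by omega, h₃⟩

theorem loopWhile_of_eq_zero (hf : e.Fits B s) (hT : e.cost + 1 ≤ T) (he : e.eval s = 0)
    (h : Q s (T - (e.cost + 1))) : WP B (WordRAM.loopWhile e p) Q s T := by
  rintro w rfl σ rfl
  obtain ⟨σ₁, e₁, hv, ha, -⟩ := e.pre_exec 0 σ hf
  exact ⟨_, σ₁, _, .seq e₁ (.loop_false (ha.trans he)), by omega, hv ▸ h⟩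

/-- One unrolling. The remaining run may be assumed to have strictly fewer credits, because the test
has used some; this replaces a termination measure. -/
theorem loopWhile_of_ne_zero (hf : e.Fits B s) (hT : e.cost + 1 ≤ T) (he : e.eval s ≠ 0)
    (h : WP B p (fun s' T' => T' < T → WP B (WordRAM.loopWhile e p) Q s' T') s (T - (e.cost + 1))) :
    WP B (WordRAM.loopWhile e p) Q s T := by
  rintro w rfl σ rfl
  obtain ⟨σ₁, e₁, hv, ha, -⟩ := e.pre_exec 0 σ hf
  obtain ⟨t, σ₂, T₂, hp, ht, hI₂⟩ := h w rfl σ₁ hv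
  obtain ⟨t', σ₃, T₃, hx, ht', hQ⟩ := hI₂ (by omega) w rfl σ₂ rfl
  -- The remaining run starts with an evaluation of the test. It is regrouped with the body just
  -- executed, since the compiled loop evaluates the test at the end of its body.
  cases hx with
  | seq e₂ hl =>
    exact ⟨_, σ₃, T₃, .seq e₁ (.loop_true (fun h => he (ha.symm.trans h)) (.seq hp e₂) hl),
      by omega, hQ⟩

/-- The rule for loops.  Termination follows from the fact that the credits `T` decrease. -/
theorem loopWhile (I : State → ℕ → Prop) (h : I s T)
    (hI : ∀ s T, I s T → e.Fits B s ∧ e.cost + 1 ≤ T ∧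
      (e.eval s ≠ 0 → WP B p I s (T - (e.cost + 1))) ∧
      (e.eval s = 0 → Q s (T - (e.cost + 1)))) : WP B (WordRAM.loopWhile e p) Q s T := by
  induction T using Nat.strong_induction_on generalizing s with
  | _ T ih =>
  obtain ⟨hf, hT, h₁, h₂⟩ := hI s T h
  by_cases he : e.eval s = 0
  · exact loopWhile_of_eq_zero hf hT he (h₂ he)
  · exact loopWhile_of_ne_zero hf hT he ((h₁ he).mono fun s' T' hI' hT' => ih T' hT' hI')

end WP

attribute [simp] Ex.eval Ex.Fits Ex.cost AsgFits BinOp.eval State.reg_setReg State.mem_setReg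
  State.reg_setMem State.mem_setMem

theorem pow_le_two_pow_wordSize (c n : ℕ) : (n + 1) ^ c ≤ 2 ^ wordSize c n := by
  rw [wordSize, mul_comm, pow_mul]
  exact Nat.pow_le_pow_left (Nat.lt_pow_succ_log_self one_lt_two n) c

/-- Together with the lower bound above, this makes the number of words polynomial in `n`; the upper
bound is needed to fit the words of the inner multiplication into those of the outer machine. -/
theorem two_pow_wordSize_le (c : ℕ) {n : ℕ} (hn : 0 < n) : 2 ^ wordSize c n ≤ (2 * n) ^ c := by
  rw [wordSize, mul_comm, pow_mul]
  refine Nat.pow_le_pow_left ?_ c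
  rw [pow_succ, mul_comm]
  exact Nat.mul_le_mul_left 2 (Nat.pow_log_le_self 2 hn.ne')

end WordRAM

section

/-! ## Breadth-first search trees and short cycles -/

namespace SimpleGraph

variable {V : Type*} {H : SimpleGraph V} {u : V} {d : V → ℕ} {par : V → V}

/-- `d` and `par` describe a tree in `H` with root `u`: the vertices of the tree are those with
`d z ≠ 0`, the depth of `z` is `d z - 1`, and `par z` is the parent of `z`. -/
structure IsLevelTree (H : SimpleGraph V) (u : V) (d : V → ℕ) (par : V → V) : Prop where
  root : d u = 1
  par_root : par u = u
  step : ∀ z, d z ≠ 0 → z ≠ u → d (par z) ≠ 0 ∧ H.Adj (par z) z ∧ d z = d (par z) + 1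

/-- All neighbors of `z` belong to the tree, and they are joined to `z` by edges of the tree. -/
def IsScanned (H : SimpleGraph V) (d : V → ℕ) (par : V → V) (z : V) : Prop :=
  ∀ y, H.Adj z y → d y ≠ 0 ∧ (par z = y ∨ par y = z)

/-- The root is its own parent, so `z ≠ y` excludes that `y` is the root. -/
theorem IsLevelTree.depth_of_par_eq (h : H.IsLevelTree u d par) {y z : V} (hy : d y ≠ 0)
    (hzy : z ≠ y) (hp : par y = z) : d y = d z + 1 := by
  subst hp
  exact (h.step y hy fun hu => hzy (by rw [hu, h.par_root])).2.2

/-- Follow parents up to the root. That all edges of the walk are parent edges is what later keeps a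
non-tree edge off it. -/
theorem IsLevelTree.exists_walk (h : H.IsLevelTree u d par) {z : V} (hz : d z ≠ 0) :
    ∃ W : H.Walk u z, W.length + 1 = d z ∧
      ∀ e ∈ W.edges, ∃ y, e = s(par y, y) := by
  induction hn : d z using Nat.strong_induction_on generalizing z with
  | _ n ih =>
  by_cases hzu : z = u
  · subst hzu
    exact ⟨.nil, by simp [← hn, h.root], by simp⟩
  · obtain ⟨h₁, h₂, h₃⟩ := h.step z hz hzu
    obtain ⟨W, hW, he⟩ := ih _ (by omega) h₁ rfl
    refine ⟨W.concat h₂, by simp; omega, fun e he' => ?_⟩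
    rw [Walk.edges_concat, List.concat_eq_append, List.mem_append] at he'
    rcases he' with he' | he'
    · exact he e he'
    · exact ⟨z, by simpa using he'⟩

theorem IsLevelTree.reachable (h : H.IsLevelTree u d par) {z : V} (hz : d z ≠ 0) :
    H.Reachable u z := (h.exists_walk hz).elim fun W _ => W.reachable

/-- An edge outside the tree closes a cycle. -/
theorem IsLevelTree.exists_isCycle (h : H.IsLevelTree u d par) {x y : V} (hx : d x ≠ 0)
    (hy : d y ≠ 0) (hxy : H.Adj x y) (h₁ : par x ≠ y) (h₂ : par y ≠ x) :
    ∃ (a : V) (c : H.Walk a a), c.IsCycle ∧ c.length ≤ d x + d y - 1 := by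
  classical
  obtain ⟨W₁, l₁, e₁⟩ := h.exists_walk hx
  obtain ⟨W₂, l₂, e₂⟩ := h.exists_walk hy
  let W := W₂.reverse.append W₁
  have hW : s(x, y) ∉ W.edges := by
    intro hmem
    have : s(x, y) ∈ W₂.edges ∨ s(x, y) ∈ W₁.edges := by simpa [W] using hmem
    obtain ⟨z, hz⟩ := this.elim (e₂ _) (e₁ _)
    rcases Sym2.eq_iff.1 hz with ⟨rfl, rfl⟩ | ⟨rfl, rfl⟩
    · exact h₂ rfl
    · exact h₁ rfl
  -- The walk from `y` through the root to `x` uses parent edges only, hence not the edge `xy`;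
  -- shortened to a path, it closes a cycle with that edge.
  refine ⟨x, .cons hxy W.toPath, W.toPath.cons_isCycle hxy fun hm => hW ?_, ?_⟩
  · exact W.edges_toPath_subset_edges hm
  · have := W.length_bypass_le_length
    simp only [Walk.length_cons, Walk.toPath, W, Walk.length_append, Walk.length_reverse] at *
    omega

/-- The edges of a cycle do not all belong to the tree. -/
theorem IsLevelTree.not_isCycle (h : H.IsLevelTree u d par) {a : V} {c : H.Walk a a}
    (hc : c.IsCycle) (he : ∀ x y, s(x, y) ∈ c.edges → d x ≠ 0 ∧ (par x = y ∨ par y = x)) :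
    False := by
  classical
  -- At a vertex of maximal depth both neighbors on the cycle would have to be its parent.
  obtain ⟨z, hz, hmax⟩ := c.support.toFinset.exists_max_image d ⟨a, by simp⟩
  rw [List.mem_toFinset] at hz
  have key (y : V) (hy : s(z, y) ∈ c.edges) : par z = y := by
    refine (he z y hy).2.resolve_right fun hp => ?_
    have hyz := (he y z (Sym2.eq_swap ▸ hy)).1
    have hadj := c.adj_of_mem_edges hy
    have := h.depth_of_par_eq hyz hadj.ne hp
    have := hmax y (by simpa using c.snd_mem_support_of_mem_edges hy)
    omega
  have hc' := hc.rotate hz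
  refine hc'.snd_ne_penultimate ((key _ ?_).symm.trans (key _ ?_))
  · exact (c.rotate_edges z hz).mem_iff.1 (Walk.mk_start_snd_mem_edges hc'.not_nil)
  · rw [Sym2.eq_swap]
    exact (c.rotate_edges z hz).mem_iff.1 (Walk.mk_penultimate_end_mem_edges hc'.not_nil)

/-- Along a scanned edge the depth grows by at most one. The bound is `i + 1` because the root has
value `1`; past its end a walk is constant, so its length does not matter. -/
theorem IsLevelTree.depth_getVert_le (h : H.IsLevelTree u d par) {t : ℕ}
    (hs : ∀ z, d z ≠ 0 → d z ≤ t → H.IsScanned d par z) {v : V} (W : H.Walk u v) {i : ℕ}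
    (hi : i ≤ t) : d (W.getVert i) ≠ 0 ∧ d (W.getVert i) ≤ i + 1 := by
  induction i with
  | zero => simp [h.root]
  | succ i ih =>
    obtain ⟨h₁, h₂⟩ := ih (by omega)
    by_cases hl : i < W.length
    · have hadj := W.adj_getVert_succ hl
      obtain ⟨h₃, h₄⟩ := hs _ h₁ (by omega) _ hadj
      refine ⟨h₃, ?_⟩
      rcases h₄ with h₄ | h₄
      · have := h.depth_of_par_eq h₁ hadj.ne' h₄
        omega
      · have := h.depth_of_par_eq h₃ hadj.ne h₄
        omega
    · rw [W.getVert_of_length_le (by omega)] at *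
      exact ⟨h₁, by omega⟩

/-- If all vertices of depth less than `t` are scanned, then a cycle of length at most `2 * t + 1`
through the root has length `2 * t + 1`, and the edge opposite to the root joins two vertices of
depth `t`. -/
theorem IsLevelTree.antipodal_edge (h : H.IsLevelTree u d par) {t : ℕ}
    (hs : ∀ z, d z ≠ 0 → d z ≤ t → H.IsScanned d par z) {c : H.Walk u u} (hc : c.IsCycle)
    (hl : c.length ≤ 2 * t + 1) :
    c.length = 2 * t + 1 ∧ ∃ v w, H.Adj v w ∧ d v = t + 1 ∧ d w = t + 1 := by
  have hfw {i : ℕ} (hi : i ≤ t) := h.depth_getVert_le hs c hi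
  have hbw {i : ℕ} (hi : i ≤ c.length) (hi' : c.length - i ≤ t) :
      d (c.getVert i) ≠ 0 ∧ d (c.getVert i) ≤ c.length - i + 1 := by
    have := h.depth_getVert_le hs c.reverse hi'
    rwa [Walk.getVert_reverse, Nat.sub_sub_self hi] at this
  -- If the conclusion fails, every edge of the cycle turns out to be a tree edge.
  by_contra hcon
  refine h.not_isCycle hc fun x y hxy => ?_
  suffices ∀ i < c.length, d (c.getVert i) ≠ 0 ∧ d (c.getVert (i + 1)) ≠ 0 ∧
      (par (c.getVert i) = c.getVert (i + 1) ∨ par (c.getVert (i + 1)) = c.getVert i) by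
    obtain ⟨i, hi, hxy⟩ := (c.mk_mem_edges_iff_exists).1 hxy
    obtain ⟨h₁, h₂, h₃⟩ := this i hi
    rcases Sym2.eq_iff.1 hxy with ⟨rfl, rfl⟩ | ⟨rfl, rfl⟩
    · exact ⟨h₁, h₃⟩
    · exact ⟨h₂, h₃.symm⟩
  intro i hi
  have hadj := c.adj_getVert_succ hi
  have fw (hz : d (c.getVert i) ≠ 0) (hz' : d (c.getVert i) ≤ t) := hs _ hz hz' _ hadj
  have bw (hz : d (c.getVert (i + 1)) ≠ 0) (hz' : d (c.getVert (i + 1)) ≤ t) :=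
    hs _ hz hz' _ hadj.symm
  by_cases h₁ : i < t
  · have := hfw h₁.le
    exact ⟨this.1, fw this.1 (by omega)⟩
  by_cases h₂ : c.length - (i + 1) < t
  · have := hbw (i := i + 1) hi h₂.le
    have h' := bw this.1 (by omega)
    exact ⟨h'.1, this.1, h'.2.symm⟩
  -- The first `t` edges have a scanned end as seen from the start, and the last `t` edges as seen
  -- backwards. Any other edge forces length `2 * t + 1` and is the middle one, with both ends of
  -- value at most `t + 1`; if one end is lower, it has been scanned.
  have hi' : i = t := by omega
  have f := hfw hi'.le
  have b := hbw (i := i + 1) hi (by omega)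
  by_cases h₃ : d (c.getVert i) ≤ t
  · exact ⟨f.1, fw f.1 h₃⟩
  by_cases h₄ : d (c.getVert (i + 1)) ≤ t
  · have h' := bw b.1 h₄
    exact ⟨h'.1, b.1, h'.2.symm⟩
  exact (hcon ⟨by omega, _, _, hadj, by omega, by omega⟩).elim

end SimpleGraph

end

/-! ### The girth from truncated breadth-first searches -/

namespace SimpleGraph

variable {V : Type*} {G : SimpleGraph V} {S : Finset V} {u : V}

/-- The graph `G` for `m = 1`, and `G` without the edges at vertices of `S` for other `m`. -/
def modeGraph (G : SimpleGraph V) (S : Finset V) (m : ℕ) : SimpleGraph V where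
  Adj u v := G.Adj u v ∧ (m = 1 ∨ u ∉ S ∧ v ∉ S)
  symm := ⟨fun _ _ h => ⟨h.1.symm, h.2.imp_right And.symm⟩⟩
  loopless := ⟨fun _ h => h.1.ne rfl⟩

theorem modeGraph_le (m : ℕ) : G.modeGraph S m ≤ G := fun _ _ h => h.1

theorem notMem_of_reachable {v : V} (hu : u ∉ S) (h : (G.modeGraph S 0).Reachable u v) :
    v ∉ S := by
  obtain ⟨W⟩ := h
  induction W with
  | nil => exact hu
  | cons h _ ih => exact ih (h.2.resolve_left zero_ne_one).2

variable [DecidableEq V]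

/-- The mode of a source `u`: all of `G` for `u ∈ S`, and `G - S` otherwise. -/
def mode (S : Finset V) (u : V) : ℕ := if u ∈ S then 1 else 0

/-- The outcome of a breadth-first search from `u` that was stopped at an edge which closes a cycle
of length at least `b` (where `b = 0` means that no cycle was found). -/
def IsBfsRow (G : SimpleGraph V) (S : Finset V) (b : ℕ) (u : V) (d : V → ℕ) : Prop :=
  ∃ par, (G.modeGraph S (mode S u)).IsLevelTree u d par ∧
    ∀ z, d z ≠ 0 → (b = 0 ∨ 2 * d z < b) → (G.modeGraph S (mode S u)).IsScanned d par z

/-- A cycle that meets `S` is rotated to start in `S`, where the search sees all of `G`; any other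
cycle survives in `G - S`. -/
theorem exists_cycle_modeGraph {a : V} {c : G.Walk a a} (hc : c.IsCycle) :
    ∃ (u : V) (c' : (G.modeGraph S (mode S u)).Walk u u), c'.IsCycle ∧ c'.length = c.length := by
  by_cases h : ∃ u ∈ c.support, u ∈ S
  · obtain ⟨u, hu, huS⟩ := h
    have hG (e) (he : e ∈ (c.rotate u hu).edges) : e ∈ (G.modeGraph S (mode S u)).edgeSet := by
      have := Walk.edges_subset_edgeSet _ he
      induction e with | _ x y
      exact ⟨this, .inl (by simp [mode, huS])⟩
    exact ⟨u, _, (hc.rotate hu).transfer hG, by simp⟩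
  · push Not at h
    have hG (e) (he : e ∈ c.edges) : e ∈ (G.modeGraph S (mode S a)).edgeSet := by
      have := Walk.edges_subset_edgeSet _ he
      induction e with | _ x y
      exact ⟨this, .inr ⟨h _ (c.fst_mem_support_of_mem_edges he),
        h _ (c.snd_mem_support_of_mem_edges he)⟩⟩
    exact ⟨a, _, hc.transfer hG, by simp⟩

theorem IsBfsRow.mem_of_ne_zero {b : ℕ} {d : V → ℕ} (h : G.IsBfsRow S b u d) {v : V}
    (hv : d v ≠ 0) : u ∈ S ∨ (G.modeGraph S 0).Reachable u v := by
  obtain ⟨par, ht, -⟩ := h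
  refine or_iff_not_imp_left.2 fun hu => ?_
  have := ht.reachable hv
  rwa [mode, if_neg hu] at this

variable {b : ℕ} {D : V → V → ℕ}

/-- If `b` were `0` or larger than `2 * t`, all vertices of value at most `t` would be scanned, and
a cycle of length at most `2 * t` through a root would have to have length `2 * t + 1`. -/
theorem IsBfsRow.le_of_isCycle (h : ∀ u, G.IsBfsRow S b u (D u)) {a : V} {c : G.Walk a a}
    (hc : c.IsCycle) {t : ℕ} (hl : c.length ≤ 2 * t) : b ≠ 0 ∧ b ≤ 2 * t := by
  by_contra hcon
  obtain ⟨u, c', hc', hl'⟩ := exists_cycle_modeGraph (S := S) hc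
  obtain ⟨par, ht, hs⟩ := h u
  have := (ht.antipodal_edge (t := t) (fun z hz hz' => hs z hz (by omega)) hc' (by omega)).1
  omega

/-- The girth `g` satisfies `g ≤ b`, and `b` is at most `g` rounded up to an even number. So `b =
g`, or `b = g + 1` with `g` odd. In the latter case a shortest cycle has, opposite to a root on it,
an edge with both ends at value `b / 2`; conversely such an edge closes a cycle of length at most `b
- 1`. -/
theorem girth_eq_of_isBfsRow (h : ∀ u, G.IsBfsRow S b u (D u))
    (hb : b ≠ 0 → ∃ (a : V) (c : G.Walk a a), c.IsCycle ∧ c.length ≤ b) :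
    (b = 0 ∨ b % 2 = 1 → G.girth = b) ∧ (b ≠ 0 → b % 2 = 0 →
      ((∃ u v w, D u v = b / 2 ∧ D u w = b / 2 ∧ G.Adj v w) → G.girth = b - 1) ∧
      ((¬ ∃ u v w, D u v = b / 2 ∧ D u w = b / 2 ∧ G.Adj v w) → G.girth = b)) := by
  by_cases hb0 : b = 0
  · subst hb0
    refine ⟨fun _ => girth_eq_zero.2 fun a c hc => ?_, fun h => absurd rfl h⟩
    exact (IsBfsRow.le_of_isCycle h hc (t := c.length) (by omega)).1 rfl
  obtain ⟨a, c, hc, hl⟩ := hb hb0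
  have hG : ¬ G.IsAcyclic := fun h => h c hc
  have hle := (G.girth_le_length hc).trans hl
  obtain ⟨a', c', hc', hl'⟩ := exists_girth_eq_length.2 hG
  have hle' (t : ℕ) (ht : G.girth ≤ 2 * t) := (IsBfsRow.le_of_isCycle h hc' (hl' ▸ ht)).2
  -- The first choice of `t` is effective for even girth, the second for odd girth.
  have h1 := hle' (G.girth / 2)
  have h2 := hle' ((G.girth + 1) / 2)
  refine ⟨by omega, fun _ heven => ⟨?_, fun hcon => ?_⟩⟩
  · rintro ⟨u, v, w, hv, hw, hvw⟩
    obtain ⟨par, ht, -⟩ := h u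
    have hadj : (G.modeGraph S (mode S u)).Adj v w := by
      refine ⟨hvw, ?_⟩
      by_cases hu : u ∈ S
      · exact .inl (if_pos hu)
      · exact .inr ⟨notMem_of_reachable hu (((h u).mem_of_ne_zero (by omega)).resolve_left hu),
          notMem_of_reachable hu (((h u).mem_of_ne_zero (by omega)).resolve_left hu)⟩
    obtain ⟨a, c, hc, hl⟩ := ht.exists_isCycle (x := v) (y := w) (by omega) (by omega) hadj
      (fun hp => by have := ht.depth_of_par_eq (by omega) hadj.ne' hp; omega)
      (fun hp => by have := ht.depth_of_par_eq (by omega) hadj.ne hp; omega)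
    have := G.girth_le_length (hc.mapLe (modeGraph_le _))
    rw [Walk.length_mapLe] at this
    omega
  · by_contra hne
    obtain ⟨u, c'', hc'', hl''⟩ := exists_cycle_modeGraph (S := S) hc'
    obtain ⟨par, ht, hs⟩ := h u
    -- With `t = b / 2 - 1` the length `2 * t + 1` is `b - 1`, and the value `t + 1` is `b / 2`.
    obtain ⟨-, v, w, hvw, hv, hw⟩ := ht.antipodal_edge (t := b / 2 - 1)
      (fun z hz hz' => hs z hz (by omega)) hc'' (by omega)
    exact hcon ⟨u, v, w, by omega, by omega, hvw.1⟩

end SimpleGraph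

section

open WordRAM

/-! ## Naive matrix multiplication -/

/-- The program that adds up all products of entries, with the number `n` in variable `0`.
Variable `1` is the counter. -/
def naiveMatMul : Program :=
  loopWhile (.var 1 <ₑ .var 0 *ₑ .var 0 *ₑ .var 0) <|
    st 2 (.var 1 /ₑ .var 0) (.ld 2 (.var 1 /ₑ .var 0) +ₑ
      .ld 0 (.var 1 /ₑ .var 0 /ₑ .var 0 *ₑ .var 0 +ₑ .var 1 %ₑ .var 0) *ₑ
      .ld 1 (.var 1 %ₑ .var 0 *ₑ .var 0 +ₑ .var 1 /ₑ .var 0 %ₑ .var 0)) ;;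
    asg 1 (.var 1 +ₑ .lit 1)

/-- The sum of the terms with an index below `p`. -/
def partialSum (f : ℕ → ℕ → ℕ) (n p q : ℕ) : ℕ :=
  ∑ l ∈ Finset.range n, if q * n + l < p then f q l else 0

/-- A single counter `p` runs over all products: it stands for the term `p % n` of the entry `p /
n`. -/
theorem partialSum_succ (f : ℕ → ℕ → ℕ) {n p : ℕ} (hn : 0 < n) (q : ℕ) :
    partialSum f n (p + 1) q =
      if q = p / n then partialSum f n p q + f (p / n) (p % n) else partialSum f n p q := by
  have hp := Nat.div_add_mod' p n
  have hlt := Nat.mod_lt p hn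
  split_ifs with h
  · subst h
    rw [partialSum, partialSum, ← Finset.sum_erase_add _ _ (Finset.mem_range.2 hlt),
      ← Finset.sum_erase_add (Finset.range n) (fun l => if p / n * n + l < p then _ else 0)
        (Finset.mem_range.2 hlt)]
    rw [if_pos (by omega), if_neg (by omega), add_zero]
    congr 1
    refine Finset.sum_congr rfl fun l hl => ?_
    have := Finset.ne_of_mem_erase hl
    exact if_congr (by omega) rfl rfl
  · refine Finset.sum_congr rfl fun l hl => if_congr ?_ rfl rfl
    have hl := Finset.mem_range.1 hl
    refine ⟨fun h' => lt_of_le_of_ne (by omega) fun h'' => h ?_, fun _ => by omega⟩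
    rw [← h'', mul_comm, Nat.mul_add_div hn, Nat.div_eq_of_lt hl, add_zero]

theorem partialSum_le (f : ℕ → ℕ → ℕ) {n p q B : ℕ} (hf : ∀ l < n, f q l ≤ B) :
    partialSum f n p q ≤ n * B := by
  refine (Finset.sum_le_card_nsmul _ _ B fun l hl => ?_).trans (by simp)
  split_ifs
  · exact hf l (Finset.mem_range.1 hl)
  · exact Nat.zero_le _

theorem view_matMulInput {n : ℕ} (A B : Matrix (Fin n) (Fin n) ℕ) :
    view (matMulInput A B) = matMulInput A B := by
  ext <;> simp [view, matMulInput]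

theorem matMulInput_mem {n : ℕ} (A B : Matrix (Fin n) (Fin n) ℕ) (i j : Fin n) (x : ℕ) :
    (matMulInput A B).mem x (i * n + j) =
      if x = 0 then A i j else if x = 1 then B i j else 0 := by
  have h' : (i * n + j : ℕ) < n * n := by
    simpa [mul_comm, add_comm] using (finProdFinEquiv (i, j)).2
  have h : finProdFinEquiv.symm ⟨i * n + j, h'⟩ = (i, j) := by
    rw [Equiv.symm_apply_eq]
    ext
    simp [mul_comm, add_comm]
  simp only [matMulInput, dif_pos h', h]

theorem naiveMatMul_wp {n B' M : ℕ} (hn : 0 < n) (A B : Matrix (Fin n) (Fin n) ℕ)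
    (hA : ∀ i j, A i j ≤ M) (hB : ∀ i j, B i j ≤ M) (hw : (n + 1) ^ 3 + (n + 1) * (M * M) ≤ B') :
    WP B' naiveMatMul (fun s _ => ∀ i j : Fin n, s.mem 2 (finProdFinEquiv (i, j)) = (A * B) i j)
      (matMulInput A B) (100 * n ^ 3 + 100) := by
  set s₀ := matMulInput A B with hs₀
  let f : ℕ → ℕ → ℕ := fun q l => s₀.mem 0 (q / n * n + l) * s₀.mem 1 (l * n + q % n)
  have hM (x p : ℕ) : s₀.mem x p ≤ M := by
    simp only [hs₀, matMulInput]
    split_ifs <;> simp [hA, hB]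
  have hf (q l : ℕ) : f q l ≤ M * M := Nat.mul_le_mul (hM _ _) (hM _ _)
  refine WP.loopWhile (fun s T => ∃ p ≤ n * n * n, s.reg 0 = n ∧ s.reg 1 = p ∧
    (∀ i, s.mem 0 i = s₀.mem 0 i) ∧ (∀ i, s.mem 1 i = s₀.mem 1 i) ∧
    (∀ q, s.mem 2 q = partialSum f n p q) ∧ 100 * n ^ 3 + 100 ≤ T + 100 * p) ?_ ?_
  · refine ⟨0, by simp, by simp [hs₀, matMulInput], by simp [hs₀, matMulInput], fun _ => rfl,
      fun _ => rfl, fun q => ?_, by simp⟩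
    simp [partialSum, hs₀, matMulInput]
  · rintro s T ⟨p, hp, h0, h1, hm0, hm1, hm2, hT⟩
    have e3 : n ^ 3 = n * n * n := by ring
    have hw3 : n * n * n + (n + 1) * (M * M) < B' := by
      refine lt_of_lt_of_le ?_ hw
      gcongr
      rw [← e3]
      exact Nat.pow_lt_pow_left (by omega) (by omega)
    have hnn : n * n ≤ n * n * n := Nat.le_mul_of_pos_right _ hn
    have hn1 : n ≤ n * n := Nat.le_mul_of_pos_right _ hn
    refine ⟨?_, ?_, fun he => ?_, fun he => ?_⟩
    · simp only [Ex.Fits, Ex.eval, BinOp.eval, h0, h1, true_and]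
      refine ⟨⟨by omega, by omega⟩, ?_⟩
      split_ifs <;> omega
    · simp [Ex.cost]; omega
    · have hlt : p < n * n * n := by
        by_contra h
        simp [Ex.eval, BinOp.eval, h0, h1, h] at he
      have hdm := Nat.div_add_mod' p n
      have hmod := Nat.mod_lt p hn
      have hdiv := Nat.div_le_self p n
      have hdm' := Nat.div_add_mod' (p / n) n
      have hdiv' := Nat.div_le_self (p / n) n
      have hmod' := Nat.mod_lt (p / n) hn
      have hle : p / n + p % n ≤ p := by
        have := Nat.le_mul_of_pos_right (p / n) hn
        omega
      have hcol : p % n * n + p / n % n < n * n := by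
        have := Nat.mul_le_mul_right n (Nat.succ_le_of_lt hmod)
        rw [Nat.succ_mul] at this
        omega
      have hps : partialSum f n p (p / n) ≤ n * (M * M) := partialSum_le f fun _ _ => hf _ _
      have hff := hf (p / n) (p % n)
      have hMM : (n + 1) * (M * M) = n * (M * M) + M * M := Nat.succ_mul ..
      refine WP.seq (WP.st (p / n) (partialSum f n p (p / n) + f (p / n) (p % n)) ?_ ?_ ?_ ?_ ?_
        (WP.asg (p + 1) ?_ ?_ ?_ ⟨p + 1, hlt, ?_⟩))
      · simp [Ex.eval, BinOp.eval, h0, h1]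
      · simp [Ex.eval, BinOp.eval, h0, h1, hm0, hm1, hm2, f]
      · simp only [Ex.Fits, Ex.eval, BinOp.eval, h0, h1, true_and]
        omega
      · simp only [Ex.Fits, Ex.eval, BinOp.eval, h0, h1, hm0, hm1, hm2, true_and]
        refine ⟨by omega, ⟨⟨⟨by omega, by omega⟩, by omega, by omega⟩,
          ⟨⟨by omega, by omega⟩, by omega, by omega⟩, ?_⟩, ?_⟩
        · exact lt_of_le_of_lt hff (by omega)
        · exact lt_of_le_of_lt (Nat.add_le_add hps hff) (by omega)
      · simp only [Ex.cost]
        omega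
      · simp [Ex.eval, BinOp.eval, h1, State.reg_setMem]
      · simp only [AsgFits, Ex.Fits, Ex.eval, BinOp.eval, h1, true_and, State.reg_setMem]
        omega
      · simp only [Ex.cost]
        omega
      · simp only [State.reg_setReg, State.reg_setMem, State.mem_setReg, State.mem_setMem, h0]
        refine ⟨by simp, by simp, by simpa using hm0, by simpa using hm1, fun q => ?_, ?_⟩
        · rw [partialSum_succ f hn]
          by_cases hq : q = p / n <;> simp [hq, hm2]
        · simp only [Ex.cost]
          omega
    · have hlt : p = n * n * n := by
        by_contra h
        have : p < n * n * n := by omega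
        simp [Ex.eval, BinOp.eval, h0, h1, this] at he
      intro i j
      have hij : (finProdFinEquiv (i, j) : ℕ) = i * n + j := by simp [mul_comm, add_comm]
      have hq : (i * n + j : ℕ) < n * n := by
        rw [← hij]
        exact (finProdFinEquiv (i, j)).2
      have hi : (i * n + j : ℕ) / n = i := by
        rw [mul_comm, Nat.mul_add_div hn, Nat.div_eq_of_lt j.2, add_zero]
      have hj : (i * n + j : ℕ) % n = j := by
        rw [mul_comm, Nat.mul_add_mod, Nat.mod_eq_of_lt j.2]
      rw [hij, hm2, Matrix.mul_apply, partialSum, Finset.sum_range]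
      refine Finset.sum_congr rfl fun l _ => ?_
      have : (i * n + j : ℕ) * n + l < p := by
        have := Nat.mul_le_mul_right n (Nat.succ_le_of_lt hq)
        rw [Nat.succ_mul] at this
        have := l.2
        omega
      rw [if_pos this]
      simp only [f, hi, hj, hs₀, matMulInput_mem, if_true, one_ne_zero, if_false]

theorem WordRAM.WP.exec {w : ℕ} {p : Program} {Q : State → ℕ → Prop} {s : State} {T : ℕ}
    (hs : view s = s) (h : WP (2 ^ w) p Q s T) :
    ∃ t s' T', Exec w p s t s' ∧ t ≤ T ∧ Q (view s') T' :=
  let ⟨t, s', T', h₁, h₂, h₃⟩ := h w rfl s hs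
  ⟨t, s', T', h₁, by omega, h₃⟩

/-- Needed only so that the infimum defining the exponent is over a nonempty set. The word size
leaves room for a sum of `n` products of size `n ^ (2 * d)` and for the counter up to `n ^ 3`. -/
theorem matMulInTime_three : MatMulInTime 3 := by
  intro d
  refine ⟨naiveMatMul, 2 * d + 5, 200, fun n hn A B hA hB => ?_⟩
  have hw : (n + 1) ^ 3 + (n + 1) * (n ^ d * n ^ d) ≤ 2 ^ wordSize (2 * d + 5) n := by
    refine le_trans ?_ (pow_le_two_pow_wordSize _ _)
    have h1 : (n + 1) ^ 3 ≤ (n + 1) ^ (2 * d + 4) := Nat.pow_le_pow_right (by omega) (by omega)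
    have h2 : (n + 1) * (n ^ d * n ^ d) ≤ (n + 1) ^ (2 * d + 4) := by
      calc (n + 1) * (n ^ d * n ^ d) ≤ (n + 1) * ((n + 1) ^ d * (n + 1) ^ d) := by gcongr <;> omega
        _ = (n + 1) ^ (2 * d + 1) := by ring
        _ ≤ _ := Nat.pow_le_pow_right (by omega) (by omega)
    calc _ ≤ (n + 1) ^ (2 * d + 4) * 2 := by omega
      _ ≤ (n + 1) ^ (2 * d + 4) * (n + 1) := by gcongr; omega
      _ = _ := by ring
  obtain ⟨t, s, -, h₁, h₂, h₃⟩ :=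
    (naiveMatMul_wp hn A B hA hB hw).exec (view_matMulInput A B)
  refine ⟨t, s, h₁, ?_, h₃⟩
  have : 1 ≤ n ^ 3 := Nat.one_le_pow _ _ hn
  have h₂' : t ≤ 200 * n ^ 3 := by omega
  calc (t : ℝ) ≤ 200 * n ^ 3 := by exact_mod_cast h₂'
    _ = _ := by norm_cast

/-- A program changes at most as many entries of an array as it takes steps. -/
theorem WordRAM.Exec.exists_finset {w : ℕ} {p : Program} {s s' : State} {t : ℕ}
    (h : Exec w p s t s') (x : ℕ) :
    ∃ F : Finset ℕ, F.card ≤ t ∧ ∀ i ∉ F, s'.mem x i = s.mem x i := by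
  induction h with
  | skip | const | op | load | loop_false => exact ⟨∅, by simp, fun _ _ => rfl⟩
  | store s y i r =>
    refine ⟨{s.reg i}, by simp, fun j hj => ?_⟩
    rw [State.mem_setMem, if_neg fun h => hj (by simp [h.2])]
  | seq _ _ ih₁ ih₂ =>
    obtain ⟨F₁, c₁, h₁⟩ := ih₁
    obtain ⟨F₂, c₂, h₂⟩ := ih₂
    refine ⟨F₁ ∪ F₂, (Finset.card_union_le ..).trans (by omega), fun i hi => ?_⟩
    rw [Finset.notMem_union] at hi
    rw [h₂ i hi.2, h₁ i hi.1]
  | ite_true _ _ ih | ite_false _ _ ih =>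
    obtain ⟨F, c, h⟩ := ih
    exact ⟨F, by omega, h⟩
  | loop_true _ _ _ ih₁ ih₂ =>
    obtain ⟨F₁, c₁, h₁⟩ := ih₁
    obtain ⟨F₂, c₂, h₂⟩ := ih₂
    refine ⟨F₁ ∪ F₂, (Finset.card_union_le ..).trans (by omega), fun i hi => ?_⟩
    rw [Finset.notMem_union] at hi
    rw [h₂ i hi.2, h₁ i hi.1]

/-- The product of two all-ones matrices has `n * n` nonzero entries, and the output array is
initially zero, so at least `n * n` steps are needed. This is what makes `k * n` at most `k ^ (τ -
1) * n` later. -/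
theorem MatMulInTime.two_le {τ : ℝ} (h : MatMulInTime τ) : 2 ≤ τ := by
  by_contra! hτ
  obtain ⟨P, c, C, hP⟩ := h 0
  have key (n : ℕ) (hn : 0 < n) : (n : ℝ) ^ (2 - τ) ≤ C := by
    obtain ⟨t, s, he, ht, hs⟩ := hP n hn (.of fun _ _ => 1) (.of fun _ _ => 1)
      (by simp) (by simp)
    obtain ⟨F, hF, hs'⟩ := he.exists_finset 2
    have hsub : Finset.range (n * n) ⊆ F := by
      intro p hp
      by_contra hpF
      have h1 := hs' p hpF
      obtain ⟨ij, hij⟩ := finProdFinEquiv.surjective (⟨p, Finset.mem_range.1 hp⟩ : Fin (n * n))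
      have h2 := hs ij.1 ij.2
      rw [Prod.mk.eta, hij, h1, Matrix.mul_apply] at h2
      simp [matMulInput] at h2
      omega
    have hcard : n * n ≤ t := by
      simpa using (Finset.card_le_card hsub).trans hF
    have hn' : (0 : ℝ) < n := by exact_mod_cast hn
    rw [Real.rpow_sub hn', div_le_iff₀ (Real.rpow_pos_of_pos hn' τ), Real.rpow_two, sq]
    exact le_trans (by exact_mod_cast hcard) ht
  have hlim := (tendsto_rpow_atTop (sub_pos.2 hτ)).comp tendsto_natCast_atTop_atTop
  obtain ⟨n, hn, hn'⟩ := ((hlim.eventually_gt_atTop C).and (Filter.eventually_gt_atTop 0)).exists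
  exact absurd (key n hn') (not_le.2 hn)

end

namespace WordRAM

/-! ## Running a program inside another one -/

/-- The program `p` with its memory moved to the arrays with index at least `20`: with the number
`j < R` of the run in variable `jv` and `R` in variable `Rv`, register `r` becomes the entry `j` of
the array `2 * r + 21`, and entry `i` of the array `x` becomes the entry `i * R + j` of the array
`2 * x + 20`.  Different runs do not share memory. -/
def embed (jv Rv : ℕ) : Program → Program
  | .skip => .skip
  | .const r c => st (2 * r + 21) (.var jv) (.lit c)
  | .op o r a b => st (2 * r + 21) (.var jv)
      (.op o (.ld (2 * a + 21) (.var jv)) (.ld (2 * b + 21) (.var jv)))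
  | .load r x i => st (2 * r + 21) (.var jv)
      (.ld (2 * x + 20) (.ld (2 * i + 21) (.var jv) *ₑ .var Rv +ₑ .var jv))
  | .store x i r => st (2 * x + 20) (.ld (2 * i + 21) (.var jv) *ₑ .var Rv +ₑ .var jv)
      (.ld (2 * r + 21) (.var jv))
  | .seq p q => .seq (embed jv Rv p) (embed jv Rv q)
  | .ite r p q => cond (.ld (2 * r + 21) (.var jv)) (embed jv Rv p) (embed jv Rv q)
  | .loop r p => loopWhile (.ld (2 * r + 21) (.var jv)) (embed jv Rv p)

/-- The state `s'` contains `s` as the memory of the embedded run number `j`. -/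
structure Simulates (jv Rv j R : ℕ) (s s' : State) : Prop where
  hj : s'.reg jv = j
  hR : s'.reg Rv = R
  reg : ∀ r, s'.mem (2 * r + 21) j = s.reg r
  mem : ∀ x i, s'.mem (2 * x + 20) (i * R + j) = s.mem x i

/-- The part of the memory that the embedded run number `j` does not touch. -/
structure AgreeOutside (j R : ℕ) (s s' : State) : Prop where
  reg : s'.reg = s.reg
  low : ∀ x < 20, s'.mem x = s.mem x
  high : ∀ x i, i % R ≠ j → s'.mem x i = s.mem x i

theorem AgreeOutside.refl (j R : ℕ) (s : State) : AgreeOutside j R s s :=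
  ⟨rfl, fun _ _ => rfl, fun _ _ _ => rfl⟩

theorem AgreeOutside.trans {j R : ℕ} {s s' s'' : State} (h : AgreeOutside j R s s')
    (h' : AgreeOutside j R s' s'') : AgreeOutside j R s s'' :=
  ⟨h'.reg.trans h.reg, fun x hx => (h'.low x hx).trans (h.low x hx),
    fun x i hi => (h'.high x i hi).trans (h.high x i hi)⟩

theorem agreeOutside_setMem {j R x i v : ℕ} (s : State) (hx : 20 ≤ x) (hi : i % R = j) :
    AgreeOutside j R s (s.setMem x i v) := by
  refine ⟨rfl, fun y hy => funext fun k => ?_, fun y k hk => ?_⟩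
  · rw [State.mem_setMem, if_neg (by omega)]
  · rw [State.mem_setMem, if_neg]
    rintro ⟨-, rfl⟩
    exact hk hi

theorem Simulates.setReg {jv Rv j R r v : ℕ} {s s' : State} (h : Simulates jv Rv j R s s') :
    Simulates jv Rv j R (s.setReg r v) (s'.setMem (2 * r + 21) j v) := by
  refine ⟨h.hj, h.hR, fun r' => ?_, fun x i => ?_⟩
  · rw [State.mem_setMem, State.reg_setReg, h.reg]
    exact if_congr (by omega) rfl rfl
  · rw [State.mem_setMem, if_neg (by omega), h.mem]
    rfl

theorem Simulates.setMem {jv Rv j R x i v : ℕ} {s s' : State} (h : Simulates jv Rv j R s s')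
    (hR : 0 < R) :
    Simulates jv Rv j R (s.setMem x i v) (s'.setMem (2 * x + 20) (i * R + j) v) := by
  refine ⟨h.hj, h.hR, fun r' => ?_, fun y k => ?_⟩
  · rw [State.mem_setMem, if_neg (by omega), h.reg]
    rfl
  · rw [State.mem_setMem, State.mem_setMem, h.mem]
    refine if_congr ⟨fun h => ⟨by omega, Nat.eq_of_mul_eq_mul_right hR (by omega)⟩, ?_⟩ rfl rfl
    rintro ⟨rfl, rfl⟩
    exact ⟨rfl, rfl⟩

/-- All registers and array entries are less than `B`. -/
structure State.BoundedBy (s : State) (B : ℕ) : Prop where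
  reg : ∀ r, s.reg r < B
  mem : ∀ x i, s.mem x i < B

theorem State.BoundedBy.setReg {s : State} {B r v : ℕ} (h : s.BoundedBy B) (hv : v < B) :
    (s.setReg r v).BoundedBy B := by
  refine ⟨fun r' => ?_, h.mem⟩
  rw [State.reg_setReg]
  split_ifs
  exacts [hv, h.reg r']

theorem State.BoundedBy.setMem {s : State} {B x i v : ℕ} (h : s.BoundedBy B) (hv : v < B) :
    (s.setMem x i v).BoundedBy B := by
  refine ⟨h.reg, fun x' i' => ?_⟩
  rw [State.mem_setMem]
  split_ifs
  exacts [hv, h.mem x' i']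

/-- Loads and stores only move values, and every other result fits into a word. -/
theorem Exec.boundedBy {w B : ℕ} {p : Program} {s s' : State} {t : ℕ} (h : Exec w p s t s')
    (hB : 2 ^ w ≤ B) (hs : s.BoundedBy B) : s'.BoundedBy B := by
  induction h with
  | skip | loop_false => exact hs
  | const s r c hc => exact hs.setReg (hc.trans_le hB)
  | op s o r a b ho => exact hs.setReg (ho.trans_le hB)
  | load s r x i => exact hs.setReg (hs.mem _ _)
  | store s x i r => exact hs.setMem (hs.reg _)
  | seq _ _ ih₁ ih₂ => exact ih₂ (ih₁ hs)
  | ite_true _ _ ih | ite_false _ _ ih => exact ih hs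
  | loop_true _ _ _ ih₁ ih₂ => exact ih₂ (ih₁ hs)

/-- Each step is simulated within ten. All values of the run stay below `M`, so the translated
indices stay below `M * R`. The bound is `M` rather than `2 ^ w₀` because the model does not require
the input to fit into words. -/
theorem Exec.wp_embed {w₀ M B jv Rv j R : ℕ} {p : Program} {s s' : State} {t : ℕ}
    (h : Exec w₀ p s t s') (hs : s.BoundedBy M) (hM : 2 ^ w₀ ≤ M) (hB : M * R ≤ B)
    (hj : j < R) {σ : State} (hsim : Simulates jv Rv j R s σ) {Q : State → ℕ → Prop} {T : ℕ}
    (hT : 10 * t ≤ T)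
    (hQ : ∀ σ', Simulates jv Rv j R s' σ' → AgreeOutside j R σ σ' → Q σ' (T - 10 * t)) :
    WP B (embed jv Rv p) Q σ T := by
  have hR : 0 < R := by omega
  have hMB : M ≤ B := le_trans (Nat.le_mul_of_pos_right _ hR) hB
  have hmod : j % R = j := Nat.mod_eq_of_lt hj
  have hmod' (i : ℕ) : (i * R + j) % R = j := by rw [mul_comm, Nat.mul_add_mod, hmod]
  have hidx {i : ℕ} (hi : i < M) : i * R < B ∧ i * R + j < B := by
    have := Nat.mul_le_mul_right R (Nat.succ_le_of_lt hi)
    rw [Nat.succ_mul] at this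
    omega
  induction h generalizing σ Q T with
  | skip s =>
    -- Surplus credits are discarded in each case, so that every step costs exactly ten.
    exact WP.weaken (T' := T - 9) (WP.skip (by omega)
      (by simpa [Nat.sub_sub] using hQ σ hsim (.refl _ _ _)))
      (by omega)
  | const s r c hc =>
    refine WP.weaken (T' := T - 7) (WP.st j c ?_ ?_ ?_ ?_ ?_ ?_) (by omega)
    · simp [Ex.eval, hsim.hj]
    · simp [Ex.eval]
    · simp [Ex.Fits]
    · exact hc.trans_le (hM.trans hMB)
    · simp [Ex.cost]; omega
    · simpa [Ex.cost, Nat.sub_sub] using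
        hQ _ hsim.setReg (agreeOutside_setMem _ (by omega) hmod)
  | op s o r a b ho =>
    refine WP.weaken (T' := T - 3) (WP.st j (o.eval (s.reg a) (s.reg b)) ?_ ?_ ?_ ?_ ?_ ?_)
      (by omega)
    · simp [Ex.eval, hsim.hj]
    · simp [Ex.eval, hsim.hj, hsim.reg]
    · simp [Ex.Fits]
    · simpa [Ex.Fits, Ex.eval, hsim.hj, hsim.reg] using ho.trans_le (hM.trans hMB)
    · simp [Ex.cost]; omega
    · simpa [Ex.cost, Nat.sub_sub] using
        hQ _ hsim.setReg (agreeOutside_setMem _ (by omega) hmod)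
  | load s r x i =>
    refine WP.weaken (T' := T - 1) (WP.st j (s.mem x (s.reg i)) ?_ ?_ ?_ ?_ ?_ ?_) (by omega)
    · simp [Ex.eval, hsim.hj]
    · simp [Ex.eval, BinOp.eval, hsim.hj, hsim.reg, hsim.hR, hsim.mem]
    · simp [Ex.Fits]
    · simpa [Ex.Fits, Ex.eval, BinOp.eval, hsim.hj, hsim.reg, hsim.hR] using hidx (hs.reg i)
    · simp [Ex.cost]; omega
    · simpa [Ex.cost, Nat.sub_sub] using
        hQ _ hsim.setReg (agreeOutside_setMem _ (by omega) hmod)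
  | store s x i r =>
    refine WP.weaken (T' := T - 1) (WP.st (s.reg i * R + j) (s.reg r) ?_ ?_ ?_ ?_ ?_ ?_) (by omega)
    · simp [Ex.eval, BinOp.eval, hsim.hj, hsim.reg, hsim.hR]
    · simp [Ex.eval, hsim.hj, hsim.reg]
    · simpa [Ex.Fits, Ex.eval, BinOp.eval, hsim.hj, hsim.reg, hsim.hR] using hidx (hs.reg i)
    · simp [Ex.Fits]
    · simp [Ex.cost]; omega
    · simpa [Ex.cost, Nat.sub_sub] using
        hQ _ (hsim.setMem hR) (agreeOutside_setMem _ (by omega) (hmod' _))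
  | seq h₁ h₂ ih₁ ih₂ =>
    refine WP.seq (ih₁ hs hsim (by omega) fun σ₁ hsim₁ ha₁ => ?_)
    refine ih₂ (h₁.boundedBy hM hs) hsim₁ (by omega) fun σ₂ hsim₂ ha₂ => ?_
    rw [Nat.sub_sub, ← mul_add]
    exact hQ _ hsim₂ (ha₁.trans ha₂)
  | @ite_true r p q s s₁ t hr hp ih =>
    refine WP.weaken (T' := T - 7) (WP.cond ?_ ?_ (fun _ => ?_) fun h0 => ?_) (by omega)
    · simp [Ex.Fits]
    · simp [Ex.cost]; omega
    · refine ih hs hsim (by simp [Ex.cost]; omega) fun σ₁ hsim₁ ha₁ => ?_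
      have : T - 7 - ((Ex.ld (2 * r + 21) (.var jv)).cost + 1) - 10 * t = T - 10 * (1 + t) := by
        simp [Ex.cost]; omega
      exact this ▸ hQ _ hsim₁ ha₁
    · simp [Ex.eval, hsim.hj, hsim.reg, hr] at h0
  | @ite_false r p q s s₁ t hr hp ih =>
    refine WP.weaken (T' := T - 7) (WP.cond ?_ ?_ (fun h0 => ?_) fun _ => ?_) (by omega)
    · simp [Ex.Fits]
    · simp [Ex.cost]; omega
    · simp [Ex.eval, hsim.hj, hsim.reg, hr] at h0
    · refine ih hs hsim (by simp [Ex.cost]; omega) fun σ₁ hsim₁ ha₁ => ?_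
      have : T - 7 - ((Ex.ld (2 * r + 21) (.var jv)).cost + 1) - 10 * t = T - 10 * (1 + t) := by
        simp [Ex.cost]; omega
      exact this ▸ hQ _ hsim₁ ha₁
  | @loop_true r p s s₁ s₂ t₁ t₂ hr h₁ h₂ ih₁ ih₂ =>
    refine WP.weaken (T' := T - 7) (WP.loopWhile_of_ne_zero ?_ ?_ ?_ ?_) (by omega)
    · simp [Ex.Fits]
    · simp [Ex.cost]; omega
    · simpa [Ex.eval, hsim.hj, hsim.reg] using hr
    · refine ih₁ hs hsim (by simp [Ex.cost]; omega) fun σ₁ hsim₁ ha₁ _ => ?_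
      refine ih₂ (h₁.boundedBy hM hs) hsim₁ (by simp [Ex.cost]; omega) fun σ₂ hsim₂ ha₂ => ?_
      have : T - 7 - ((Ex.ld (2 * r + 21) (.var jv)).cost + 1) - 10 * t₁ - 10 * t₂ =
          T - 10 * (1 + t₁ + t₂) := by
        simp [Ex.cost]; omega
      exact this ▸ hQ _ hsim₂ (ha₁.trans ha₂)
  | @loop_false r p s hr =>
    refine WP.weaken (T' := T - 7) (WP.loopWhile_of_eq_zero ?_ ?_ ?_ ?_) (by omega)
    · simp [Ex.Fits]
    · simp [Ex.cost]; omega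
    · simpa [Ex.eval, hsim.hj, hsim.reg] using hr
    · simpa [Ex.cost, Nat.sub_sub] using hQ _ hsim (.refl _ _ _)

end WordRAM

section

open WordRAM SimpleGraph

/-! ## Building the neighbor lists -/

theorem mul_add_lt_mul {a b m n : ℕ} (ha : a < m) (hb : b < n) : a * n + b < m * n := by
  have := Nat.mul_le_mul_right n (Nat.succ_le_of_lt ha)
  rw [Nat.succ_mul] at this
  omega

theorem mul_add_inj {a b a' b' n : ℕ} (hb : b < n) (hb' : b' < n) :
    a * n + b = a' * n + b' ↔ a = a' ∧ b = b' := by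
  refine ⟨fun h => ?_, by rintro ⟨rfl, rfl⟩; rfl⟩
  have h₁ : (a * n + b) / n = a := by
    rw [mul_comm, Nat.mul_add_div (by omega), Nat.div_eq_of_lt hb, add_zero]
  have h₂ : (a' * n + b') / n = a' := by
    rw [mul_comm, Nat.mul_add_div (by omega), Nat.div_eq_of_lt hb', add_zero]
  have : a = a' := by rw [← h₁, ← h₂, h]
  subst this
  exact ⟨rfl, by omega⟩

theorem ite_one_zero_lt {B : ℕ} (hB : 1 < B) (c : Prop) [Decidable c] :
    (if c then 1 else 0) < B := by
  split_ifs <;> omega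

/-- The entries of the array `f` from index `a` on are the elements of `l`. -/
def HoldsList {n : ℕ} (f : ℕ → ℕ) (a : ℕ) (l : List (Fin n)) : Prop :=
  ∀ j (h : j < l.length), f (a + j) = l[j]

theorem HoldsList.congr {n : ℕ} {f g : ℕ → ℕ} {a : ℕ} {l : List (Fin n)} (h : HoldsList f a l)
    (hg : ∀ j < l.length, g (a + j) = f (a + j)) : HoldsList g a l :=
  fun j hj => (hg j hj).trans (h j hj)

theorem HoldsList.concat {n : ℕ} {f g : ℕ → ℕ} {a : ℕ} {l : List (Fin n)} {y : Fin n}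
    (h : HoldsList f a l) (hg : ∀ j < l.length, g (a + j) = f (a + j))
    (hy : g (a + l.length) = y) : HoldsList g a (l ++ [y]) := by
  intro j hj
  rw [List.getElem_append]
  split_ifs with hl
  · exact (hg j hl).trans (h j hl)
  · have : j = l.length := by simp at hj; omega
    subst this
    simp [hy]

variable {n : ℕ} {G : SimpleGraph (Fin n)} {adj : Fin n → List (Fin n)} {S : Finset (Fin n)}

/-- The state contains the input. -/
structure HasInput (adj : Fin n → List (Fin n)) (S : Finset (Fin n)) (s : State) : Prop where
  reg_zero : s.reg 0 = n
  off_succ : ∀ v : Fin n, s.mem 0 (v + 1) = s.mem 0 v + (adj v).length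
  off_le : ∀ v : Fin n, s.mem 0 (v + 1) ≤ n * n
  list : ∀ v : Fin n, HoldsList (s.mem 1) (s.mem 0 v) (adj v)
  sep : ∀ v : Fin n, s.mem 2 v = mode S v

theorem HasInput.congr {s s' : State} (h : HasInput adj S s) (h0 : s'.reg 0 = s.reg 0)
    (hm : ∀ x < 3, s'.mem x = s.mem x) : HasInput adj S s' := by
  obtain ⟨h₁, h₂, h₃, h₄, h₅⟩ := h
  refine ⟨h0.trans h₁, ?_, ?_, ?_, ?_⟩ <;> simpa only [hm 0 (by omega), hm 1 (by omega),
    hm 2 (by omega)]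

/-- The neighbors of `v` in `modeGraph G S m`. -/
def modeNbrs (adj : Fin n → List (Fin n)) (S : Finset (Fin n)) (m : ℕ) (v : Fin n) :
    List (Fin n) := (adj v).filter fun y => m = 1 ∨ v ∉ S ∧ y ∉ S

theorem IsAdjLists.modeNbrs (h : IsAdjLists G adj) (m : ℕ) :
    IsAdjLists (G.modeGraph S m) (modeNbrs adj S m) := fun v =>
  ⟨(h v).1.filter _, fun u => by simp [_root_.modeNbrs, (h v).2, modeGraph]⟩

theorem IsAdjLists.length_le (h : IsAdjLists G adj) (v : Fin n) : (adj v).length ≤ n := by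
  simpa using (h v).1.length_le_card

theorem view_graphInput : view (graphInput adj S) = graphInput adj S := by
  ext <;> simp [view, graphInput]

theorem hasInput_graphInput (h : IsAdjLists G adj) : HasInput adj S (graphInput adj S) := by
  have hoff (p : ℕ) (hp : p ≤ n) : (graphInput adj S).mem 0 p =
      ∑ u : Fin n, if (u : ℕ) < p then (adj u).length else 0 := by
    simp [graphInput, hp]
  have htake (p : ℕ) (hp : p ≤ n) : (graphInput adj S).mem 0 p =
      (((List.ofFn adj).map List.length).take p).sum := by
    rw [hoff p hp, List.map_ofFn, List.sum_take_ofFn, Finset.sum_filter]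
    rfl
  refine ⟨by simp [graphInput], fun v => ?_, fun v => ?_, fun v j hj => ?_, fun v => ?_⟩
  · rw [htake _ v.2, htake _ v.2.le, List.sum_take_succ _ _ (by simp)]
    simp
  · rw [hoff _ v.2]
    refine (Finset.sum_le_card_nsmul _ _ n fun u _ => ?_).trans (by simp)
    split_ifs
    exacts [h.length_le u, Nat.zero_le _]
  · rw [htake _ v.2.le]
    have h1 := List.drop_take_succ_flatten_eq_getElem (List.ofFn adj) v (by simp)
    rw [List.getElem_ofFn] at h1
    have h2 := congrArg (fun l => l[j]?) h1
    simp only [List.getElem?_drop, List.getElem?_take] at h2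
    split_ifs at h2 with h3
    · simp only [graphInput, one_ne_zero, if_false, if_true, List.getD_eq_getElem?_getD,
        List.getElem?_map]
      rw [h2]
      simp [hj]
    · simp [hj] at h2
  · simp [graphInput, mode]

theorem IsAdjLists.modeNbrs_length_le (h : IsAdjLists G adj) (m : ℕ) (v : Fin n) :
    (_root_.modeNbrs adj S m v).length ≤ n := (h.modeNbrs (S := S) m).length_le v

/-- Build the neighbor lists in both modes (array `3`, with the lengths in array `4`) and the
adjacency matrix (array `5`).  Variable `3` is the row `m * n + v`, variables `4` and `5` delimit
the rest of the list of `v`, variable `6` counts, and variable `7` is a neighbor. -/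
def buildRow : Program :=
  asg 7 (.ld 1 (.var 4)) ;;
  st 5 (.var 3 %ₑ .var 0 *ₑ .var 0 +ₑ .var 7) (.lit 1) ;;
  cond (.var 3 /ₑ .var 0 +ₑ (.lit 1 -ₑ .ld 2 (.var 3 %ₑ .var 0)) *ₑ (.lit 1 -ₑ .ld 2 (.var 7)))
    (st 3 (.var 3 *ₑ .var 0 +ₑ .var 6) (.var 7) ;; asg 6 (.var 6 +ₑ .lit 1)) .skip ;;
  asg 4 (.var 4 +ₑ .lit 1)

def buildLists : Program :=
  asg 3 (.lit 0) ;;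
  loopWhile (.var 3 <ₑ .lit 2 *ₑ .var 0)
    (asg 4 (.ld 0 (.var 3 %ₑ .var 0)) ;;
    asg 5 (.ld 0 (.var 3 %ₑ .var 0 +ₑ .lit 1)) ;;
    asg 6 (.lit 0) ;;
    loopWhile (.var 4 <ₑ .var 5) buildRow ;;
    st 4 (.var 3) (.var 6) ;;
    asg 3 (.var 3 +ₑ .lit 1))

/-- The vertex that belongs to the row `p` of the neighbor lists. -/
def rowVertex (hn : 0 < n) (p : ℕ) : Fin n := ⟨p % n, Nat.mod_lt p hn⟩

/-- The neighbor lists of the rows below `p` are available. -/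
def HasRows (hn : 0 < n) (adj : Fin n → List (Fin n)) (S : Finset (Fin n)) (s : State) (p : ℕ) :
    Prop :=
  ∀ q < p, s.mem 4 q = (modeNbrs adj S (q / n) (rowVertex hn q)).length ∧
    HoldsList (s.mem 3) (q * n) (modeNbrs adj S (q / n) (rowVertex hn q))

/-- The part of the adjacency matrix in the rows below `p` is available. -/
structure HasMatrix (hn : 0 < n) (G : SimpleGraph (Fin n)) (s : State) (p : ℕ) : Prop where
  le_one : ∀ i, s.mem 5 i ≤ 1
  adj : ∀ v y : Fin n, s.mem 5 (v * n + y) ≠ 0 → G.Adj v y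
  row : ∀ q < p, ∀ y, G.Adj (rowVertex hn q) y → s.mem 5 (rowVertex hn q * n + y) ≠ 0

theorem HasMatrix.setMem {hn : 0 < n} {s : State} {p : ℕ} (h : HasMatrix hn G s p) {v y : Fin n}
    (hvy : G.Adj v y) : HasMatrix hn G (s.setMem 5 (v * n + y) 1) p := by
  obtain ⟨h₁, h₂, h₃⟩ := h
  refine ⟨fun i => ?_, fun v' y' => ?_, fun q hq y' h => ?_⟩
  · rw [State.mem_setMem]
    split_ifs
    exacts [le_rfl, h₁ i]
  · rw [State.mem_setMem]
    split_ifs with hi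
    · obtain ⟨h, h'⟩ := (mul_add_inj y'.2 y.2).1 hi.2
      rw [Fin.ext h, Fin.ext h']
      exact fun _ => hvy
    · exact h₂ v' y'
  · rw [State.mem_setMem]
    split_ifs
    exacts [one_ne_zero, h₃ q hq y' h]

/-- The neighbors of `v` in `modeGraph G S m` among the first `i` neighbors of `v` in `G`. -/
def takeNbrs (adj : Fin n → List (Fin n)) (S : Finset (Fin n)) (m : ℕ) (v : Fin n) (i : ℕ) :
    List (Fin n) := ((adj v).take i).filter fun y => m = 1 ∨ v ∉ S ∧ y ∉ S

theorem takeNbrs_succ (m : ℕ) (v : Fin n) (i : ℕ) (hi : i < (adj v).length) :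
    takeNbrs adj S m v (i + 1) = if m = 1 ∨ v ∉ S ∧ (adj v)[i] ∉ S
      then takeNbrs adj S m v i ++ [(adj v)[i]] else takeNbrs adj S m v i := by
  rw [takeNbrs, ← List.take_concat_get' _ _ hi, List.filter_append]
  split_ifs with h <;> simp [takeNbrs, h]

theorem takeNbrs_length (m : ℕ) (v : Fin n) :
    takeNbrs adj S m v (adj v).length = modeNbrs adj S m v := by
  rw [takeNbrs, List.take_length, modeNbrs]

/-- The first `i` neighbors of `v` have been copied to the row `p`. -/
structure BuildInv (hn : 0 < n) (G : SimpleGraph (Fin n)) (adj : Fin n → List (Fin n))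
    (S : Finset (Fin n)) (s₀ : State) (p m : ℕ) (v : Fin n) (i : ℕ) (s : State) : Prop where
  reg0 : s.reg 0 = n
  reg3 : s.reg 3 = p
  reg4 : s.reg 4 = s₀.mem 0 v + i
  reg5 : s.reg 5 = s₀.mem 0 v + (adj v).length
  reg6 : s.reg 6 = (takeNbrs adj S m v i).length
  list : HoldsList (s.mem 3) (p * n) (takeNbrs adj S m v i)
  rows : HasRows hn adj S s p
  matrix : HasMatrix hn G s p
  row : ∀ y ∈ (adj v).take i, s.mem 5 (v * n + y) ≠ 0
  frame : ∀ x, x ≠ 3 → x ≠ 4 → x ≠ 5 → s.mem x = s₀.mem x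

theorem wp_buildRow {B : ℕ} {hn : 0 < n} (hadj : IsAdjLists G adj) (hw : 64 * (n + 1) ^ 4 ≤ B)
    {s₀ s : State} {p m i : ℕ} {v : Fin n} (hp : p < 2 * n) (hvp : p % n = v) (hpm : p / n = m)
    (hi : i < (adj v).length)
    (hs₀ : HasInput adj S s₀) (hs : BuildInv hn G adj S s₀ p m v i s)
    {T : ℕ} (hT : 60 ≤ T) {Q : State → ℕ → Prop}
    (hQ : ∀ s' T', BuildInv hn G adj S s₀ p m v (i + 1) s' → T ≤ T' + 60 → Q s' T') :
    WP B buildRow Q s T := by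
  obtain ⟨h0, h3, h4, h5, h6, hl, hr, hm, hm', hf⟩ := hs
  set y := (adj v)[i] with hy
  have hvy : G.Adj v y := ((hadj v).2 y).1 (List.getElem_mem _)
  have htake : (adj v).take (i + 1) = (adj v).take i ++ [y] := by simp [hy]
  have htn := takeNbrs_succ (S := S) m v i hi
  rw [← hy] at htn
  set l := takeNbrs adj S m v i with hldef
  have hll : l.length < n := (List.length_filter_le _ _).trans_lt
    (by have := hadj.length_le v; simp; omega)
  have hwn : 4 * (n * n) + 4 * n + 4 < B := by
    refine lt_of_lt_of_le ?_ hw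
    nlinarith [Nat.zero_le n, pow_two_nonneg ((n + 1) ^ 2), Nat.one_le_pow 2 (n + 1) (by omega)]
  have hoff := hs₀.off_le v
  rw [hs₀.off_succ] at hoff
  have hvn : v * n + y < n * n := mul_add_lt_mul v.2 y.2
  have hpn : p * n + l.length < 2 * n * n := mul_add_lt_mul hp hll
  have h2nn : 2 * n * n = 2 * (n * n) := mul_assoc ..
  have hpdiv : m < 2 := hpm ▸ Nat.div_lt_of_lt_mul (by rwa [mul_comm])
  have hm1 : s.mem 1 = s₀.mem 1 := hf 1 (by simp) (by simp) (by simp)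
  have hm2 : s.mem 2 = s₀.mem 2 := hf 2 (by simp) (by simp) (by simp)
  have hmy : s.mem 1 (s.reg 4) = y := by rw [hm1, h4, hs₀.list v i hi]
  have hvlt := v.2
  have hylt := y.2
  have hmode (u : Fin n) : mode S u ≤ 1 := by rw [mode]; split_ifs <;> simp
  -- Arithmetic form of the test whether the edge `vy` belongs to the graph of mode `m`.
  have hcond : m + (1 - mode S v) * (1 - mode S y) = 0 ↔ ¬ (m = 1 ∨ v ∉ S ∧ y ∉ S) := by
    have h := Nat.le_one_iff_eq_zero_or_eq_one.1 (Nat.le_of_lt_succ hpdiv)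
    rcases h with h | h <;> simp only [h, mode] <;> split_ifs <;> simp_all
  have hmul : (1 - mode S v) * (1 - mode S y) ≤ 1 :=
    Nat.mul_le_mul (Nat.sub_le 1 _) (Nat.sub_le 1 _)
  have hmat := hm.setMem hvy
  have hrow : ∀ z ∈ (adj v).take (i + 1), (s.setMem 5 (v * n + y) 1).mem 5 (v * n + z) ≠ 0 := by
    intro z hz
    rw [State.mem_setMem]
    split_ifs with h
    · exact one_ne_zero
    · rw [htake, List.mem_append, List.mem_singleton] at hz
      rcases hz with hz | rfl
      · exact hm' z hz
      · exact absurd ⟨rfl, rfl⟩ h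
  refine WP.seq (WP.asg y ?_ ?_ ?_ (WP.seq (WP.st (v * n + y) 1 ?_ ?_ ?_ ?_ ?_ (WP.seq ?_))))
  · simp [hmy]
  · simp
  · simp
    omega
  · simp [h0, h3, hvp]
  · simp
  · simp [h0, h3, hvp]
    omega
  · simp
    omega
  · simp
    omega
  refine WP.cond ?_ ?_ (fun hc => ?_) (fun hc => ?_)
  · simp [h0, h3, hvp, hpm, hm2, hs₀.sep]
    omega
  · simp
    omega
  · replace hc : m + (1 - mode S v) * (1 - mode S y) ≠ 0 := by
      simpa [h0, h3, hvp, hpm, hm2, hs₀.sep] using hc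
    rw [Ne, hcond, not_not] at hc
    rw [if_pos hc] at htn
    refine WP.seq (WP.st (p * n + l.length) y ?_ ?_ ?_ ?_ ?_ (WP.asg (l.length + 1) ?_ ?_ ?_
      (WP.asg (s₀.mem 0 v + (i + 1)) ?_ ?_ ?_ (hQ _ _ ?_ ?_))))
    · simp [h0, h3, h6]
    · simp
    · simp [h0, h3, h6]
      omega
    · simp
    · simp
      omega
    · simp [h6]
    · simp [h6]
      omega
    · simp
      omega
    · simp [h4, add_assoc]
    · simp [h4]
      omega
    · simp
      omega
    · refine ⟨by simp [h0], by simp [h3], by simp, by simp [h5],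
        by simp [htn], ?_, ?_, ?_, ?_, ?_⟩
      · rw [htn]
        refine hl.concat (fun j hj => ?_) (by simp)
        simp [hj.ne]
      · intro q hq
        refine ⟨by simpa using (hr q hq).1, (hr q hq).2.congr fun j hj => ?_⟩
        -- Each row owns `n` cells and no list is longer than `n`, so earlier rows are not
        -- overwritten.
        have : q * n + j ≠ p * n + l.length := by
          have := hadj.modeNbrs_length_le (S := S) (q / n) (rowVertex hn q)
          rw [Ne, mul_add_inj (by omega) hll]
          omega
        simp [this]
      · exact ⟨by simpa using hmat.le_one, by simpa using hmat.adj, by simpa using hmat.row⟩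
      · simpa using hrow
      · intro x hx3 hx4 hx5
        ext j
        simp [hx3, hx5, hf x hx3 hx4 hx5]
    · simp
      omega
  · replace hc : m + (1 - mode S v) * (1 - mode S y) = 0 := by
      simpa [h0, h3, hvp, hpm, hm2, hs₀.sep] using hc
    rw [hcond] at hc
    rw [if_neg hc] at htn
    refine WP.skip ?_ (WP.asg (s₀.mem 0 v + (i + 1)) ?_ ?_ ?_ (hQ _ _ ?_ ?_))
    · simp
      omega
    · simp [h4, add_assoc]
    · simp [h4]
      omega
    · simp
      omega
    · refine ⟨by simp [h0], by simp [h3], by simp, by simp [h5],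
        by simp [htn, h6], ?_, ?_, ?_, ?_, ?_⟩
      · rw [htn]
        exact hl.congr fun j hj => by simp
      · exact fun q hq => ⟨by simpa using (hr q hq).1, (hr q hq).2.congr fun j hj => by simp⟩
      · exact ⟨by simpa using hmat.le_one, by simpa using hmat.adj, by simpa using hmat.row⟩
      · simpa using hrow
      · intro x hx3 hx4 hx5
        ext j
        simp [hx5, hf x hx3 hx4 hx5]
    · simp
      omega

/-- The neighbor lists in both modes and the adjacency matrix are available. -/
structure HasLists (hn : 0 < n) (G : SimpleGraph (Fin n)) (adj : Fin n → List (Fin n))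
    (S : Finset (Fin n)) (s : State) : Prop where
  rows : HasRows hn adj S s (2 * n)
  matrix : HasMatrix hn G s n

/-- The number of credits that suffices to build the rows below `p`. -/
def buildCost (hn : 0 < n) (adj : Fin n → List (Fin n)) (p : ℕ) : ℕ :=
  ∑ q ∈ Finset.range p, (70 * (adj (rowVertex hn q)).length + 70)

theorem wp_buildLists {B : ℕ} {hn : 0 < n} (hadj : IsAdjLists G adj) (hB : 64 * (n + 1) ^ 4 ≤ B)
    {s₀ : State} (hs₀ : HasInput adj S s₀) (h4 : ∀ i, s₀.mem 5 i = 0) {T : ℕ}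
    (hT : buildCost hn adj (2 * n) + 70 ≤ T) {Q : State → ℕ → Prop}
    (hQ : ∀ s' T', HasLists hn G adj S s' → s'.reg 0 = n →
      (∀ x, x ≠ 3 → x ≠ 4 → x ≠ 5 → s'.mem x = s₀.mem x) →
      T ≤ T' + (buildCost hn adj (2 * n) + 70) → Q s' T') :
    WP B buildLists Q s₀ T := by
  have hBn : 4 * (n * n) + 4 * n + 4 < B := by
    refine lt_of_lt_of_le ?_ hB
    nlinarith [Nat.zero_le n, pow_two_nonneg ((n + 1) ^ 2), Nat.one_le_pow 2 (n + 1) (by omega)]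
  refine WP.seq (WP.asg 0 (by simp) (by simp; omega) (by simp; omega) ?_)
  refine WP.loopWhile (fun s T' => ∃ p ≤ 2 * n, s.reg 0 = n ∧ s.reg 3 = p ∧ HasRows hn adj S s p ∧
    HasMatrix hn G s p ∧ (∀ x, x ≠ 3 → x ≠ 4 → x ≠ 5 → s.mem x = s₀.mem x) ∧
    T ≤ T' + buildCost hn adj p + 2) ⟨0, by simp, ?_⟩ ?_
  · refine ⟨by simpa using hs₀.reg_zero, by simp, fun q hq => by simp at hq, ⟨?_, ?_, ?_⟩, ?_, ?_⟩
    · simp [h4]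
    · simp [h4]
    · simp
    · simp
    · simp [buildCost]
      omega
  rintro s T' ⟨p, hp, h0, h3, hr, hm, hf, hT'⟩
  have hcost : p < 2 * n → buildCost hn adj p + (70 * (adj (rowVertex hn p)).length + 70) ≤
      buildCost hn adj (2 * n) := fun h => by
    rw [buildCost, ← Finset.sum_range_succ]
    exact Finset.sum_le_sum_of_subset (Finset.range_subset_range.2 h)
  have hcost' : buildCost hn adj p ≤ buildCost hn adj (2 * n) :=
    Finset.sum_le_sum_of_subset (Finset.range_subset_range.2 hp)
  refine ⟨?_, ?_, fun he => ?_, fun he => ?_⟩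
  · simp [h0, h3]
    split_ifs <;> omega
  · simp
    omega
  · have hlt : p < 2 * n := by simpa [h0, h3] using he
    have hsucc : buildCost hn adj (p + 1) = buildCost hn adj p +
      (70 * (adj (rowVertex hn p)).length + 70) := Finset.sum_range_succ ..
    have hcost := hcost hlt
    clear he
    generalize hv : rowVertex hn p = v at hcost hsucc
    have hvp : p % n = v := by rw [← hv]; rfl
    have hoff := hs₀.off_le v
    rw [hs₀.off_succ] at hoff
    have hm0 : s.mem 0 = s₀.mem 0 := hf 0 (by simp) (by simp) (by simp)
    have hvlt := v.2
    refine WP.seq (WP.asg (s₀.mem 0 v) ?_ ?_ ?_ (WP.seq (WP.asg (s₀.mem 0 v + (adj v).length) ?_ ?_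
      ?_ (WP.seq (WP.asg 0 ?_ ?_ ?_ (WP.seq ?_))))))
    · simp [h0, h3, hvp, hm0]
    · simp [h0, h3, hvp]
      omega
    · simp
      omega
    · simp [h0, h3, hvp, hm0, hs₀.off_succ]
    · simp [h0, h3, hvp]
      omega
    · simp
      omega
    · simp
    · simp
      omega
    · simp
      omega
    refine WP.loopWhile (fun s' T'' => ∃ i ≤ (adj v).length, BuildInv hn G adj S s₀ p (p / n)
      v i s' ∧
      T' ≤ T'' + 70 * i + 30) ⟨0, Nat.zero_le _, ⟨?_, ?_, ?_, ?_, ?_, ?_, ?_, ?_, ?_, ?_⟩, ?_⟩ ?_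
    · simp [h0]
    · simp [h3]
    · simp
    · simp
    · simp [takeNbrs]
    · simp [takeNbrs, HoldsList]
    · exact hr
    · exact ⟨hm.le_one, hm.adj, hm.row⟩
    · simp
    · exact hf
    · simp
      omega
    rintro s' T'' ⟨i, hi, hs', hT''⟩
    refine ⟨?_, ?_, fun he => ?_, fun he => ?_⟩
    · simp
      exact ite_one_zero_lt (by omega) _
    · simp
      omega
    · have hlt' : i < (adj v).length := by simpa [hs'.reg4, hs'.reg5] using he
      refine wp_buildRow hadj hB hlt hvp rfl hlt' hs₀ hs' ?_ fun s₂ T₂ hs₂ hT₂ => ⟨i + 1, hlt',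
        hs₂, ?_⟩
      · simp
        omega
      · simp at hT₂
        omega
    · have hi' : i = (adj v).length := by
        have : ¬ i < (adj v).length := by simpa [hs'.reg4, hs'.reg5] using he
        omega
      subst hi'
      obtain ⟨r0, r3, -, -, r6, hl, hr', hm', hrow, hf'⟩ := hs'
      rw [takeNbrs_length] at r6 hl
      rw [List.take_length] at hrow
      have hll := hadj.modeNbrs_length_le (S := S) (p / n) v
      refine WP.seq (WP.st p (modeNbrs adj S (p / n) v).length ?_ ?_ ?_ ?_ ?_ (WP.asg (p + 1)
        ?_ ?_ ?_
        ⟨p + 1, hlt, ?_, ?_, ?_, ⟨?_, ?_, ?_⟩, ?_, ?_⟩))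
      · simp [r3]
      · simp [r6]
      · simp
      · simp
      · simp
        omega
      · simp [r3]
      · simp [r3]
        omega
      · simp
        omega
      · simp [r0]
      · simp
      · intro q hq
        rcases Nat.lt_succ_iff_lt_or_eq.1 hq with hq | rfl
        · refine ⟨?_, (hr' q hq).2.congr fun j hj => by simp⟩
          simp [hq.ne, (hr' q hq).1]
        · rw [hv]
          exact ⟨by simp, hl.congr fun j hj => by simp⟩
      · simpa using hm'.le_one
      · simpa using hm'.adj
      · intro q hq y hy
        rcases Nat.lt_succ_iff_lt_or_eq.1 hq with hq | rfl
        · simpa using hm'.row q hq y hy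
        · rw [hv] at hy ⊢
          simpa using hrow y (((hadj v).2 y).2 hy)
      · intro x hx3 hx4 hx5
        ext j
        simp [hx4, hf' x hx3 hx4 hx5]
      · simp
        omega
  · have hp' : p = 2 * n := by
      have : ¬ p < 2 * n := by simpa [h0, h3] using he
      omega
    subst hp'
    refine hQ _ _ ⟨hr, hm.le_one, hm.adj, fun q hq => hm.row q (by omega)⟩ h0 hf ?_
    simp
    omega

end

section

open WordRAM SimpleGraph

/-! ## Ordering the vertices by components -/

variable {n : ℕ} {G : SimpleGraph (Fin n)} {adj : Fin n → List (Fin n)} {S : Finset (Fin n)}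

/-- Only the variables in `rs` and the arrays in `xs` have changed. -/
structure Unchanged (rs xs : List ℕ) (s s' : State) : Prop where
  reg : ∀ r ∉ rs, s'.reg r = s.reg r
  mem : ∀ x ∉ xs, s'.mem x = s.mem x

theorem Unchanged.refl {rs xs : List ℕ} (s : State) : Unchanged rs xs s s :=
  ⟨fun _ _ => rfl, fun _ _ => rfl⟩

theorem Unchanged.trans {rs xs rs' xs' : List ℕ} {s s' s'' : State} (h : Unchanged rs xs s s')
    (h' : Unchanged rs' xs' s' s'') (hr : rs' ⊆ rs) (hx : xs' ⊆ xs) : Unchanged rs xs s s'' :=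
  ⟨fun r hm => (h'.reg r fun hm' => hm (hr hm')).trans (h.reg r hm),
    fun x hm => (h'.mem x fun hm' => hm (hx hm')).trans (h.mem x hm)⟩

theorem Unchanged.setReg {rs xs : List ℕ} {s s' : State} {r v : ℕ} (h : Unchanged rs xs s s')
    (hr : r ∈ rs) : Unchanged rs xs s (s'.setReg r v) := by
  refine ⟨fun r' hr' => ?_, h.mem⟩
  rw [State.reg_setReg, if_neg (by rintro rfl; exact hr' hr), h.reg r' hr']

theorem Unchanged.setMem {rs xs : List ℕ} {s s' : State} {x i v : ℕ} (h : Unchanged rs xs s s')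
    (hx : x ∈ xs) : Unchanged rs xs s (s'.setMem x i v) := by
  refine ⟨h.reg, fun x' hx' => funext fun j => ?_⟩
  rw [State.mem_setMem, if_neg (by rintro ⟨rfl, -⟩; exact hx' hx), h.mem x' hx']

theorem HasRows.congr {hn : 0 < n} {s s' : State} {p : ℕ} (h : HasRows hn adj S s p)
    (h₃ : s'.mem 3 = s.mem 3) (h₄ : s'.mem 4 = s.mem 4) : HasRows hn adj S s' p := by
  rwa [HasRows, h₃, h₄]

theorem HasRows.get {hn : 0 < n} {s : State} (h : HasRows hn adj S s (2 * n)) {m : ℕ} (hm : m < 2)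
    (v : Fin n) : s.mem 4 (m * n + v) = (modeNbrs adj S m v).length ∧
      HoldsList (s.mem 3) ((m * n + v) * n) (modeNbrs adj S m v) := by
  have h₁ : (m * n + v) / n = m := by
    rw [mul_comm, Nat.mul_add_div hn, Nat.div_eq_of_lt v.2, add_zero]
  have h₂ : rowVertex hn (m * n + v) = v := by
    ext
    simp [rowVertex, Nat.mod_eq_of_lt v.2]
  have := h (m * n + v) (mul_add_lt_mul hm v.2)
  rwa [h₁, h₂] at this

/-- The queue `L` is stored in array `6`, its length in variable `5`, and the set of its elements
in array `7`. -/
structure HasQueue (s : State) (L : List (Fin n)) : Prop where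
  nodup : L.Nodup
  list : HoldsList (s.mem 6) 0 L
  len : s.reg 5 = L.length
  vis : ∀ v : Fin n, s.mem 7 v ≠ 0 ↔ v ∈ L

theorem HasQueue.congr {s s' : State} {L : List (Fin n)} (h : HasQueue s L) {rs xs : List ℕ}
    (hs : Unchanged rs xs s s') (h5 : 5 ∉ rs) (h6 : 6 ∉ xs) (h7 : 7 ∉ xs) : HasQueue s' L :=
  ⟨h.nodup, hs.mem 6 h6 ▸ h.list, (hs.reg 5 h5).trans h.len, hs.mem 7 h7 ▸ h.vis⟩

/-- Append the vertex in variable `r` to the queue. -/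
def push (r : ℕ) : Program :=
  st 7 (.var r) (.lit 1) ;; st 6 (.var 5) (.var r) ;; asg 5 (.var 5 +ₑ .lit 1)

theorem wp_push {B : ℕ} (hB : n + 1 < B) {s : State} {L : List (Fin n)} (hs : HasQueue s L) {r : ℕ}
    {y : Fin n} (hy : s.reg r = y) (hyL : y ∉ L) {T : ℕ} (hT : 10 ≤ T)
    {Q : State → ℕ → Prop}
    (hQ : ∀ s' T', HasQueue s' (L ++ [y]) → Unchanged [5] [6, 7] s s' → T ≤ T' + 10 → Q s' T') :
    WP B (push r) Q s T := by
  have hL : L.length < n + 1 := Nat.lt_succ_of_le (by simpa using hs.nodup.length_le_card)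
  have h5 := hs.len
  refine WP.seq (WP.st y 1 ?_ ?_ ?_ ?_ ?_ (WP.seq (WP.st L.length y ?_ ?_ ?_ ?_ ?_
    (WP.asg (L.length + 1) ?_ ?_ ?_ (hQ _ _ ⟨?_, ?_, ?_, ?_⟩ ?_ ?_)))))
  · simp [hy]
  · simp
  · simp
  · simp; omega
  · simp; omega
  · simp [h5]
  · simp [hy]
  · simp
  · simp
  · simp; omega
  · simp [h5]
  · simp [h5]; omega
  · simp; omega
  · exact List.nodup_append.2 ⟨hs.nodup, by simp, fun a ha b hb => by
      rw [List.mem_singleton] at hb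
      rintro rfl
      exact hyL (hb ▸ ha)⟩
  · exact hs.list.concat (fun j hj => by simp [hj.ne]) (by simp)
  · simp
  · intro v
    have := hs.vis v
    by_cases hv : v = y <;> simp [hv, Fin.val_inj, ← this]
  · exact ((((Unchanged.refl s).setMem (by simp)).setMem (by simp)).setReg (by simp))
  · simp
    omega

/-- Append the new neighbors of the vertex in variable `7` to the queue.  The variables `8` and `9`
delimit its list. -/
def scanNbrs : Program :=
  loopWhile (.var 8 <ₑ .var 9)
    (asg 10 (.ld 3 (.var 8)) ;; asg 8 (.var 8 +ₑ .lit 1) ;; cond (.ld 7 (.var 10)) .skip (push 10))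

theorem wp_scanNbrs {B : ℕ} (hB : n + 1 < B) {s : State} {L N : List (Fin n)} (hs : HasQueue s L)
    {a : ℕ} (haB : a + N.length < B) (h8 : s.reg 8 = a) (h9 : s.reg 9 = a + N.length)
    (hN : HoldsList (s.mem 3) a N) {T : ℕ} (hT : 30 * N.length + 10 ≤ T) {Q : State → ℕ → Prop}
    (hQ : ∀ s' T' R, HasQueue s' (L ++ R) → (∀ y ∈ R, y ∈ N) → (∀ y ∈ N, y ∈ L ++ R) →
      Unchanged [5, 8, 10] [6, 7] s s' → T ≤ T' + (30 * N.length + 10) → Q s' T') :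
    WP B scanNbrs Q s T := by
  refine WP.loopWhile (fun s' T' => ∃ i ≤ N.length, ∃ R, HasQueue s' (L ++ R) ∧
    (∀ y ∈ R, y ∈ N) ∧ (∀ j (h : j < N.length), j < i → N[j] ∈ L ++ R) ∧
    Unchanged [5, 8, 10] [6, 7] s s' ∧ s'.reg 8 = a + i ∧ T ≤ T' + 30 * i)
    ⟨0, Nat.zero_le _, [], by simpa using hs, by simp, by simp, .refl _, by simpa using h8,
    by simp⟩ ?_
  rintro s' T' ⟨i, hi, R, hq, hRN, hNR, hu, h8', hT'⟩
  have h9' : s'.reg 9 = a + N.length := by rw [hu.reg 9 (by simp), h9]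
  have h3 : s'.mem 3 = s.mem 3 := hu.mem 3 (by simp)
  refine ⟨?_, ?_, fun he => ?_, fun he => ?_⟩
  · simp [h8', h9']
    exact ite_one_zero_lt (by omega) _
  · simp
    omega
  · have hlt : i < N.length := by simpa [h8', h9'] using he
    have hy := hN i hlt
    have hu' := (hu.setReg (r := 10) (v := N[i]) (by simp)).setReg (r := 8) (v := a + i + 1)
      (by simp)
    have hq' : HasQueue ((s'.setReg 10 N[i]).setReg 8 (a + i + 1)) (L ++ R) :=
      ⟨hq.nodup, hq.list, by simp [hq.len], hq.vis⟩
    refine WP.seq (WP.asg N[i] ?_ ?_ ?_ (WP.seq (WP.asg (a + i + 1) ?_ ?_ ?_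
      (WP.cond ?_ ?_ (fun hc => ?_) fun hc => ?_))))
    · simp [h8', h3, hy]
    · simp
    · simp; omega
    · simp [h8']
    · simp [h8']; omega
    · simp; omega
    · simp
    · simp; omega
    · have hmem : N[i] ∈ L ++ R := (hq.vis _).1 (by simpa using hc)
      refine WP.skip ?_ ⟨i + 1, hlt, R, hq', hRN, fun j h hj => ?_, hu', ?_, ?_⟩
      · simp; omega
      · rcases Nat.lt_succ_iff_lt_or_eq.1 hj with hj | rfl
        exacts [hNR j h hj, hmem]
      · simp [add_assoc]
      · simp; omega
    · have hmem : N[i] ∉ L ++ R := fun h => (hq.vis _).2 h (by simpa using hc)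
      refine wp_push hB hq' (y := N[i]) (by simp) hmem ?_ fun s₂ T₂ hq₂ hu₂ hT₂ =>
        ⟨i + 1, hlt, R ++ [N[i]], by simpa using hq₂, ?_, fun j h hj => ?_,
          hu'.trans hu₂ (by simp) (by simp), ?_, ?_⟩
      · simp; omega
      · simp only [List.mem_append, List.mem_singleton]
        rintro y (hy | rfl)
        exacts [hRN y hy, List.getElem_mem _]
      · rcases Nat.lt_succ_iff_lt_or_eq.1 hj with hj | rfl
        · have := hNR j h hj
          simp only [List.mem_append] at this ⊢
          tauto
        · simp
      · rw [hu₂.reg 8 (by simp)]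
        simp [add_assoc]
      · simp at hT₂
        omega
  · have hi' : i = N.length := by
      have : ¬ i < N.length := by simpa [h8', h9'] using he
      omega
    subst hi'
    refine hQ _ _ R hq hRN (fun y hy => ?_) hu ?_
    · obtain ⟨j, hj, rfl⟩ := List.getElem_of_mem hy
      exact hNR j hj hj
    · simp
      omega

end

/-! ### Exploring one component of `G - S` -/

section

open WordRAM SimpleGraph

variable {n : ℕ} {G : SimpleGraph (Fin n)} {adj : Fin n → List (Fin n)} {S : Finset (Fin n)}

/-- Append the component of the vertex in variable `3` to the queue.  Variable `4` is the position
of its first vertex, and variable `6` the position of the vertex that is scanned. -/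
def explore : Program :=
  asg 4 (.var 5 +ₑ .lit 0) ;; asg 6 (.var 5 +ₑ .lit 0) ;; push 3 ;;
  loopWhile (.var 6 <ₑ .var 5)
    (asg 7 (.ld 6 (.var 6)) ;; asg 8 (.var 7 *ₑ .var 0) ;; asg 9 (.var 8 +ₑ .ld 4 (.var 7)) ;;
      scanNbrs ;; asg 6 (.var 6 +ₑ .lit 1))

/-- Amortized cost: every vertex that enters the queue is paid for with `c` credits, which cover the
scan of its list. The credit hypothesis reserves `c` for each vertex that is not yet in the queue.
-/
theorem wp_explore {B : ℕ} {hn : 0 < n} (hadj : IsAdjLists G adj) (hB : 4 * (n * n) + 4 * n + 4 < B)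
    {s : State} {L : List (Fin n)} (hs : HasQueue s L) (hr : HasRows hn adj S s (2 * n))
    (h0 : s.reg 0 = n) {v : Fin n} (h3 : s.reg 3 = v) (hv : v ∉ L) {c : ℕ}
    (hc : ∀ x, 30 * (modeNbrs adj S 0 x).length + 60 ≤ c) {T : ℕ}
    (hT : c * n + 30 ≤ T + c * L.length) {Q : State → ℕ → Prop}
    (hQ : ∀ s' T' R, HasQueue s' (L ++ R) → v ∈ R → (∀ x ∈ R, (G.modeGraph S 0).Reachable v x) →
      (∀ x ∈ R, ∀ y, (G.modeGraph S 0).Adj x y → y ∈ L ++ R) → s'.reg 4 = L.length →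
      Unchanged [4, 5, 6, 7, 8, 9, 10] [6, 7] s s' → T ≤ T' + (c * R.length + 30) → Q s' T') :
    WP B explore Q s T := by
  have hlen {L' : List (Fin n)} (h : L'.Nodup) : L'.length ≤ n := by simpa using h.length_le_card
  have hLn : L.length + 1 ≤ n := by
    have : (L ++ [v]).Nodup := List.nodup_append.2 ⟨hs.nodup, by simp, fun a ha b hb => by
      rintro rfl
      exact hv (List.mem_singleton.1 hb ▸ ha)⟩
    simpa using hlen this
  have h5 := hs.len
  have hcn := Nat.mul_le_mul_left c hLn
  rw [Nat.mul_succ] at hcn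
  have hc60 := hc v
  have hu₀ : Unchanged [4, 5, 6, 7, 8, 9, 10] [6, 7] s ((s.setReg 4 L.length).setReg 6 L.length) :=
    (((Unchanged.refl s).setReg (by simp)).setReg (by simp))
  refine WP.seq (WP.asg L.length ?_ ?_ ?_ (WP.seq (WP.asg L.length ?_ ?_ ?_ (WP.seq ?_))))
  · simp [h5]
  · simp [h5]; omega
  · simp; omega
  · simp [h5]
  · simp [h5]; omega
  · simp; omega
  have hq₀ : HasQueue ((s.setReg 4 L.length).setReg 6 L.length) L :=
    ⟨hs.nodup, hs.list, by simp [h5], hs.vis⟩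
  refine wp_push ?_ hq₀ (y := v) ?_ hv ?_ fun s₁ T₁ hq₁ hu₁ hT₁ => ?_
  · omega
  · simp [h3]
  · simp; omega
  simp at hT₁
  refine WP.loopWhile (fun s' T' => ∃ R h, h ≤ R.length ∧ HasQueue s' (L ++ R) ∧ v ∈ R ∧
    (∀ x ∈ R, (G.modeGraph S 0).Reachable v x) ∧ (∀ j (hj : j < R.length), j < h → ∀ y,
      (G.modeGraph S 0).Adj R[j] y → y ∈ L ++ R) ∧ s'.reg 4 = L.length ∧ s'.reg 6 = L.length + h ∧
      Unchanged [4, 5, 6, 7, 8, 9, 10] [6, 7] s s' ∧ T ≤ T' + (c * h + 20)) ⟨[v], 0, by simp, hq₁,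
      by simp, by simp, by simp, ?_, ?_, hu₀.trans hu₁ (by simp) (by simp), ?_⟩ ?_
  · rw [hu₁.reg 4 (by simp)]
    simp
  · rw [hu₁.reg 6 (by simp)]
    simp
  · omega
  rintro s' T' ⟨R, h, hh, hq, hvR, hreach, hscan, h4, h6, hu, hT'⟩
  have hLR : L.length + R.length ≤ n := by simpa using hlen hq.nodup
  have hcR := Nat.mul_le_mul_left c hLR
  rw [mul_add] at hcR
  have h5' : s'.reg 5 = L.length + R.length := by simpa using hq.len
  have hch := Nat.mul_le_mul_left c hh
  refine ⟨?_, ?_, fun he => ?_, fun he => ?_⟩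
  · simp
    exact ite_one_zero_lt (by omega) _
  · simp
    omega
  · have hlt : h < R.length := by simpa [h5', h6] using he
    have hch := Nat.mul_le_mul_left c (Nat.succ_le_of_lt hlt)
    rw [Nat.mul_succ] at hch
    set x := R[h] with hx
    have hcx := hc x
    have hrx := (hr.get two_pos x)
    rw [zero_mul, zero_add] at hrx
    have hlx := hadj.modeNbrs_length_le (S := S) 0 x
    have hxn := mul_add_lt_mul (b := 0) x.2 hn
    have hmx : s'.mem 6 (L.length + h) = x := by
      have := hq.list (L.length + h) (by simp; omega)
      rw [List.getElem_append_right (by omega)] at this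
      simpa using this
    have hu' : Unchanged [4, 5, 6, 7, 8, 9, 10] [6, 7] s
        (((s'.setReg 7 x).setReg 8 (x * n)).setReg 9
        (x * n + (modeNbrs adj S 0 x).length)) :=
      (((hu.setReg (by simp)).setReg (by simp)).setReg (by simp))
    refine WP.seq (WP.asg x ?_ ?_ ?_ (WP.seq (WP.asg (x * n) ?_ ?_ ?_ (WP.seq
      (WP.asg (x * n + (modeNbrs adj S 0 x).length) ?_ ?_ ?_ (WP.seq ?_))))))
    · simp [h6, hmx]
    · simp
    · simp; omega
    · simp [hu.reg 0, h0]
    · simp [hu.reg 0, h0]; omega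
    · simp; omega
    · simp [hu.mem 4, hrx.1]
    · simp [hu.mem 4, hrx.1]; omega
    · simp; omega
    have hq' : HasQueue (((s'.setReg 7 x).setReg 8 (x * n)).setReg 9
        (x * n + (modeNbrs adj S 0 x).length)) (L ++ R) :=
      ⟨hq.nodup, hq.list, by simp [h5'], hq.vis⟩
    refine wp_scanNbrs ?_ hq' (N := modeNbrs adj S 0 x) (a := x * n) ?_ ?_ ?_ ?_ ?_ ?_
    · omega
    · omega
    · simp
    · simp
    · simpa [hu.mem 3] using hrx.2
    · simp; omega
    intro s₂ T₂ R₂ hq₂ hR₂ hN₂ hu₂ hT₂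
    have hmem (y : Fin n) : y ∈ modeNbrs adj S 0 x ↔ (G.modeGraph S 0).Adj x y :=
      (hadj.modeNbrs 0 x).2 y
    have h6₂ : s₂.reg 6 = L.length + h := by rw [hu₂.reg 6 (by simp)]; simp [h6]
    refine WP.asg (L.length + (h + 1)) ?_ ?_ ?_ ⟨R ++ R₂, h + 1, ?_, ⟨?_, ?_, ?_, ?_⟩, ?_, ?_, ?_,
      ?_, ?_,
      (hu'.trans hu₂ (by simp) (by simp)).setReg (by simp), ?_⟩
    · simp [h6₂, add_assoc]
    · simp [h6₂]; omega
    · simp at hT₂ ⊢; omega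
    · simp; omega
    · simpa using hq₂.nodup
    · simpa using hq₂.list
    · simpa using hq₂.len
    · simpa using hq₂.vis
    · simp [hvR]
    · intro z hz
      rcases List.mem_append.1 hz with hz | hz
      · exact hreach z hz
      · exact (hreach x (List.getElem_mem _)).trans ((hmem z).1 (hR₂ z hz)).reachable
    · intro j hj hjh y hy
      rcases Nat.lt_succ_iff_lt_or_eq.1 hjh with hjh | rfl
      · rw [List.getElem_append_left (by omega)] at hy
        have := hscan j (by omega) hjh y hy
        rw [← List.append_assoc]
        exact List.mem_append_left _ this
      · rw [List.getElem_append_left hlt] at hy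
        simpa using hN₂ y ((hmem y).2 hy)
    · simp [hu₂.reg 4, h4]
    · simp
    · rw [Nat.mul_succ]
      simp at hT₂ ⊢
      omega
  · have hh' : h = R.length := by
      have : ¬ h < R.length := by simpa [h5', h6] using he
      omega
    subst hh'
    refine hQ _ _ R hq hvR hreach (fun x hx => ?_) h4 hu ?_
    · obtain ⟨j, hj, rfl⟩ := List.getElem_of_mem hx
      exact hscan j hj hj
    · simp
      omega

end

/-! ### Component orders and separators -/

section

open WordRAM SimpleGraph

variable {n : ℕ} {G : SimpleGraph (Fin n)} {adj : Fin n → List (Fin n)} {S : Finset (Fin n)}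

theorem reachable_induce_of_modeGraph {v x : Fin n} (hv : v ∉ S) (hx : x ∉ S)
    (h : (G.modeGraph S 0).Reachable v x) :
    (G.induce {v : Fin n | v ∉ S}).Reachable ⟨v, hv⟩ ⟨x, hx⟩ := by
  obtain ⟨W⟩ := h
  induction W with
  | nil => exact .refl _
  | cons h _ ih =>
    have hm := (h.2.resolve_left zero_ne_one).2
    refine SimpleGraph.Reachable.trans (v := ⟨_, hm⟩) (SimpleGraph.Adj.reachable ?_) (ih hm hx)
    exact h.1

/-- Vertices reachable from `v` in `G - S` lie in one component, which has at most `k - S.card`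
vertices; the subtraction is exact since `S.card ≤ k`. -/
theorem IsKSeparator.length_add_card_le {k : ℕ} (h : IsKSeparator G S k) {v : Fin n} (hv : v ∉ S)
    {R : List (Fin n)} (hR : R.Nodup) (hreach : ∀ x ∈ R, (G.modeGraph S 0).Reachable v x) :
    S.card + R.length ≤ k := by
  obtain ⟨h₁, h₂⟩ := h
  set C := (G.induce {v : Fin n | v ∉ S}).connectedComponentMk ⟨v, hv⟩ with hC
  have h₃ := h₂ C
  have h₄ : R.length ≤ C.supp.ncard := by
    rw [← List.toFinset_card_of_nodup hR, ← Set.ncard_coe_finset,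
      ← Set.ncard_image_of_injective C.supp Subtype.val_injective]
    refine Set.ncard_le_ncard (fun x hx => ?_) (Set.toFinite _)
    have hx := hreach x (by simpa using hx)
    have hxS := notMem_of_reachable hv hx
    refine ⟨⟨x, hxS⟩, ?_, rfl⟩
    rw [ConnectedComponent.mem_supp_iff, ConnectedComponent.eq]
    exact (reachable_induce_of_modeGraph hv hxS hx).symm
  omega

/-- Applied to this separator, a bound that holds for all admissible `k` gives a bound by `n`. -/
theorem isKSeparator_self : IsKSeparator G S n := by
  refine ⟨by simpa using S.card_le_univ, fun K => (Set.ncard_le_card _).trans ?_⟩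
  have : {v : Fin n | v ∉ S} = ((Sᶜ : Finset (Fin n)) : Set (Fin n)) := by ext; simp
  rw [Nat.card_coe_set_eq, this, Set.ncard_coe_finset, Finset.card_compl, Fintype.card_fin]

/-- The list `L` starts with the vertices of `S`, and continues with components of `G - S` that
have at most `mx` vertices. -/
structure IsComponentOrder (G : SimpleGraph (Fin n)) (S : Finset (Fin n)) (L : List (Fin n))
    (mx : ℕ) : Prop where
  mem_iff : ∀ i (hi : i < L.length), L[i] ∈ S ↔ i < S.card
  mem_of_mem : ∀ v ∈ S, v ∈ L
  closed : ∀ x ∈ L, x ∉ S → ∀ y, (G.modeGraph S 0).Adj x y → y ∈ L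
  window : ∀ i j (hi : i < L.length) (hj : j < L.length), L[i] ∉ S →
    (G.modeGraph S 0).Reachable L[i] L[j] → j < i + mx
  le : ∀ k, IsKSeparator G S k → S.card + mx ≤ k

theorem IsComponentOrder.mem_of_reachable {L : List (Fin n)} {mx : ℕ}
    (h : IsComponentOrder G S L mx) {x y : Fin n} (hx : x ∈ L) (hxS : x ∉ S)
    (hxy : (G.modeGraph S 0).Reachable x y) : y ∈ L := by
  obtain ⟨W⟩ := hxy
  induction W with
  | nil => exact hx
  | cons hadj _ ih =>
    exact ih (h.closed _ hx hxS _ hadj) (hadj.2.resolve_left zero_ne_one).2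

/-- The list `L` contains `S` and is closed under reachability in `G - S`. Hence no vertex of `R` is
in `S` or reachable from a vertex of `L` outside `S`, and only positions inside `R` have to be
compared. -/
theorem IsComponentOrder.append {L R : List (Fin n)} {mx : ℕ} (h : IsComponentOrder G S L mx)
    (hnd : (L ++ R).Nodup) {v : Fin n} (hv : v ∈ R)
    (hreach : ∀ x ∈ R, (G.modeGraph S 0).Reachable v x)
    (hcl : ∀ x ∈ R, ∀ y, (G.modeGraph S 0).Adj x y → y ∈ L ++ R) :
    IsComponentOrder G S (L ++ R) (max mx R.length) := by
  have hdisj := List.disjoint_of_nodup_append hnd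
  have hvS : v ∉ S := fun h' => hdisj (h.mem_of_mem v h') hv
  have hRS : ∀ x ∈ R, x ∉ S := fun x hx => notMem_of_reachable hvS (hreach x hx)
  have hcard : S.card ≤ L.length := by
    rw [← List.toFinset_card_of_nodup (List.Nodup.of_append_left hnd)]
    exact Finset.card_le_card fun x hx => List.mem_toFinset.2 (h.mem_of_mem x hx)
  refine ⟨fun i hi => ?_, fun x hx => List.mem_append_left _ (h.mem_of_mem x hx),
    fun x hx hxS y hy => ?_, fun i j hi hj hiS hr => ?_, fun k hk => ?_⟩
  · rw [List.getElem_append]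
    split_ifs with hiL
    · exact h.mem_iff i hiL
    · exact ⟨fun h' => absurd h' (hRS _ (List.getElem_mem _)), fun h' => by omega⟩
  · rcases List.mem_append.1 hx with hx | hx
    · exact List.mem_append_left _ (h.closed x hx hxS y hy)
    · exact hcl x hx y hy
  · rw [List.length_append] at hi hj
    rw [List.getElem_append] at hiS hr
    rw [List.getElem_append] at hr
    split_ifs at hiS hr with hiL hjL hjL
    · have := h.window i j hiL hjL hiS hr
      omega
    · exact absurd (List.getElem_mem _) (hdisj (h.mem_of_reachable (List.getElem_mem _) hiS hr))
    · exact absurd (List.getElem_mem _) (hdisj (h.mem_of_reachable (List.getElem_mem hjL)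
        (notMem_of_reachable hiS hr) hr.symm) ·)
    · omega
  · have h₁ := h.le k hk
    have h₂ := hk.length_add_card_le hvS (List.Nodup.of_append_right hnd) hreach
    omega

/-- Compute the order (array `6`), and the size `K` (variable `1`) of `S` and the largest component
together.  Variable `3` is a vertex, variable `11` the size of the largest component so far, and
variable `12` the size of `S`. -/
def orderVertices : Program :=
  asg 5 (.lit 0) ;; asg 3 (.lit 0) ;;
  loopWhile (.var 3 <ₑ .var 0) (cond (.ld 2 (.var 3)) (push 3) .skip ;; asg 3 (.var 3 +ₑ .lit 1)) ;;
  asg 12 (.var 5 +ₑ .lit 0) ;; asg 11 (.lit 0) ;; asg 3 (.lit 0) ;;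
  loopWhile (.var 3 <ₑ .var 0)
    (cond (.ld 7 (.var 3)) .skip
      (explore ;; cond (.var 11 <ₑ .var 5 -ₑ .var 4) (asg 11 (.var 5 -ₑ .var 4)) .skip) ;;
    asg 3 (.var 3 +ₑ .lit 1)) ;;
  asg 1 (.var 12 +ₑ .var 11)

/-- The order of all vertices is available. -/
structure HasOrder (G : SimpleGraph (Fin n)) (S : Finset (Fin n)) (s : State) (L : List (Fin n))
    (K : ℕ) : Prop where
  list : HoldsList (s.mem 6) 0 L
  reg1 : s.reg 1 = K
  length : L.length = n
  card_le : S.card ≤ K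
  mem_iff : ∀ i (hi : i < L.length), L[i] ∈ S ↔ i < S.card
  mem : ∀ v, v ∈ L
  window : ∀ i j (hi : i < L.length) (hj : j < L.length), L[i] ∉ S →
    (G.modeGraph S 0).Reachable L[i] L[j] → j < i + K
  le : ∀ k, IsKSeparator G S k → K ≤ k

theorem wp_orderVertices {B : ℕ} {hn : 0 < n} (hadj : IsAdjLists G adj)
    (hB : 4 * (n * n) + 4 * n + 4 < B)
    {s : State} (hs : HasInput adj S s) (hr : HasRows hn adj S s (2 * n)) (h7 : ∀ i, s.mem 7 i = 0)
    {c : ℕ} (hc : ∀ x, 30 * (modeNbrs adj S 0 x).length + 60 ≤ c) {T : ℕ}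
    (hT : c * n + 200 * n + 100 ≤ T) {Q : State → ℕ → Prop}
    (hQ : ∀ s' T' L K, HasOrder G S s' L K →
      Unchanged [1, 3, 4, 5, 6, 7, 8, 9, 10, 11, 12] [6, 7] s s' →
      T ≤ T' + (c * n + 200 * n + 100) → Q s' T') :
    WP B orderVertices Q s T := by
  have h0 := hs.reg_zero
  refine WP.seq (WP.asg 0 (by simp) (by simp; omega) (by simp; omega)
    (WP.seq (WP.asg 0 (by simp) (by simp; omega) (by simp; omega) (WP.seq ?_))))
  -- This loop puts `S` at the front of the queue. Marking its vertices as visited is harmless for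
  -- the exploration, which takes place in `G - S`.
  refine WP.loopWhile (fun s' T' => ∃ p ≤ n, ∃ L : List (Fin n), s'.reg 3 = p ∧ HasQueue s' L ∧
    (∀ x : Fin n, x ∈ L ↔ x ∈ S ∧ x < p) ∧ Unchanged [3, 5] [6, 7] s s' ∧ T ≤ T' + 30 * p + 2)
    ⟨0, Nat.zero_le _, [], by simp, ⟨by simp, by simp [HoldsList], by simp, by simp [h7]⟩, by simp,
      ((Unchanged.refl s).setReg (by simp)).setReg (by simp), by simp; omega⟩ ?_
  rintro s' T' ⟨p, hp, L, h3, hq, hL, hu, hT'⟩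
  have h0' : s'.reg 0 = n := by rw [hu.reg 0 (by simp), h0]
  refine ⟨?_, ?_, fun he => ?_, fun he => ?_⟩
  · simp
    exact ite_one_zero_lt (by omega) _
  · simp
    omega
  · have hlt : p < n := by simpa [h0', h3] using he
    have hsep : s'.mem 2 p = mode S ⟨p, hlt⟩ := by rw [hu.mem 2 (by simp)]; exact hs.sep ⟨p, hlt⟩
    refine WP.seq (WP.cond ?_ ?_ (fun hc => ?_) fun hc => ?_)
    · simp
    · simp; omega
    · have hpS : (⟨p, hlt⟩ : Fin n) ∈ S := by simpa [h3, hsep, mode] using hc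
      refine wp_push ?_ hq (y := ⟨p, hlt⟩) (by simp [h3]) ?_ ?_ fun s₂ T₂ hq₂ hu₂ hT₂ => ?_
      · omega
      · rw [hL]
        simp
      · simp; omega
      have h3₂ : s₂.reg 3 = p := by rw [hu₂.reg 3 (by simp), h3]
      refine WP.asg (p + 1) ?_ ?_ ?_ ⟨p + 1, hlt, _, ?_, ⟨hq₂.nodup, hq₂.list, ?_, hq₂.vis⟩, ?_,
        (hu.trans hu₂ (by simp) (by simp)).setReg (by simp), ?_⟩
      · simp [h3₂]
      · simp [h3₂]; omega
      · simp at hT₂ ⊢; omega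
      · simp
      · simp [hq₂.len]
      · intro x
        rw [List.mem_append, hL, List.mem_singleton, Fin.ext_iff, Nat.lt_succ_iff_lt_or_eq]
        constructor
        · rintro (⟨hx, hx'⟩ | hx)
          · exact ⟨hx, .inl hx'⟩
          · exact ⟨by rwa [show x = ⟨p, hlt⟩ from Fin.ext hx], .inr hx⟩
        · rintro ⟨hx, hx' | hx'⟩
          exacts [.inl ⟨hx, hx'⟩, .inr hx']
      · simp at hT₂ ⊢; omega
    · have hpS : (⟨p, hlt⟩ : Fin n) ∉ S := by simpa [h3, hsep, mode] using hc
      refine WP.skip ?_ (WP.asg (p + 1) ?_ ?_ ?_ ⟨p + 1, hlt, L, ?_, ⟨hq.nodup, hq.list, ?_,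
        hq.vis⟩, ?_,
        hu.setReg (by simp), ?_⟩)
      · simp; omega
      · simp [h3]
      · simp [h3]; omega
      · simp; omega
      · simp
      · simp [hq.len]
      · intro x
        rw [hL, Nat.lt_succ_iff_lt_or_eq]
        refine and_congr_right fun hx => (or_iff_left fun h => hpS ?_).symm
        rwa [show (⟨p, hlt⟩ : Fin n) = x from Fin.ext h.symm]
      · simp; omega
  have hp' : p = n := by
    have : ¬ p < n := by simpa [h0', h3] using he
    omega
  subst hp'
  replace hL (x : Fin p) : x ∈ L ↔ x ∈ S := by simp [hL]
  have hlen : L.length = S.card := by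
    rw [← List.toFinset_card_of_nodup hq.nodup]
    congr 1
    ext x
    simp [hL]
  have hcard : S.card ≤ p := by simpa using S.card_le_univ
  have hord : IsComponentOrder G S L 0 := by
    refine ⟨fun i hi => ?_, fun v hv => (hL v).2 hv, fun x hx hxS => absurd ((hL x).1 hx) hxS,
      fun i j hi hj hiS => absurd ((hL _).1 (List.getElem_mem _)) hiS, fun k hk => hk.1⟩
    simp [← hlen, hi, ← hL]
  clear hL
  refine WP.seq (WP.asg S.card ?_ ?_ ?_ (WP.seq (WP.asg 0 ?_ ?_ ?_
    (WP.seq (WP.asg 0 ?_ ?_ ?_ (WP.seq ?_))))))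
  · simp [hq.len, hlen]
  · simp [hq.len, hlen]; omega
  · simp; omega
  · simp
  · simp; omega
  · simp; omega
  · simp
  · simp; omega
  · simp; omega
  -- The exploration is charged to the length of the queue, and the loop itself to the counter `v`.
  refine WP.loopWhile (fun s' T' => ∃ v ≤ p, ∃ (L : List (Fin p)) (mx : ℕ), s'.reg 3 = v ∧
    HasQueue s' L ∧ s'.reg 12 = S.card ∧ s'.reg 11 = mx ∧ IsComponentOrder G S L mx ∧
    (∀ x : Fin p, x < v → x ∈ L) ∧ Unchanged [3, 4, 5, 6, 7, 8, 9, 10, 11, 12] [6, 7] s s' ∧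
    T ≤ T' + c * L.length + 80 * v + 30 * p + 20)
    ⟨0, Nat.zero_le _, L, 0, by simp, ⟨hq.nodup, hq.list, by simp [hq.len], hq.vis⟩, by simp,
    by simp,
      hord, by simp, ?_, ?_⟩ ?_
  · have hu' : Unchanged [3, 4, 5, 6, 7, 8, 9, 10, 11, 12] [6, 7] s s' :=
      (Unchanged.refl s).trans hu (by simp) (by simp)
    exact ((hu'.setReg (by simp)).setReg (by simp)).setReg (by simp)
  · simp; omega
  clear! L s' T'
  rintro s' T' ⟨v, hv, L, mx, h3, hq, h12, h11, hord, hL, hu, hT'⟩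
  have h0' : s'.reg 0 = p := by rw [hu.reg 0 (by simp), h0]
  have hmx : S.card + mx ≤ p := hord.le p isKSeparator_self
  have hLp : L.length ≤ p := by simpa using hq.nodup.length_le_card
  have hcL := Nat.mul_le_mul_left c hLp
  refine ⟨?_, ?_, fun he => ?_, fun he => ?_⟩
  · simp
    exact ite_one_zero_lt (by omega) _
  · simp
    omega
  · have hlt : v < p := by simpa [h0', h3] using he
    have hvis := hq.vis ⟨v, hlt⟩
    refine WP.seq (WP.cond ?_ ?_ (fun hc => ?_) fun hc' => ?_)
    · simp
    · simp; omega
    · have hvL : (⟨v, hlt⟩ : Fin p) ∈ L := hvis.1 (by simpa [h3] using hc)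
      refine WP.skip ?_ (WP.asg (v + 1) ?_ ?_ ?_ ⟨v + 1, hlt, L, mx, ?_, ⟨hq.nodup, hq.list, ?_,
        hq.vis⟩,
        ?_, ?_, hord, ?_, hu.setReg (by simp), ?_⟩)
      · simp; omega
      · simp [h3]
      · simp [h3]; omega
      · simp; omega
      · simp
      · simp [hq.len]
      · simp [h12]
      · simp [h11]
      · intro x hx
        rcases Nat.lt_succ_iff_lt_or_eq.1 hx with hx | hx
        · exact hL x hx
        · rwa [show x = ⟨v, hlt⟩ from Fin.ext hx]
      · simp; omega
    · have hvL : (⟨v, hlt⟩ : Fin p) ∉ L := fun h => hvis.2 h (by simpa [h3] using hc')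
      refine WP.seq (wp_explore hadj hB hq (hr.congr (hu.mem 3 (by simp)) (hu.mem 4 (by simp)))
        h0' h3 hvL hc ?_
        fun s₂ T₂ R hq₂ hvR hreach hcl h4 hu₂ hT₂ => ?_)
      · simp
        omega
      have hu' := hu.trans hu₂ (by simp) (by simp)
      have hord₂ := hord.append hq₂.nodup hvR hreach hcl
      have h5₂ := hq₂.len
      have h11₂ := (hu₂.reg 11 (by simp)).trans h11
      have h12₂ := (hu₂.reg 12 (by simp)).trans h12
      have h3₂ := (hu₂.reg 3 (by simp)).trans h3
      have hlen₂ : L.length + R.length ≤ p := by simpa using hq₂.nodup.length_le_card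
      have hcLR := Nat.mul_le_mul_left c hlen₂
      rw [mul_add] at hcLR
      rw [List.length_append] at h5₂
      -- Common continuation of both branches of the update of the maximum.
      have key (s₃ : State) (T₃ : ℕ) (h11₃ : s₃.reg 11 = max mx R.length)
          (hu₃ : Unchanged [11] [] s₂ s₃) (hT₃ : T₂ ≤ T₃ + 12) :
          WP B (asg 3 (.var 3 +ₑ .lit 1)) (fun s' T' => ∃ v ≤ p, ∃ (L : List (Fin p)) (mx : ℕ),
            s'.reg 3 = v ∧ HasQueue s' L ∧ s'.reg 12 = S.card ∧ s'.reg 11 = mx ∧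
            IsComponentOrder G S L mx ∧ (∀ x : Fin p, x < v → x ∈ L) ∧
            Unchanged [3, 4, 5, 6, 7, 8, 9, 10, 11, 12] [6, 7] s s' ∧
            T ≤ T' + c * L.length + 80 * v + 30 * p + 20) s₃ T₃ := by
        have h3₃ := (hu₃.reg 3 (by simp)).trans h3₂
        have hq₃ := hq₂.congr hu₃ (by simp) (by simp) (by simp)
        refine WP.asg (v + 1) ?_ ?_ ?_ ⟨v + 1, hlt, L ++ R, max mx R.length, ?_,
          ⟨hq₃.nodup, hq₃.list, ?_, hq₃.vis⟩, ?_, ?_, hord₂, ?_,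
          (hu'.trans hu₃ (by simp) (by simp)).setReg (by simp), ?_⟩
        · simp [h3₃]
        · simp [h3₃]; omega
        · simp at hT₂ ⊢; omega
        · simp
        · simp [hq₃.len]
        · simp [hu₃.reg 12, h12₂]
        · simp [h11₃]
        · intro x hx
          rcases Nat.lt_succ_iff_lt_or_eq.1 hx with hx | hx
          · exact List.mem_append_left _ (hL x hx)
          · rw [show x = ⟨v, hlt⟩ from Fin.ext hx]
            exact List.mem_append_right _ hvR
        · simp [mul_add] at hT₂ ⊢
          omega
      refine WP.cond ?_ ?_ (fun hc => ?_) fun hc => ?_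
      · simp [h5₂, h4]
        exact ⟨by omega, ite_one_zero_lt (by omega) _⟩
      · simp at hT₂ ⊢; omega
      · have hlt' : mx < R.length := by simpa [h11₂, h5₂, h4] using hc
        refine WP.asg R.length ?_ ?_ ?_ (key _ _ ?_ ((Unchanged.refl _).setReg (by simp)) ?_)
        · simp [h5₂, h4]
        · simp [h5₂, h4]; omega
        · simp at hT₂ ⊢; omega
        · simp; omega
        · simp; omega
      · have hlt' : ¬ mx < R.length := by simpa [h11₂, h5₂, h4] using hc
        refine WP.skip ?_ (key _ _ ?_ (.refl _) ?_)
        · simp at hT₂ ⊢; omega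
        · rw [h11₂]; omega
        · simp; omega
  · have hv' : v = p := by
      have : ¬ v < p := by simpa [h0', h3] using he
      omega
    have hall (x : Fin p) : x ∈ L := hL x (hv' ▸ x.2)
    refine WP.asg (S.card + mx) ?_ ?_ ?_ (hQ _ _ L (S.card + mx) ⟨?_, ?_, ?_, ?_, hord.mem_iff,
      hall,
      fun i j hi hj hiS hij => ?_, hord.le⟩ ?_ ?_)
    · simp [h12, h11]
    · simp [h12, h11]; omega
    · simp; omega
    · simpa using hq.list
    · simp
    · rw [← List.toFinset_card_of_nodup hq.nodup]
      rw [show L.toFinset = Finset.univ by ext; simp [hall]]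
      simp
    · omega
    · have := hord.window i j hi hj hiS hij
      omega
    · exact ((Unchanged.refl s).trans hu (by simp) (by simp)).setReg (by simp)
    · simp; omega

end

/-! ### Invariants of breadth-first search -/

namespace SimpleGraph

variable {V : Type*} {H : SimpleGraph V} {u : V} {N : V → List V} {q : List V}
  {h i : ℕ} {d : V → ℕ} {par : V → V}

/-- The state of a breadth-first search from `u` with queue `q`: the first `h` vertices of the
queue and the first `i` neighbors of the next vertex have been scanned, and all scanned edges belong
to the tree. -/
structure BfsInv (H : SimpleGraph V) (u : V) (N : V → List V) (q : List V) (h i : ℕ)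
    (d : V → ℕ) (par : V → V) : Prop where
  tree : H.IsLevelTree u d par
  nodup : q.Nodup
  mem_iff : ∀ v, v ∈ q ↔ d v ≠ 0
  mono : ∀ j k (hj : j < q.length) (hk : k < q.length), j ≤ k → d q[j] ≤ d q[k]
  scanned : ∀ j (hj : j < q.length), j < h → H.IsScanned d par q[j]
  part : ∀ hh : h < q.length, ∀ y ∈ (N q[h]).take i, d y ≠ 0 ∧ (par q[h] = y ∨ par y = q[h])
  -- A child was discovered from a part of a list that has already been read, so a scan that goes on
  -- never meets a child of the current vertex again.
  child : ∀ y, d y ≠ 0 → y ≠ u → (∃ j, ∃ hj : j < q.length, j < h ∧ par y = q[j]) ∨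
    ∃ hh : h < q.length, par y = q[h] ∧ y ∈ (N q[h]).take i
  -- No depth exceeds that of a waiting vertex by more than one; this keeps the queue sorted.
  span : ∀ j (hj : j < q.length), h ≤ j → ∀ v, d v ≠ 0 → d v ≤ d q[j] + 1

theorem bfsInv_init [DecidableEq V] (hpar : par u = u) :
    BfsInv H u N [u] 0 0 (fun v => if v = u then 1 else 0) par := by
  refine ⟨⟨by simp, hpar, by simp⟩, by simp, by simp, ?_, by simp, by simp, by simp, ?_⟩
  · intro j k hj hk _
    simp at hj hk
    simp [hj, hk]
  · intro j hj _ v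
    split_ifs <;> simp

namespace BfsInv

theorem getElem_ne_zero (hb : BfsInv H u N q h i d par) {j : ℕ} (hj : j < q.length) :
    d q[j] ≠ 0 := (hb.mem_iff _).1 (List.getElem_mem hj)

theorem next (hb : BfsInv H u N q h i d par) (hN : ∀ x y, y ∈ N x ↔ H.Adj x y)
    (hh : h < q.length) (hi : (N q[h]).length ≤ i) : BfsInv H u N q (h + 1) 0 d par := by
  obtain ⟨h₁, h₂, h₃, h₄, h₅, h₆, h₇, h₈⟩ := hb
  refine ⟨h₁, h₂, h₃, h₄, fun j hj hjh => ?_, by simp, fun y hy hyu => .inl ?_,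
    fun j hj hjh => h₈ j hj (by omega)⟩
  · rcases Nat.lt_succ_iff_lt_or_eq.1 hjh with hjh | rfl
    · exact h₅ j hj hjh
    · exact fun y hy => h₆ hj y (by rw [List.take_of_length_le hi]; exact (hN _ _).2 hy)
  · rcases h₇ y hy hyu with ⟨j, hj, hjh, hp⟩ | ⟨hh, hp, -⟩
    exacts [⟨j, hj, by omega, hp⟩, ⟨h, hh, by omega, hp⟩]

theorem skip (hb : BfsInv H u N q h i d par) (hN : ∀ x y, y ∈ N x ↔ H.Adj x y)
    (hh : h < q.length) (hi : i < (N q[h]).length) (hy : (N q[h])[i] = par q[h]) :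
    BfsInv H u N q h (i + 1) d par := by
  have hadj : H.Adj q[h] (par q[h]) := by
    rw [← hy]
    exact (hN _ _).1 (List.getElem_mem _)
  -- The root is recorded as its own parent, which is never one of its neighbors.
  have hne : q[h] ≠ u := fun hu => by
    rw [hu, hb.tree.par_root] at hadj
    exact hadj.ne rfl
  obtain ⟨h₁, h₂, h₃, h₄, h₅, h₆, h₇, h₈⟩ := hb
  refine ⟨h₁, h₂, h₃, h₄, h₅, fun _ y hy' => ?_, fun y hy hyu => ?_, h₈⟩
  · rw [← List.take_concat_get' _ _ hi, List.mem_append, List.mem_singleton] at hy'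
    rcases hy' with hy' | rfl
    · exact h₆ hh y hy'
    · rw [hy]
      exact ⟨(h₁.step _ ((h₃ _).1 (List.getElem_mem _)) hne).1, .inl rfl⟩
  · rcases h₇ y hy hyu with h' | ⟨hh, hp, hy'⟩
    exacts [.inl h', .inr ⟨hh, hp, (List.take_subset_take_left _ (by omega)) hy'⟩]

/-- By `span` the new value `d q[h] + 1` is at least every other value, so appending keeps the queue
sorted. On the old tree `d` and `par` do not change, because the new vertex was outside it. -/
theorem push [DecidableEq V] (hb : BfsInv H u N q h i d par) (hN : ∀ x y, y ∈ N x ↔ H.Adj x y)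
    (hh : h < q.length) (hi : i < (N q[h]).length) (hy : d (N q[h])[i] = 0) :
    BfsInv H u N (q ++ [(N q[h])[i]]) h (i + 1)
      (Function.update d (N q[h])[i] (d q[h] + 1)) (Function.update par (N q[h])[i] q[h]) := by
  set x := q[h] with hx
  set y := (N x)[i] with hydef
  have hadj : H.Adj x y := (hN _ _).1 (List.getElem_mem _)
  have hdx : d x ≠ 0 := hb.getElem_ne_zero hh
  have hd {z : V} (hz : d z ≠ 0) : Function.update d y (d x + 1) z = d z :=
    Function.update_of_ne (by rintro rfl; exact hz hy) ..
  have hp {z : V} (hz : d z ≠ 0) : Function.update par y x z = par z :=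
    Function.update_of_ne (by rintro rfl; exact hz hy) ..
  have hrel {z w : V} (hz : d z ≠ 0) (hw : d w ≠ 0 ∧ (par z = w ∨ par w = z)) :
      Function.update d y (d x + 1) w ≠ 0 ∧
        (Function.update par y x z = w ∨ Function.update par y x w = z) := by
    rw [hd hw.1, hp hz, hp hw.1]
    exact hw
  have hyq : y ∉ q := fun h => (hb.mem_iff _).1 h hy
  have hdu : d u ≠ 0 := by simp [hb.tree.root]
  have hyu : y ≠ u := by rintro h; exact hdu (h ▸ hy)
  have hget {j : ℕ} (hj : j < q.length) : (q ++ [y])[j]'(by simp; omega) = q[j] :=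
    List.getElem_append_left hj
  have hlen : (q ++ [y]).length = q.length + 1 := by simp
  have hge (j : ℕ) (hj : j < (q ++ [y]).length) : (∃ hj' : j < q.length, (q ++ [y])[j] = q[j]) ∨
      j = q.length ∧ (q ++ [y])[j] = y := by
    by_cases hj' : j < q.length
    · exact .inl ⟨hj', hget hj'⟩
    · have : j = q.length := by omega
      subst this
      simp
  have hdx1 : Function.update d y (d x + 1) y = d x + 1 := Function.update_self ..
  obtain ⟨h₁, h₂, h₃, h₄, h₅, h₆, h₇, h₈⟩ := id hb
  refine ⟨⟨?_, ?_, fun z hz hzu => ?_⟩, ?_, fun v => ?_, fun j k hj hk hjk => ?_, fun j hj hjh =>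
    ?_,
    fun hh' z hz => ?_, fun z hz hzu => ?_, fun j hj hjh v hv => ?_⟩
  · rw [hd hdu, h₁.root]
  · rw [hp hdu, h₁.par_root]
  · by_cases hzy : z = y
    · subst hzy
      rw [Function.update_self, hd hdx, Function.update_self]
      exact ⟨hdx, hadj, rfl⟩
    · rw [Function.update_of_ne hzy] at hz ⊢
      rw [Function.update_of_ne hzy]
      have := h₁.step z hz hzu
      rwa [hd this.1]
  · exact List.nodup_append.2 ⟨h₂, by simp, fun a ha b hb => by
      rintro rfl
      exact hyq (List.mem_singleton.1 hb ▸ ha)⟩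
  · rw [List.mem_append, List.mem_singleton, h₃]
    by_cases hvy : v = y
    · simp [hvy]
    · simp [hvy]
  · rcases hge j hj with ⟨hj', e⟩ | ⟨rfl, e⟩ <;> rcases hge k hk with ⟨hk', e'⟩ | ⟨hk', e'⟩ <;>
      simp only [e, e']
    · rw [hd (hb.getElem_ne_zero hj'), hd (hb.getElem_ne_zero hk')]
      exact h₄ j k hj' hk' hjk
    · rw [hd (hb.getElem_ne_zero hj'), hdx1]
      exact h₈ h hh le_rfl _ (hb.getElem_ne_zero hj')
    · omega
    · exact le_rfl
  · have hj' : j < q.length := by omega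
    rw [hget hj']
    exact fun w hw => hrel (hb.getElem_ne_zero hj') (h₅ j hj' hjh w hw)
  · rw [hget hh] at hz ⊢
    rw [← List.take_concat_get' _ _ hi, List.mem_append, List.mem_singleton] at hz
    rcases hz with hz | rfl
    · exact hrel hdx (h₆ hh z hz)
    · rw [← hydef, hdx1, Function.update_self]
      exact ⟨by omega, .inr rfl⟩
  · by_cases hzy : z = y
    · refine .inr ⟨by omega, ?_⟩
      rw [hget hh, hzy, Function.update_self]
      exact ⟨rfl, List.mem_take_iff_getElem.2 ⟨i, by omega, rfl⟩⟩
    · rw [Function.update_of_ne hzy] at hz ⊢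
      rcases h₇ z hz hzu with ⟨j, hj, hjh, e⟩ | ⟨hh', e, hz'⟩
      · exact .inl ⟨j, by omega, hjh, by rw [hget hj, e]⟩
      · refine .inr ⟨by omega, ?_⟩
        rw [hget hh]
        exact ⟨e, (List.take_subset_take_left _ (by omega)) hz'⟩
  · have hv' : Function.update d y (d x + 1) v ≤ d x + 1 := by
      by_cases hvy : v = y
      · rw [hvy, hdx1]
      · rw [Function.update_of_ne hvy] at hv ⊢
        exact h₈ h hh le_rfl v hv
    rcases hge j hj with ⟨hj', e⟩ | ⟨rfl, e⟩ <;> rw [e]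
    · rw [hd (hb.getElem_ne_zero hj')]
      exact hv'.trans (Nat.succ_le_succ (h₄ h j hh hj' hjh))
    · rw [hdx1]
      exact hv'.trans (Nat.le_succ _)

theorem finish (hb : BfsInv H u N q h i d par) (hh : q.length ≤ h) (z : V) (hz : d z ≠ 0) :
    H.IsScanned d par z := by
  obtain ⟨j, hj, rfl⟩ := List.getElem_of_mem ((hb.mem_iff z).2 hz)
  exact hb.scanned j hj (by omega)

/-- The edge is not a parent edge of `q[h]` by assumption. Nor is it one of its other end: a child
of `q[h]` would be among the neighbors already read, and lists and queue have no repetitions. As the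
other end has value at most `d q[h] + 1`, a vertex `z` with `2 * d z` below the length bound has `d
z < d q[h]`, so it precedes `q[h]` in the queue and has been scanned. -/
theorem closing_edge (hb : BfsInv H u N q h i d par) (hnd : ∀ x, (N x).Nodup)
    (hN : ∀ x y, y ∈ N x ↔ H.Adj x y)
    (hh : h < q.length) (hi : i < (N q[h]).length) (hy : d (N q[h])[i] ≠ 0)
    (hp : (N q[h])[i] ≠ par q[h]) :
    (∃ (a : V) (c : H.Walk a a), c.IsCycle ∧ c.length ≤ d q[h] + d (N q[h])[i] - 1) ∧
      ∀ z, d z ≠ 0 → 2 * d z < d q[h] + d (N q[h])[i] - 1 → H.IsScanned d par z := by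
  have hadj : H.Adj q[h] (N q[h])[i] := (hN _ _).1 (List.getElem_mem _)
  have hx := hb.getElem_ne_zero hh
  refine ⟨hb.tree.exists_isCycle hx hy hadj hp.symm fun hp' => ?_, fun z hz hlt => ?_⟩
  · by_cases hyu : (N q[h])[i] = u
    · rw [hyu, hb.tree.par_root, ← hyu] at hp'
      exact hadj.ne hp'.symm
    · rcases hb.child _ hy hyu with ⟨j, hj, hjh, e⟩ | ⟨hh', e, hm⟩
      · rw [e] at hp'
        have := (List.Nodup.getElem_inj_iff hb.nodup).1 hp'
        omega
      · obtain ⟨j, hj, e⟩ := List.mem_take_iff_getElem.1 hm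
        have := (List.Nodup.getElem_inj_iff (hnd _)).1 e
        omega
  · have hsp := hb.span h hh le_rfl _ hy
    obtain ⟨j, hj, rfl⟩ := List.getElem_of_mem ((hb.mem_iff z).2 hz)
    refine hb.scanned j hj ?_
    by_contra hjh
    have := hb.mono h j hh hj (by omega)
    omega

end BfsInv

/-- Lowering a nonzero bound asks for fewer scanned vertices, and `b = 0` asks for all of them. So
rows stay valid while later searches improve the bound. -/
theorem IsBfsRow.mono [DecidableEq V] {G : SimpleGraph V} {S : Finset V} {b b' : ℕ} {d : V → ℕ}
    (hb : G.IsBfsRow S b u d) (h : b' = b ∨ b' ≠ 0 ∧ (b = 0 ∨ b' ≤ b)) : G.IsBfsRow S b' u d := by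
  obtain ⟨par, ht, hs⟩ := hb
  exact ⟨par, ht, fun z hz hlt => hs z hz (by omega)⟩

end SimpleGraph

section

open WordRAM SimpleGraph

/-! ## Breadth-first search -/

variable {n : ℕ} {G : SimpleGraph (Fin n)} {adj : Fin n → List (Fin n)} {S : Finset (Fin n)}

/-- The outcome of a search from `u` that was started in the state `s₀`. -/
structure IsBfsResult (G : SimpleGraph (Fin n)) (S : Finset (Fin n)) (s₀ : State) (u : Fin n)
    (s : State) : Prop where
  best : s.reg 2 = s₀.reg 2 ∨ s.reg 2 ≠ 0 ∧ (s₀.reg 2 = 0 ∨ s.reg 2 ≤ s₀.reg 2) ∧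
    ∃ (a : Fin n) (c : G.Walk a a), c.IsCycle ∧ c.length ≤ s.reg 2
  le : s.reg 2 ≤ 2 * n
  row : G.IsBfsRow S (s.reg 2) u fun v => s.mem 8 (u * n + v)
  rows : ∀ u', u' ≠ u → ∀ v : Fin n, s.mem 8 (u' * n + v) = s₀.mem 8 (u' * n + v)
  unch : Unchanged [2, 4, 5, 6, 7, 8, 9, 10, 11, 12, 13] [8, 9, 10] s₀ s

/-- A state of the search from `u`. -/
structure BfsState (G : SimpleGraph (Fin n)) (adj : Fin n → List (Fin n)) (S : Finset (Fin n))
    (s₀ : State) (u : Fin n) (q : List (Fin n)) (h i : ℕ) (d : Fin n → ℕ) (par : Fin n → Fin n)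
    (s : State) : Prop where
  inv : BfsInv (G.modeGraph S (mode S u)) u (modeNbrs adj S (mode S u)) q h i d par
  le : ∀ v, d v ≤ q.length
  reg4 : s.reg 4 = u * n
  reg5 : s.reg 5 = mode S u * n
  reg7 : s.reg 7 = q.length
  row : ∀ v : Fin n, s.mem 8 (u * n + v) = d v
  par : ∀ v : Fin n, d v ≠ 0 → s.mem 9 v = par v
  queue : HoldsList (s.mem 10) 0 q
  rows : ∀ u', u' ≠ u → ∀ v : Fin n, s.mem 8 (u' * n + v) = s₀.mem 8 (u' * n + v)
  unch : Unchanged [4, 5, 6, 7, 8, 9, 10, 11, 12, 13] [8, 9, 10] s₀ s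

/-- The state while the neighbors of the vertex at position `h` of the queue are scanned; `T₀`
credits were available at the beginning. -/
def BfsScan (G : SimpleGraph (Fin n)) (adj : Fin n → List (Fin n)) (S : Finset (Fin n))
    (s₀ : State) (u : Fin n) (T₀ h : ℕ) (s : State) (T : ℕ) : Prop :=
  ∃ (q : List (Fin n)) (i : ℕ) (d : Fin n → ℕ) (par : Fin n → Fin n) (k : ℕ) (hh : h < q.length),
    BfsState G adj S s₀ u q h i d par s ∧ i ≤ (modeNbrs adj S (mode S u) q[h]).length ∧ k ≤ 1 ∧
    (k ≠ 0 → par q[h] ∈ (modeNbrs adj S (mode S u) q[h]).take i) ∧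
    s.reg 6 = h + 1 ∧ s.reg 8 = q[h] ∧ s.reg 9 = d q[h] ∧
    s.reg 10 = (mode S u * n + q[h]) * n + i ∧
    s.reg 11 = (mode S u * n + q[h]) * n + (modeNbrs adj S (mode S u) q[h]).length ∧
    -- Potential: a vertex pays once for entering the queue, which covers the tree edge to it, and
    -- twice for leaving it, which covers its setup and the edge to its parent. The flag `k` records
    -- that the parent edge has been seen.
    T₀ ≤ T + 70 * (q.length + 2 * h + k)

theorem BfsScan.weaken {s₀ s : State} {u : Fin n} {T₀ h T T' : ℕ}
    (hs : BfsScan G adj S s₀ u T₀ h s T) (hT : T ≤ T') : BfsScan G adj S s₀ u T₀ h s T' := by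
  obtain ⟨q, i, d, par, k, hh, h₁, h₂, h₃, h₄, h₅, h₆, h₇, h₈, h₉, hT₀⟩ := hs
  exact ⟨q, i, d, par, k, hh, h₁, h₂, h₃, h₄, h₅, h₆, h₇, h₈, h₉, by omega⟩

/-- The state after the search has stopped at an edge that closes a cycle. -/
def BfsStopped (G : SimpleGraph (Fin n)) (S : Finset (Fin n)) (s₀ : State) (u : Fin n) (T₀ : ℕ)
    (s : State) (T : ℕ) : Prop :=
  IsBfsResult G S s₀ u s ∧ s.reg 6 = s.reg 7 ∧ s.reg 10 = s.reg 11 ∧ T₀ ≤ T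

/-- Scan the next edge.  Variable `3` is the source, variable `4` the beginning of its row,
variable `5` the beginning of the neighbor lists for its mode, variables `6` and `7` delimit the
rest of the queue, variable `8` is the vertex that is scanned, variable `9` its distance, variables
`10` and `11` delimit the rest of its list, and variable `12` is the neighbor. -/
def bfsStep : Program :=
  asg 12 (.ld 3 (.var 10)) ;; asg 10 (.var 10 +ₑ .lit 1) ;; asg 13 (.ld 8 (.var 4 +ₑ .var 12)) ;;
  cond (.var 13)
    (cond (.var 12 =ₑ .ld 9 (.var 8)) .skip
      (cond ((.var 2 =ₑ .lit 0) +ₑ ((.var 9 +ₑ .var 13 -ₑ .lit 1) <ₑ .var 2))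
        (asg 2 (.var 9 +ₑ .var 13 -ₑ .lit 1)) .skip ;;
      asg 10 (.var 11 +ₑ .lit 0) ;; asg 6 (.var 7 +ₑ .lit 0)))
    (st 8 (.var 4 +ₑ .var 12) (.var 9 +ₑ .lit 1) ;; st 9 (.var 12) (.var 8) ;;
      st 10 (.var 7) (.var 12) ;; asg 7 (.var 7 +ₑ .lit 1))

/-- The search from the vertex in variable `3`. -/
def bfs : Program :=
  asg 4 (.var 3 *ₑ .var 0) ;; asg 5 (.ld 2 (.var 3) *ₑ .var 0) ;;
  st 8 (.var 4 +ₑ .var 3) (.lit 1) ;; st 9 (.var 3) (.var 3) ;; st 10 (.lit 0) (.var 3) ;;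
  asg 6 (.lit 0) ;; asg 7 (.lit 1) ;;
  loopWhile (.var 6 <ₑ .var 7)
    (asg 8 (.ld 10 (.var 6)) ;; asg 6 (.var 6 +ₑ .lit 1) ;; asg 9 (.ld 8 (.var 4 +ₑ .var 8)) ;;
      asg 10 ((.var 5 +ₑ .var 8) *ₑ .var 0) ;; asg 11 (.var 10 +ₑ .ld 4 (.var 5 +ₑ .var 8)) ;;
      loopWhile (.var 10 <ₑ .var 11) bfsStep)

theorem BfsState.length_le {s₀ s : State} {u : Fin n} {q : List (Fin n)} {h i : ℕ} {d : Fin n → ℕ}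
    {par : Fin n → Fin n} (hs : BfsState G adj S s₀ u q h i d par s) {N : ℕ}
    (hN : ∀ R : List (Fin n), R.Nodup →
      (∀ x ∈ R, (G.modeGraph S (mode S u)).Reachable u x) → R.length ≤ N) : q.length ≤ N :=
  hN q hs.inv.nodup fun x hx => hs.inv.tree.reachable ((hs.inv.mem_iff x).1 hx)

theorem mode_le_one (S : Finset (Fin n)) (u : Fin n) : mode S u ≤ 1 := by
  rw [mode]
  split_ifs <;> simp

/-- The neighbor is the parent, or closes a cycle, or is new. The number `D` stands for credits that
the surrounding loop keeps in reserve, and the additional `10` absorb its test. -/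
theorem wp_bfsStep {B : ℕ} {hn : 0 < n} (hadj : IsAdjLists G adj) (hB : 4 * (n * n) + 4 * n + 4 < B)
    {s₀ s : State} {u : Fin n} (hr : HasRows hn adj S s₀ (2 * n)) (hb : s₀.reg 2 ≤ 2 * n)
    {T₀ T h D : ℕ} (hs : BfsScan G adj S s₀ u T₀ h s (T + (D + 10)))
    (he : s.reg 10 < s.reg 11) (hT : 60 ≤ T) {Q : State → ℕ → Prop}
    (hscan : ∀ s' T', BfsScan G adj S s₀ u T₀ h s' (T' + D) → Q s' T')
    (hclosed : ∀ s' T', BfsStopped G S s₀ u T s' (T' + 60) → Q s' T') :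
    WP B bfsStep Q s T := by
  obtain ⟨q, i, d, par, k, hh, hbs, hi, hk, hkp, h6, h8, h9, h10, h11, hT₀⟩ := hs
  obtain ⟨hinv, hle, h4, h5, h7, hrow, hpar, hqu, hrows, hu⟩ := hbs
  have hmem (v y) : y ∈ modeNbrs adj S (mode S u) v ↔ (G.modeGraph S (mode S u)).Adj v y :=
    (hadj.modeNbrs (S := S) (mode S u) v).2 y
  have hnd (v) : (modeNbrs adj S (mode S u) v).Nodup := (hadj.modeNbrs (S := S) (mode S u) v).1
  have hlt : i < (modeNbrs adj S (mode S u) q[h]).length := by omega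
  have hm2 : mode S u < 2 := Nat.lt_succ_of_le (mode_le_one S u)
  have hrx := (hr.get hm2 q[h]).2
  have hlx := hadj.modeNbrs_length_le (S := S) (mode S u) q[h]
  have hxn := mul_add_lt_mul hm2 q[h].2
  have hp : (mode S u * n + q[h]) * n + i < 2 * n * n := mul_add_lt_mul hxn (by omega)
  rw [mul_assoc 2] at hp
  set y := (modeNbrs adj S (mode S u) q[h])[i] with hy
  have hmy : s.mem 3 ((mode S u * n + q[h]) * n + i) = y := by
    rw [hu.mem 3 (by simp)]
    exact hrx i hlt
  have hyn := y.2
  have huy := mul_add_lt_mul u.2 hyn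
  have hqn : q.length ≤ n := by simpa using hinv.nodup.length_le_card
  have hdx : d q[h] ≤ n := (hle _).trans hqn
  have hdy : d y ≤ n := (hle _).trans hqn
  have hdx0 : d q[h] ≠ 0 := hinv.getElem_ne_zero hh
  have h2 : s.reg 2 = s₀.reg 2 := hu.reg 2 (by simp)
  refine WP.seq (WP.asg y ?_ ?_ ?_ (WP.seq (WP.asg ((mode S u * n + q[h]) * n + (i + 1)) ?_ ?_ ?_
    (WP.seq (WP.asg (d y) ?_ ?_ ?_ (WP.cond ?_ ?_ (fun hc => ?_) fun hc => ?_))))))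
  · simp [h10, hmy]
  · simp
  · simp; omega
  · simp [h10, add_assoc]
  · simp [h10]; omega
  · simp; omega
  · simp [h4, hrow]
  · simp [h4]; omega
  · simp; omega
  · simp
  · simp; omega
  · have hdy0 : d y ≠ 0 := by simpa using hc
    refine WP.cond ?_ ?_ (fun hc' => ?_) (fun hc' => ?_)
    · simp
      exact ite_one_zero_lt (by omega) _
    · simp; omega
    · have hyp : y = par q[h] := by
        have : y.1 = par q[h] := by simpa [h8, hpar _ hdx0] using hc'
        exact Fin.ext this
      -- The list has no repetitions, so the parent is met only once and `k` may go from `0` to `1`.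
      have hk0 : k = 0 := by
        by_contra hk0
        obtain ⟨j, hj, e⟩ := List.mem_take_iff_getElem.1 (hkp hk0)
        rw [← hyp, hy] at e
        have := (List.Nodup.getElem_inj_iff (hnd _)).1 e
        omega
      refine WP.skip ?_ (hscan _ _ ⟨q, i + 1, d, par, 1, hh, ⟨hinv.skip hmem hh hlt hyp, hle, ?_,
        ?_, ?_,
        ?_, ?_, hqu, ?_, ?_⟩, hlt, le_rfl, fun _ => ?_, ?_, ?_, ?_, ?_, ?_, ?_⟩)
      · simp; omega
      · simp [h4]
      · simp [h5]
      · simp [h7]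
      · simpa using hrow
      · simpa using hpar
      · simpa using hrows
      · exact ((hu.setReg (by simp)).setReg (by simp)).setReg (by simp)
      · rw [← hyp]
        exact List.mem_take_iff_getElem.2 ⟨i, by omega, rfl⟩
      · simp [h6]
      · simp [h8]
      · simp [h9]
      · simp
      · simp [h11]
      · simp; omega
    · have hyp : y ≠ par q[h] := fun h => by simp [h8, hpar _ hdx0, h] at hc'
      obtain ⟨⟨a, c, hc, hcl⟩, hsc⟩ := hinv.closing_edge hnd hmem hh hlt hdy0 hyp
      rw [← hy] at hcl hsc
      -- Both branches leave a bound `b` that is at most the length bound of the new cycle, which is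
      -- all that validity of the row requires. Setting the two counters to their limits then ends
      -- both loops.
      have key (s₁ : State) (T₁ b : ℕ) (h2₁ : s₁.reg 2 = b)
          (hu₁ : Unchanged [2, 10, 12, 13] [] s s₁) (hbn : b ≤ 2 * n)
          (hb : b = s₀.reg 2 ∨ b ≠ 0 ∧ (s₀.reg 2 = 0 ∨ b ≤ s₀.reg 2) ∧
            d q[h] + d y - 1 = b) (hb' : b ≠ 0 ∧ b ≤ d q[h] + d y - 1)
          (hT₁ : T ≤ T₁ + 50) :
          WP B (asg 10 (.var 11 +ₑ .lit 0) ;; asg 6 (.var 7 +ₑ .lit 0)) Q s₁ T₁ := by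
        have h11₁ := (hu₁.reg 11 (by simp)).trans h11
        have h7₁ := (hu₁.reg 7 (by simp)).trans h7
        have hp' : (mode S u * n + q[h]) * n + (modeNbrs adj S (mode S u) q[h]).length <
            2 * (n * n) + n := by omega
        refine WP.seq (WP.asg _ rfl ?_ ?_ (WP.asg _ rfl ?_ ?_ (hclosed _ _
          ⟨⟨?_, ?_, ⟨par, ?_, ?_⟩, ?_, ?_⟩, ?_, ?_, ?_⟩)))
        · simp [h11₁]; omega
        · simp; omega
        · simp [h7₁]; omega
        · simp; omega
        · simp only [State.reg_setReg]
          simp [h2₁]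
          rcases hb with hb | ⟨hb0, hb, e⟩
          · exact .inl hb
          · exact .inr ⟨hb0, hb, a, c.mapLe (modeGraph_le _), hc.mapLe _, by simpa [← e] using hcl⟩
        · simpa [h2₁] using hbn
        · simpa [hu₁.mem 8, hrow] using hinv.tree
        · simp [hu₁.mem 8, hrow, h2₁]
          intro z hz hlt
          exact hsc z hz (by omega)
        · simpa [hu₁.mem 8] using hrows
        · exact ((((Unchanged.refl s₀).trans hu (by simp) (by simp)).trans hu₁ (by simp)
            (by simp)).setReg (by simp)).setReg (by simp)
        · simp
        · simp
        · simp; omega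
      refine WP.seq (WP.cond ?_ ?_ (fun hc => ?_) fun hc => ?_)
      · simp [h9]
        and_intros <;> first | omega | (split_ifs <;> omega)
      · simp; omega
      · have hc : s₀.reg 2 = 0 ∨ d q[h] + d y - 1 < s₀.reg 2 := by
          by_contra hcon
          push Not at hcon
          exact hc (by simp [h2, h9, hcon.1, Nat.not_lt.2 hcon.2])
        refine WP.asg (d q[h] + d y - 1) ?_ ?_ ?_ (key _ _ (d q[h] + d y - 1) ?_ ?_ ?_ ?_ ?_ ?_)
        · simp [h9]
        · simp [h9]; omega
        · simp; omega
        · simp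
        · exact ((((Unchanged.refl s).setReg (by simp)).setReg (by simp)).setReg (by simp)).setReg
            (by simp)
        · omega
        · omega
        · omega
        · simp; omega
      · have hc : s₀.reg 2 ≠ 0 ∧ s₀.reg 2 ≤ d q[h] + d y - 1 := by
          by_contra hcon
          have : s₀.reg 2 = 0 ∨ d q[h] + d y - 1 < s₀.reg 2 := by omega
          rcases this with h' | h' <;> simp [h2, h9, h'] at hc
        refine WP.skip ?_ (key _ _ (s₀.reg 2) ?_ ?_ hb (.inl rfl) hc ?_)
        · simp; omega
        · simp [h2]
        · exact (((Unchanged.refl s).setReg (by simp)).setReg (by simp)).setReg (by simp)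
        · simp; omega
  · have hdy0 : d y = 0 := by simpa using hc
    have hpush := hinv.push hmem hh hlt hdy0
    rw [← hy] at hpush
    have hne (v : Fin n) (hv : d v ≠ 0) : v ≠ y := by rintro rfl; exact hv hdy0
    have hqn' : q.length + 1 ≤ n := by simpa using hpush.nodup.length_le_card
    refine WP.seq (WP.st (u * n + y) (d q[h] + 1)
      ?_ ?_ ?_ ?_ ?_ (WP.seq (WP.st y q[h] ?_ ?_ ?_ ?_ ?_
      (WP.seq (WP.st q.length y ?_ ?_ ?_ ?_ ?_ (WP.asg (q.length + 1) ?_ ?_ ?_ (hscan _ _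
      ⟨q ++ [y], i + 1, _, _, k, by simp; omega, ⟨hpush, ?_, ?_, ?_, ?_, ?_, ?_, ?_, ?_, ?_⟩, ?_,
      hk, ?_,
        ?_, ?_, ?_, ?_, ?_, ?_⟩)))))))
    · simp [h4]
    · simp [h9]
    · simp [h4]; omega
    · simp [h9]; omega
    · simp; omega
    · simp
    · simp [h8]
    · simp
    · simp
    · simp; omega
    · simp [h7]
    · simp
    · simp
    · simp
    · simp; omega
    · simp [h7]
    · simp [h7]; omega
    · simp; omega
    · intro v
      have := hle v
      have := hle q[h]
      rw [Function.update_apply]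
      split_ifs <;> simp <;> omega
    · simp [h4]
    · simp [h5]
    · simp
    · intro v
      have := hrow v
      by_cases hv : v = y <;> simp [hv, Fin.val_inj, hrow]
    · intro v hv
      by_cases hvy : v = y
      · simp [hvy]
      · rw [Function.update_of_ne hvy] at hv
        simp [hvy, Fin.val_inj, hpar v hv]
    · exact hqu.concat (fun j hj => by simp [hj.ne]) (by simp)
    · intro u' hu' v
      have : u' * n + v ≠ u * n + y := by
        rw [Ne, mul_add_inj v.2 y.2]
        exact fun h => hu' (Fin.ext h.1)
      simp [this, hrows u' hu' v]
    · exact (((((((hu.setReg (by simp)).setReg (by simp)).setReg (by simp)).setMem (by simp)).setMem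
        (by simp)).setMem (by simp)).setReg (by simp))
    · simpa [List.getElem_append_left hh] using hlt
    · intro hk0
      rw [List.getElem_append_left hh, Function.update_of_ne (hne _ hdx0)]
      exact (List.take_subset_take_left _ (by omega)) (hkp hk0)
    · simp [h6]
    · simp [h8, List.getElem_append_left hh]
    · simp [h9, List.getElem_append_left hh, Function.update_of_ne (hne _ hdx0)]
    · simp [List.getElem_append_left hh]
    · simp [h11, List.getElem_append_left hh]
    · simp; omega

end

/-! ### A complete search and its cost -/

section

open WordRAM SimpleGraph

variable {n : ℕ} {G : SimpleGraph (Fin n)} {adj : Fin n → List (Fin n)} {S : Finset (Fin n)}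

/-- The cost is linear in the number of vertices reached, not of edges: apart from the edge that
ends the search, only tree edges are scanned, each at most once from either end. The constant `210`
is `70 * (1 + 2)`, from the potential with `h ≤ q.length ≤ N`. -/
theorem wp_bfs {B : ℕ} {hn : 0 < n} (hadj : IsAdjLists G adj) (hB : 4 * (n * n) + 4 * n + 4 < B)
    {s₀ : State} (hs₀ : HasInput adj S s₀) (hr : HasRows hn adj S s₀ (2 * n)) {u : Fin n}
    (h3 : s₀.reg 3 = u) (hb : s₀.reg 2 ≤ 2 * n) (hrow : ∀ v : Fin n, s₀.mem 8 (u * n + v) = 0)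
    {N : ℕ} (hN : ∀ R : List (Fin n), R.Nodup →
      (∀ x ∈ R, (G.modeGraph S (mode S u)).Reachable u x) → R.length ≤ N) {T : ℕ}
    (hT : 210 * N + 200 ≤ T) {Q : State → ℕ → Prop}
    (hQ : ∀ s' T', IsBfsResult G S s₀ u s' → T ≤ T' + (210 * N + 200) → Q s' T') :
    WP B bfs Q s₀ T := by
  have h0 := hs₀.reg_zero
  have hsep := hs₀.sep u
  have hm1 := mode_le_one S u
  have hm2 : mode S u < 2 := Nat.lt_succ_of_le hm1
  have hun := u.2
  have huu := mul_add_lt_mul u.2 u.2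
  have hmn := Nat.mul_le_mul_right n hm1
  refine WP.seq (WP.asg (u * n) ?_ ?_ ?_ (WP.seq (WP.asg (mode S u * n) ?_ ?_ ?_ (WP.seq
    (WP.st (u * n + u) 1 ?_ ?_ ?_ ?_ ?_ (WP.seq (WP.st u u ?_ ?_ ?_ ?_ ?_ (WP.seq
    (WP.st 0 u ?_ ?_ ?_ ?_ ?_ (WP.seq (WP.asg 0 ?_ ?_ ?_ (WP.seq (WP.asg 1 ?_ ?_ ?_ ?_)))))))))))))
  · simp [h3, h0]
  · simp [h3, h0]; omega
  · simp; omega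
  · simp [h3, h0, hsep]
  · simp [h3, h0, hsep]; omega
  · simp; omega
  · simp [h3]
  · simp
  · simp [h3]; omega
  · simp; omega
  · simp; omega
  · simp [h3]
  · simp [h3]
  · simp
  · simp
  · simp; omega
  · simp
  · simp [h3]
  · simp; omega
  · simp
  · simp; omega
  · simp
  · simp; omega
  · simp; omega
  · simp
  · simp; omega
  · simp; omega
  refine WP.loopWhile (fun s T' => (∃ (q : List (Fin n)) (h : ℕ) (d : Fin n → ℕ)
    (par : Fin n → Fin n), BfsState G adj S s₀ u q h 0 d par s ∧ h ≤ q.length ∧ s.reg 6 = h ∧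
      T ≤ T' + 70 * (q.length + 2 * h)) ∨ BfsStopped G S s₀ u T s (T' + 210 * N + 100))
    -- The initial parent function is arbitrary away from the root.
    (.inl ⟨[u], 0, fun v => if v = u then 1 else 0, id, ⟨bfsInv_init rfl, ?_, ?_, ?_, ?_, ?_, ?_,
    ?_,
      ?_, ?_⟩, ?_, ?_, ?_⟩) ?_
  · intro v
    simp only [List.length_singleton]
    split_ifs <;> omega
  · simp
  · simp
  · simp
  · intro v
    by_cases hv : v = u <;> simp [hv, Fin.val_inj, hrow]
  · intro v hv
    have : v = u := by simpa using hv
    simp [this]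
  · simp [HoldsList]
  · intro u' hu' v
    have : u' * n + v ≠ u * n + u := by
      rw [Ne, mul_add_inj v.2 u.2]
      exact fun h => hu' (Fin.ext h.1)
    simp [this]
  · exact (((((((Unchanged.refl s₀).setReg (by simp)).setReg (by simp)).setMem (by simp)).setMem
      (by simp)).setMem (by simp)).setReg (by simp)).setReg (by simp)
  · simp
  · simp
  · simp; omega
  rintro s T' (⟨q, h, d, par, hs, hh, h6, hT'⟩ | ⟨hres, h67, h1011, hT'⟩)
  · have hqN := hs.length_le hN
    have hqn : q.length ≤ n := by simpa using hs.inv.nodup.length_le_card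
    have h7 := hs.reg7
    refine ⟨?_, ?_, fun he => ?_, fun he => ?_⟩
    · simp
      exact ite_one_zero_lt (by omega) _
    · simp
      omega
    · have hlt : h < q.length := by simpa [h6, h7] using he
      have h0' : s.reg 0 = n := (hs.unch.reg 0 (by simp)).trans h0
      have hrx := (hr.get hm2 q[h]).1
      have hlx := hadj.modeNbrs_length_le (S := S) (mode S u) q[h]
      have hxn : mode S u * n + q[h] < 2 * n := mul_add_lt_mul hm2 q[h].2
      have hp : (mode S u * n + q[h]) * n + 0 < 2 * n * n := mul_add_lt_mul hxn hn
      rw [mul_assoc 2] at hp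
      have hux : u * n + q[h] < n * n := mul_add_lt_mul u.2 q[h].2
      have hqh := hs.queue h hlt
      rw [zero_add] at hqh
      have hdx : d q[h] ≤ n := (hs.le _).trans hqn
      refine WP.seq (WP.asg q[h] ?_ ?_ ?_ (WP.seq (WP.asg (h + 1) ?_ ?_ ?_ (WP.seq (WP.asg (d q[h])
        ?_
        ?_ ?_ (WP.seq (WP.asg ((mode S u * n + q[h]) * n) ?_ ?_ ?_ (WP.seq
        (WP.asg ((mode S u * n + q[h]) * n + (modeNbrs adj S (mode S u) q[h]).length) ?_ ?_ ?_
          ?_)))))))))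
      · simp [h6, hqh]
      · simp
      · simp; omega
      · simp [h6]
      · simp [h6]; omega
      · simp; omega
      · simp [hs.reg4, hs.row]
      · simp [hs.reg4]; omega
      · simp; omega
      · simp [hs.reg5, h0']
      · simp [hs.reg5, h0']; omega
      · simp; omega
      · simp [hs.reg5, hs.unch.mem 4, hrx]
      · simp [hs.reg5, hs.unch.mem 4, hrx]; omega
      · simp; omega
      refine WP.loopWhile (fun s₁ T₁ => BfsScan G adj S s₀ u T h s₁ (T₁ + 24) ∨
        BfsStopped G S s₀ u T s₁ (T₁ + 210 * N + 90)) (.inl ⟨q, 0, d, par, 0, hlt,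
          ⟨hs.inv, hs.le, ?_, ?_, ?_, ?_, ?_, ?_, ?_, ?_⟩, ?_, ?_, ?_, ?_, ?_, ?_, ?_, ?_, ?_⟩) ?_
      · simp [hs.reg4]
      · simp [hs.reg5]
      · simp [hs.reg7]
      · simpa using hs.row
      · simpa using hs.par
      · simpa using hs.queue
      · simpa using hs.rows
      · exact (((((hs.unch.setReg (by simp)).setReg (by simp)).setReg (by simp)).setReg
          (by simp)).setReg (by simp))
      · simp
      · simp
      · simp
      · simp
      · simp
      · simp
      · simp
      · simp
      · simp; omega
      clear! s T' q
      rintro s T' (hs | ⟨hres, h67, h1011, hT'⟩)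
      · obtain ⟨q, i, d, par, k, hh, hbs, hi, hk, -, h6, -, -, h10, h11, hT'⟩ := id hs
        have hqN := hbs.length_le hN
        refine ⟨?_, ?_, fun he => ?_, fun he => ?_⟩
        · simp
          exact ite_one_zero_lt (by omega) _
        · simp
          omega
        · refine wp_bfsStep hadj hB (D := 24) hr hb (hs.weaken ?_) ?_ ?_
            (fun s' T'' h => .inl h) fun s' T'' ⟨hres, h67, h1011, hT''⟩ => .inr ⟨hres, h67, h1011,
            ?_⟩
          · simp; omega
          · by_contra hcon
            simp [hcon] at he
          · simp; omega
          · simp at hT''; omega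
        · have hi : (modeNbrs adj S (mode S u) q[h]).length ≤ i := by
            simpa [h10, h11] using he
          have hmem (v y) : y ∈ modeNbrs adj S (mode S u) v ↔ (G.modeGraph S (mode S u)).Adj v y :=
            (hadj.modeNbrs (S := S) (mode S u) v).2 y
          refine .inl ⟨q, h + 1, d, par, ⟨hbs.inv.next hmem hh hi, hbs.le, hbs.reg4, hbs.reg5,
            hbs.reg7,
            hbs.row, hbs.par, hbs.queue, hbs.rows, hbs.unch⟩, hh, h6, ?_⟩
          simp
          omega
      · refine ⟨?_, ?_, fun he => ?_, fun he => ?_⟩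
        · simp
          exact ite_one_zero_lt (by omega) _
        · simp
          omega
        · simp [h1011] at he
        · refine .inr ⟨hres, h67, h1011, ?_⟩
          simp
          omega
    · have hh' : q.length ≤ h := by simpa [h6, h7] using he
      refine hQ _ _ ⟨.inl (hs.unch.reg 2 (by simp)), ?_, ⟨par, ?_, ?_⟩, hs.rows, ?_⟩ ?_
      · rwa [hs.unch.reg 2 (by simp)]
      · simpa [hs.row] using hs.inv.tree
      · simp only [hs.row]
        exact fun z hz _ => hs.inv.finish hh' z hz
      · exact (Unchanged.refl s₀).trans hs.unch (by simp) (by simp)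
      · simp
        omega
  · refine ⟨?_, ?_, fun he => ?_, fun he => hQ _ _ hres ?_⟩
    · simp
      exact ite_one_zero_lt (by omega) _
    · simp
      omega
    · simp [h67] at he
    · simp
      omega

end

/-! ### Searches from all vertices -/

section

open WordRAM SimpleGraph

variable {n : ℕ} {G : SimpleGraph (Fin n)} {adj : Fin n → List (Fin n)} {S : Finset (Fin n)}

/-- The searches from the vertices below `p` have been done. -/
structure HasDist (G : SimpleGraph (Fin n)) (S : Finset (Fin n)) (s : State) (p : ℕ) : Prop where
  le : s.reg 2 ≤ 2 * n
  row : ∀ u : Fin n, u < p → G.IsBfsRow S (s.reg 2) u fun v => s.mem 8 (u * n + v)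
  cycle : s.reg 2 ≠ 0 → ∃ (a : Fin n) (c : G.Walk a a), c.IsCycle ∧ c.length ≤ s.reg 2

/-- Search from all vertices. -/
def searchAll : Program :=
  asg 2 (.lit 0) ;; asg 3 (.lit 0) ;; loopWhile (.var 3 <ₑ .var 0) (bfs ;; asg 3 (.var 3 +ₑ .lit 1))

/-- The number of credits that suffices for the searches from the vertices below `p`, if the search
from `u` reaches at most `N u` vertices. -/
def searchCost (hn : 0 < n) (N : Fin n → ℕ) (p : ℕ) : ℕ :=
  ∑ q ∈ Finset.range p, (210 * N (rowVertex hn q) + 220)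

theorem wp_searchAll {B : ℕ} {hn : 0 < n} (hadj : IsAdjLists G adj) (hB : 4 * (n * n)
    + 4 * n + 4 < B)
    {s₀ : State} (hs₀ : HasInput adj S s₀) (hr : HasRows hn adj S s₀ (2 * n))
    (h8 : ∀ i, s₀.mem 8 i = 0)
    {N : Fin n → ℕ} (hN : ∀ (u : Fin n) (R : List (Fin n)), R.Nodup →
      (∀ x ∈ R, (G.modeGraph S (mode S u)).Reachable u x) → R.length ≤ N u) {T : ℕ}
    (hT : searchCost hn N n + 20 ≤ T) {Q : State → ℕ → Prop}
    (hQ : ∀ s' T', HasDist G S s' n →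
      Unchanged [2, 3, 4, 5, 6, 7, 8, 9, 10, 11, 12, 13] [8, 9, 10] s₀ s' →
      T ≤ T' + (searchCost hn N n + 20) → Q s' T') :
    WP B searchAll Q s₀ T := by
  refine WP.seq (WP.asg 0 ?_ ?_ ?_ (WP.seq (WP.asg 0 ?_ ?_ ?_ ?_)))
  · simp
  · simp; omega
  · simp; omega
  · simp
  · simp; omega
  · simp; omega
  refine WP.loopWhile (fun s T' => ∃ p ≤ n, s.reg 3 = p ∧ HasDist G S s p ∧
    (∀ u : Fin n, p ≤ u → ∀ v : Fin n, s.mem 8 (u * n + v) = 0) ∧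
    Unchanged [2, 3, 4, 5, 6, 7, 8, 9, 10, 11, 12, 13] [8, 9, 10] s₀ s ∧
    T ≤ T' + searchCost hn N p + 4) ⟨0, Nat.zero_le _, by simp, ⟨by simp, by simp, by simp⟩,
      by simp [h8], ((Unchanged.refl s₀).setReg (by simp)).setReg (by simp), by simp; omega⟩ ?_
  rintro s T' ⟨p, hp, h3, hd, hz, hu, hT'⟩
  have hcost : p < n → searchCost hn N (p + 1) ≤ searchCost hn N n := fun h =>
    Finset.sum_le_sum_of_subset (Finset.range_subset_range.2 h)
  have hcost' : searchCost hn N p ≤ searchCost hn N n :=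
    Finset.sum_le_sum_of_subset (Finset.range_subset_range.2 hp)
  have hs := hs₀.congr (s' := s) (hu.reg 0 (by simp)) fun x hx => hu.mem x (by simp; omega)
  have h0 := hs.reg_zero
  refine ⟨?_, ?_, fun he => ?_, fun he => ?_⟩
  · simp
    exact ite_one_zero_lt (by omega) _
  · simp
    omega
  · have hlt : p < n := by simpa [h3, h0] using he
    have hcost := hcost hlt
    have hsucc : searchCost hn N (p + 1) = searchCost hn N p + (210 * N (rowVertex hn p) + 220) :=
      Finset.sum_range_succ ..
    have hv : (rowVertex hn p : ℕ) = p := Nat.mod_eq_of_lt hlt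
    set u := rowVertex hn p
    refine WP.seq (wp_bfs hadj hB hs (hr.congr (hu.mem 3 (by simp)) (hu.mem 4 (by simp))) (u := u)
      (by rw [h3, hv]) hd.le (hz u hv.ge) (hN u) ?_ fun s₁ T₁ hres hT₁ => ?_)
    · simp; omega
    have h3₁ : s₁.reg 3 = p := (hres.unch.reg 3 (by simp)).trans h3
    refine WP.asg (p + 1) ?_ ?_ ?_ ⟨p + 1, hlt, ?_, ⟨?_, fun v hv' => ?_, ?_⟩, fun v hv' w => ?_,
      (hu.trans hres.unch (by simp) (by simp)).setReg (by simp), ?_⟩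
    · simp [h3₁]
    · simp [h3₁]; omega
    · simp at hT₁ ⊢; omega
    · simp
    · simpa using hres.le
    · by_cases hvu : v = u
      · subst hvu
        simpa using hres.row
      · have hvp : v < p := by
          have : (v : ℕ) ≠ p := fun h => hvu (Fin.ext (h.trans hv.symm))
          omega
        -- Rows of earlier searches remain valid for the improved bound.
        have := (hd.row v hvp).mono (b' := s₁.reg 2)
          (hres.best.imp_right fun h => ⟨h.1, h.2.1⟩)
        simpa [hres.rows v hvu] using this
    · simp only [State.reg_setReg]
      simp
      intro hne
      rcases hres.best with h | h
      · rw [h] at hne ⊢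
        exact hd.cycle hne
      · exact h.2.2
    · have hvu : v ≠ u := by
        rintro rfl
        omega
      simpa [hres.rows v hvu] using hz v (by omega) w
    · simp at hT₁ ⊢; omega
  · have hp' : p = n := by
      have : ¬ p < n := by simpa [h0, h3] using he
      omega
    subst hp'
    refine hQ _ _ hd hu ?_
    simp
    omega

end

section

open WordRAM SimpleGraph

/-! ## Antipodal edges by matrix multiplication -/

variable {n : ℕ}

/-- The vertices of the window `j`: the first `K` vertices of the order `L`, followed by the `2 * K`
vertices from position `j * K` on. -/
def windowVertex (L : List (Fin n)) (hL : L.length = n) (hn : 0 < n) (K j a : ℕ) : Fin n :=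
  L[(if a < K then a else a + j * K - K) % n]'(by rw [hL]; exact Nat.mod_lt _ hn)

/-- The position in the order of the entry `e` of the window. -/
def windowIndex (e : Ex) : Ex :=
  (e +ₑ (.lit 1 -ₑ (e <ₑ .var 1)) *ₑ .var 12 -ₑ (.lit 1 -ₑ (e <ₑ .var 1)) *ₑ .var 1) %ₑ .var 0

/-- The state in which the matrices for the window `j` are computed.  Variable `5` is the size of
the matrices, variable `6` its square, variable `8` the distance that is looked for. -/
structure IsWindow (hn : 0 < n) (L : List (Fin n)) (K P j : ℕ) (D A : Fin n → Fin n → ℕ)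
    (s : State) : Prop where
  reg0 : s.reg 0 = n
  reg1 : s.reg 1 = K
  reg3 : s.reg 3 = j
  reg5 : s.reg 5 = 3 * K
  reg6 : s.reg 6 = 3 * K * (3 * K)
  reg8 : s.reg 8 = P
  reg12 : s.reg 12 = j * K
  order : HoldsList (s.mem 6) 0 L
  dist : ∀ u v : Fin n, s.mem 8 (u * n + v) = D u v
  matrix : ∀ u v : Fin n, s.mem 5 (u * n + v) = A u v

variable {hn : 0 < n} {L : List (Fin n)} {K P j : ℕ} {D A : Fin n → Fin n → ℕ}

theorem IsWindow.congr {s s' : State} (h : IsWindow hn L K P j D A s) {rs xs : List ℕ}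
    (hs : Unchanged rs xs s s') (hr : ∀ r ∈ [0, 1, 3, 5, 6, 8, 12], r ∉ rs)
    (hx : ∀ x ∈ [5, 6, 8], x ∉ xs) : IsWindow hn L K P j D A s' := by
  obtain ⟨h₁, h₂, h₃, h₄, h₅, h₆, h₇, h₈, h₉, h₁₀⟩ := h
  simp only [List.mem_cons, List.not_mem_nil, or_false, forall_eq_or_imp, forall_eq] at hr hx
  refine ⟨?_, ?_, ?_, ?_, ?_, ?_, ?_, ?_, ?_, ?_⟩
  · rwa [hs.reg 0 hr.1]
  · rwa [hs.reg 1 hr.2.1]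
  · rwa [hs.reg 3 hr.2.2.1]
  · rwa [hs.reg 5 hr.2.2.2.1]
  · rwa [hs.reg 6 hr.2.2.2.2.1]
  · rwa [hs.reg 8 hr.2.2.2.2.2.1]
  · rwa [hs.reg 12 hr.2.2.2.2.2.2]
  · rwa [hs.mem 6 hx.2.1]
  · rwa [hs.mem 8 hx.2.2]
  · rwa [hs.mem 5 hx.1]

/-- Compute the position of the entry `p` of the matrices in the arrays `5` and `8`, where `p` is
variable `7`. -/
def windowEntry : Program :=
  asg 10 (.ld 6 (windowIndex (.var 7 /ₑ .var 5))) ;;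
  asg 11 (.ld 6 (windowIndex (.var 7 %ₑ .var 5))) ;; asg 13 (.var 10 *ₑ .var 0 +ₑ .var 11)

/-- The case distinction is expressed by multiplication with a 0/1 factor, so the cost is the same
for all positions. Subtraction is exact: it takes effect only for `a ≥ K`. -/
theorem wp_windowVertex {B r : ℕ} {e : Ex} {s : State} (hs : IsWindow hn L K P j D A s)
    (hL : L.length = n) (hj : j * K ≤ n) (hK : K ≤ n) (hB : 4 * n + 4 < B) {a : ℕ} (ha : a < 3 * K)
    (he : e.eval s = a) (hf : e.Fits B s) (hc : e.cost = 3) {T : ℕ} (hT : 26 ≤ T)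
    {Q : State → ℕ → Prop}
    (hQ : Q (s.setReg r (windowVertex L hL hn K j a)) (T - 26)) :
    WP B (asg r (.ld 6 (windowIndex e))) Q s T := by
  have key : (windowIndex e).eval s = (if a < K then a else a + j * K - K) % n := by
    simp only [windowIndex, Ex.eval, BinOp.eval, he, hs.reg12, hs.reg1, hs.reg0]
    split_ifs <;> simp
  have hcost : (Ex.ld 6 (windowIndex e)).cost = 26 := by simp [windowIndex, hc]
  refine WP.asg (windowVertex L hL hn K j a) ?_ ?_ (by rwa [hcost]) (by rwa [hcost])
  · rw [Ex.eval, key]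
    have := hs.order ((if a < K then a else a + j * K - K) % n) (by rw [hL]; exact Nat.mod_lt _ hn)
    rwa [zero_add] at this
  · have hmod := Nat.mod_lt (if a < K then a else a + j * K - K) hn
    have h1 : (1 - if a < K then 1 else 0) * (j * K) ≤ 1 * (j * K) :=
      Nat.mul_le_mul_right _ (Nat.sub_le _ _)
    have h2 : (1 - if a < K then 1 else 0) * K ≤ 1 * K :=
      Nat.mul_le_mul_right _ (Nat.sub_le _ _)
    have h3 := ite_one_zero_lt (B := B) (by omega) (a < K)
    simp only [AsgFits, windowIndex, Ex.Fits, Ex.eval, BinOp.eval, he, hs.reg12, hs.reg1, hs.reg0,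
      hf]
    and_intros <;> first | trivial | omega | skip
    refine (Nat.mod_lt _ hn).trans ?_
    omega

theorem wp_windowEntry {B : ℕ} {s : State} (hs : IsWindow hn L K P j D A s) (hL : L.length = n)
    (hj : j * K ≤ n) (hK : K ≤ n) (hB : 9 * (n * n * n) + 9 * (n * n) + 9 * n + 9 < B) {p : ℕ}
    (hp : p < 3 * K * (3 * K)) (h7 : s.reg 7 = p) {T : ℕ} (hT : 60 ≤ T) {Q : State → ℕ → Prop}
    (hQ : ∀ s' T', s'.reg 13 = windowVertex L hL hn K j (p / (3 * K)) * n +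
      windowVertex L hL hn K j (p % (3 * K)) → Unchanged [10, 11, 13] [] s s' → T ≤ T' + 60 →
      Q s' T') : WP B windowEntry Q s T := by
  have hp₁ : p / (3 * K) < 3 * K := Nat.div_lt_of_lt_mul hp
  have hp₂ : p % (3 * K) < 3 * K := Nat.mod_lt _ (Nat.pos_of_ne_zero fun h => by simp [h] at hp)
  have hu₁ : Unchanged [10, 11, 13] [] s
      (s.setReg 10 (windowVertex L hL hn K j (p / (3 * K)))) := (Unchanged.refl s).setReg (by simp)
  have hlt := mul_add_lt_mul (windowVertex L hL hn K j (p / (3 * K))).2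
    (windowVertex L hL hn K j (p % (3 * K))).2
  refine WP.seq (wp_windowVertex hs hL hj hK ?_ hp₁ ?_ ?_ ?_ ?_ (WP.seq (wp_windowVertex
    (hs.congr hu₁ (by simp) (by simp)) hL hj hK ?_ hp₂ ?_ ?_ ?_ ?_
    (WP.asg _ rfl ?_ ?_ (hQ _ _ ?_ ((hu₁.setReg (by simp)).setReg (by simp)) ?_)))))
  · omega
  · simp [h7, hs.reg5]
  · simp [h7, hs.reg5]; omega
  · simp
  · omega
  · omega
  · simp [h7, hs.reg5]
  · simp [h7, hs.reg5]; omega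
  · simp
  · omega
  · simp [hs.reg0]; omega
  · simp; omega
  · simp [hs.reg0]
  · simp; omega

/-- The entry `p` of the first matrix. -/
def windowDist (L : List (Fin n)) (hL : L.length = n) (hn : 0 < n) (K P j : ℕ)
    (D : Fin n → Fin n → ℕ) (p : ℕ) : ℕ :=
  if D (windowVertex L hL hn K j (p / (3 * K))) (windowVertex L hL hn K j (p % (3 * K))) = P
    then 1 else 0

/-- The entry `p` of the second matrix. -/
def windowAdj (L : List (Fin n)) (hL : L.length = n) (hn : 0 < n) (K j : ℕ)
    (A : Fin n → Fin n → ℕ) (p : ℕ) : ℕ :=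
  A (windowVertex L hL hn K j (p / (3 * K))) (windowVertex L hL hn K j (p % (3 * K)))

/-- Store the two matrices and their size in the input of the embedded run number `j`. -/
def fillWindow : Program :=
  st 21 (.var 3) (.var 5) ;; asg 7 (.lit 0) ;;
  loopWhile (.var 7 <ₑ .var 6)
    (windowEntry ;; st 20 (.var 7 *ₑ .var 0 +ₑ .var 3) (.ld 8 (.var 13) =ₑ .var 8) ;;
      st 22 (.var 7 *ₑ .var 0 +ₑ .var 3) (.ld 5 (.var 13)) ;; asg 7 (.var 7 +ₑ .lit 1))

/-- Since the memory of run `j` is zero beforehand, it becomes exactly the initial memory of the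
multiplication: array `21` holds its register `0`, and the arrays `20` and `22` hold its two
matrices. Restoring the registers in `AgreeOutside` expresses a condition on the arrays alone. -/
theorem wp_fillWindow {B : ℕ} {s : State} (hs : IsWindow hn L K P j D A s) (hL : L.length = n)
    (hj : j * K ≤ n) (hjn : j < n) (hK : K ≤ n)
    (hB : 9 * (n * n * n) + 9 * (n * n) + 9 * n + 9 < B)
    (hz : ∀ x i, 20 ≤ x → i % n = j → s.mem x i = 0)
    {T : ℕ} (hT : 100 * (3 * K * (3 * K)) + 20 ≤ T) {Q : State → ℕ → Prop}
    (hQ : ∀ s' T', (∀ i, s'.mem 20 (i * n + j) =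
        if i < 3 * K * (3 * K) then windowDist L hL hn K P j D i else 0) →
      (∀ i, s'.mem 22 (i * n + j) =
        if i < 3 * K * (3 * K) then windowAdj L hL hn K j A i else 0) →
      s'.mem 21 j = 3 * K →
      AgreeOutside j n s { s' with reg := s.reg } → Unchanged [7, 10, 11, 13] [20, 21, 22] s s' →
      T ≤ T' + (100 * (3 * K * (3 * K)) + 20) → Q s' T') : WP B fillWindow Q s T := by
  have hjmod : j % n = j := Nat.mod_eq_of_lt hjn
  have hmod (i : ℕ) : (i * n + j) % n = j := by rw [mul_comm, Nat.mul_add_mod, hjmod]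
  refine WP.seq (WP.st j (3 * K) ?_ ?_ ?_ ?_ ?_ (WP.seq (WP.asg 0 ?_ ?_ ?_ ?_)))
  · simp [hs.reg3]
  · simp [hs.reg5]
  · simp
  · simp
  · simp; omega
  · simp
  · simp; omega
  · simp; omega
  refine WP.loopWhile (fun s' T' => ∃ p ≤ 3 * K * (3 * K), s'.reg 7 = p ∧ (∀ i,
    s'.mem 20 (i * n + j) =
        if i < p then windowDist L hL hn K P j D i else 0) ∧
      (∀ i, s'.mem 22 (i * n + j) = if i < p then windowAdj L hL hn K j A i else 0) ∧
      s'.mem 21 j = 3 * K ∧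
      AgreeOutside j n s { s' with reg := s.reg } ∧ Unchanged [7, 10, 11, 13] [20, 21, 22] s s' ∧
      T ≤ T' + 100 * p + 10)
    ⟨0, Nat.zero_le _, by simp, fun i => ?_, fun i => ?_, by simp, ?_, ?_, ?_⟩ ?_
  · simpa using hz 20 _ (by simp) (hmod i)
  · simpa using hz 22 _ (by simp) (hmod i)
  · exact agreeOutside_setMem s (by simp) hjmod
  · exact ((Unchanged.refl s).setMem (by simp)).setReg (by simp)
  · simp; omega
  rintro s' T' ⟨p, hp, h7, h20, h22, h21, hag, hu, hT'⟩
  have hw := hs.congr hu (by simp) (by simp)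
  refine ⟨?_, ?_, fun he => ?_, fun he => ?_⟩
  · simp
    exact ite_one_zero_lt (by omega) _
  · simp
    omega
  · have hlt : p < 3 * K * (3 * K) := by simpa [h7, hw.reg6] using he
    refine WP.seq (wp_windowEntry hw hL hj hK hB hlt h7 ?_ fun s₁ T₁ h13 hu₁ hT₁ => ?_)
    · simp; omega
    have hw₁ := hw.congr hu₁ (by simp) (by simp)
    have hu' := hu.trans hu₁ (by simp) (by simp)
    have h7₁ := (hu₁.reg 7 (by simp)).trans h7
    have hm (x) : s₁.mem x = s'.mem x := hu₁.mem x (by simp)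
    have hKK : 3 * K * (3 * K) ≤ 3 * n * (3 * n) :=
      Nat.mul_le_mul (Nat.mul_le_mul_left 3 hK) (Nat.mul_le_mul_left 3 hK)
    have hpn : p * n + j < 3 * n * (3 * n) * n := mul_add_lt_mul (hlt.trans_le hKK) hjn
    have e9 : 3 * n * (3 * n) * n = 9 * (n * n * n) := by ring
    have e9' : 3 * n * (3 * n) = 9 * (n * n) := by ring
    simp at hT₁
    refine WP.seq (WP.st (p * n + j) (windowDist L hL hn K P j D p) ?_ ?_ ?_ ?_ ?_ (WP.seq
      (WP.st (p * n + j) (windowAdj L hL hn K j A p) ?_ ?_ ?_ ?_ ?_ (WP.asg (p + 1) ?_ ?_ ?_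
      ⟨p + 1, hlt, ?_, fun i => ?_, fun i => ?_, ?_, ?_, ?_, ?_⟩))))
    · simp [h7₁, hw₁.reg0, hw₁.reg3]
    · simp [h13, hw₁.reg8, hw₁.dist, windowDist]
    · simp [h7₁, hw₁.reg0, hw₁.reg3]; omega
    · simp
      exact ite_one_zero_lt (by omega) _
    · simp; omega
    · simp [h7₁, hw₁.reg0, hw₁.reg3]
    · simp [h13, hw₁.matrix, windowAdj]
    · simp [h7₁, hw₁.reg0, hw₁.reg3]; omega
    · simp
    · simp; omega
    · simp [h7₁]
    · simp [h7₁]; omega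
    · simp; omega
    · simp
    · by_cases hi : i = p
      · subst hi
        simp
      · have : i * n + j ≠ p * n + j := by rw [Ne, mul_add_inj hjn hjn]; exact fun h => hi h.1
        simp only [State.mem_setReg, State.mem_setMem, this, and_false, if_false, hm, h20]
        exact if_congr (by omega) rfl rfl
    · by_cases hi : i = p
      · subst hi
        simp
      · have : i * n + j ≠ p * n + j := by rw [Ne, mul_add_inj hjn hjn]; exact fun h => hi h.1
        simp only [State.mem_setReg, State.mem_setMem, this, and_false, if_false, hm, h22]
        exact if_congr (by omega) rfl rfl
    · simpa [hm] using h21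
    · refine (hag.trans (agreeOutside_setMem _ (x := 20) (v := windowDist L hL hn K P j D p)
        (by simp)
        (hmod p))).trans ?_
      have := agreeOutside_setMem (({ s' with reg := s.reg } : State).setMem 20 (p * n + j)
        (windowDist L hL hn K P j D p)) (x := 22) (v := windowAdj L hL hn K j A p) (by simp)
        (hmod p)
      refine ⟨rfl, fun x hx => ?_, fun x i hi => ?_⟩
      · rw [← this.low x hx]
        ext i
        simp [hm]
      · rw [← this.high x i hi]
        simp [hm]
    · exact ((hu'.setMem (by simp)).setMem (by simp)).setReg (by simp)
    · simp; omega
  · have hp' : p = 3 * K * (3 * K) := by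
      have : ¬ p < 3 * K * (3 * K) := by simpa [h7, hw.reg6] using he
      omega
    subst hp'
    refine hQ _ _ h20 h22 h21 hag hu ?_
    simp
    omega

end

/-! ### Multiplication and test in one window -/

section

open WordRAM SimpleGraph

variable {n : ℕ} {hn : 0 < n} {L : List (Fin n)} {K P j : ℕ} {D A : Fin n → Fin n → ℕ}

/-- The first matrix of the window `j`. -/
def windowDistMatrix (L : List (Fin n)) (hL : L.length = n) (hn : 0 < n) (K P j : ℕ)
    (D : Fin n → Fin n → ℕ) : Matrix (Fin (3 * K)) (Fin (3 * K)) ℕ :=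
  fun a b => if D (windowVertex L hL hn K j a) (windowVertex L hL hn K j b) = P then 1 else 0

/-- The second matrix of the window `j`. -/
def windowAdjMatrix (L : List (Fin n)) (hL : L.length = n) (hn : 0 < n) (K j : ℕ)
    (A : Fin n → Fin n → ℕ) : Matrix (Fin (3 * K)) (Fin (3 * K)) ℕ :=
  fun a b => A (windowVertex L hL hn K j a) (windowVertex L hL hn K j b)

/-- The entries of the window with index below `p` contain an antipodal edge. -/
def HasAntipodal (L : List (Fin n)) (hL : L.length = n) (hn : 0 < n) (K P j : ℕ)
    (D A : Fin n → Fin n → ℕ) (p : ℕ) : Prop :=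
  ∃ a b : Fin (3 * K), a * (3 * K) + b < p ∧ windowDistMatrix L hL hn K P j D a b ≠ 0 ∧
    (windowDistMatrix L hL hn K P j D * windowAdjMatrix L hL hn K j A) a b ≠ 0

/-- Set variable `9` if the window contains an antipodal edge. -/
def checkWindow : Program :=
  asg 7 (.lit 0) ;;
  loopWhile (.var 7 <ₑ .var 6)
    (windowEntry ;;
      cond ((.ld 8 (.var 13) =ₑ .var 8) *ₑ .ld 24 (.var 7 *ₑ .var 0 +ₑ .var 3)) (asg 9 (.lit 1))
      .skip ;;
      asg 7 (.var 7 +ₑ .lit 1))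

theorem hasAntipodal_succ (hL : L.length = n) {a b : Fin (3 * K)} :
    HasAntipodal L hL hn K P j D A (a * (3 * K) + b + 1) ↔
      HasAntipodal L hL hn K P j D A (a * (3 * K) + b) ∨ windowDistMatrix L hL hn K P j D a b ≠ 0 ∧
        (windowDistMatrix L hL hn K P j D * windowAdjMatrix L hL hn K j A) a b ≠ 0 := by
  constructor
  · rintro ⟨a', b', h, h'⟩
    rcases Nat.lt_succ_iff_lt_or_eq.1 h with h | h
    · exact .inl ⟨a', b', h, h'⟩
    · obtain ⟨h₁, h₂⟩ := (mul_add_inj b'.2 b.2).1 h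
      rw [Fin.ext h₁, Fin.ext h₂] at h'
      exact .inr h'
  · rintro (⟨a', b', h, h'⟩ | h')
    · exact ⟨a', b', by omega, h'⟩
    · exact ⟨a, b, by omega, h'⟩

theorem wp_checkWindow {B : ℕ} {s : State} (hs : IsWindow hn L K P j D A s) (hL : L.length = n)
    (hj : j * K ≤ n) (hjn : j < n) (hK : K ≤ n)
    (hB : 9 * (n * n * n) + 9 * (n * n) + 9 * n + 9 < B)
    (h24 : ∀ a b : Fin (3 * K), s.mem 24 ((a * (3 * K) + b) * n + j) =
      (windowDistMatrix L hL hn K P j D * windowAdjMatrix L hL hn K j A) a b)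
    (hfit : ∀ a b, (windowDistMatrix L hL hn K P j D * windowAdjMatrix L hL hn K j A) a b < B)
    {T : ℕ} (hT : 100 * (3 * K * (3 * K)) + 20 ≤ T) {Q : State → ℕ → Prop}
    (hQ : ∀ s' T', (s'.reg 9 ≠ 0 ↔ s.reg 9 ≠ 0 ∨
        HasAntipodal L hL hn K P j D A (3 * K * (3 * K))) →
      Unchanged [7, 9, 10, 11, 13] [] s s' → T ≤ T' + (100 * (3 * K * (3 * K)) + 20) → Q s' T') :
    WP B checkWindow Q s T := by
  refine WP.seq (WP.asg 0 ?_ ?_ ?_ ?_)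
  · simp
  · simp; omega
  · simp; omega
  refine WP.loopWhile (fun s' T' => ∃ p ≤ 3 * K * (3 * K), s'.reg 7 = p ∧
      (s'.reg 9 ≠ 0 ↔ s.reg 9 ≠ 0 ∨ HasAntipodal L hL hn K P j D A p) ∧
      Unchanged [7, 9, 10, 11, 13] [] s s' ∧ T ≤ T' + 100 * p + 10)
    ⟨0, Nat.zero_le _, by simp, ?_, (Unchanged.refl s).setReg (by simp), ?_⟩ ?_
  · simp [HasAntipodal]
  · simp; omega
  rintro s' T' ⟨p, hp, h7, h9, hu, hT'⟩
  have hw := hs.congr hu (by simp) (by simp)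
  refine ⟨?_, ?_, fun he => ?_, fun he => ?_⟩
  · simp
    exact ite_one_zero_lt (by omega) _
  · simp
    omega
  · have hlt : p < 3 * K * (3 * K) := by simpa [h7, hw.reg6] using he
    have hKpos : 0 < 3 * K := Nat.pos_of_ne_zero fun h => by simp [h] at hlt
    obtain ⟨a, ha⟩ : ∃ a : Fin (3 * K), (a : ℕ) = p / (3 * K) :=
      ⟨⟨p / (3 * K), Nat.div_lt_of_lt_mul hlt⟩, rfl⟩
    obtain ⟨b, hb⟩ : ∃ b : Fin (3 * K), (b : ℕ) = p % (3 * K) :=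
      ⟨⟨p % (3 * K), Nat.mod_lt _ hKpos⟩, rfl⟩
    have hab : (a : ℕ) * (3 * K) + b = p := by rw [ha, hb, Nat.div_add_mod']
    refine WP.seq (wp_windowEntry hw hL hj hK hB hlt h7 ?_ fun s₁ T₁ h13 hu₁ hT₁ => ?_)
    · simp; omega
    rw [← ha, ← hb] at h13
    have hw₁ := hw.congr hu₁ (by simp) (by simp)
    have hu' := hu.trans hu₁ (by simp) (by simp)
    have h7₁ := (hu₁.reg 7 (by simp)).trans h7
    have h9₁ := hu₁.reg 9 (by simp)
    have hprod : s₁.mem 24 (p * n + j) =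
        (windowDistMatrix L hL hn K P j D * windowAdjMatrix L hL hn K j A) a b := by
      rw [hu'.mem 24 (by simp), ← hab, h24]
    have hdist : windowDistMatrix L hL hn K P j D a b ≠ 0 ↔
        D (windowVertex L hL hn K j a) (windowVertex L hL hn K j b) = P := by
      simp [windowDistMatrix]
    have hsucc := hasAntipodal_succ (hn := hn) (P := P) (j := j) (D := D) (A := A) hL (a := a)
      (b := b)
    rw [hab] at hsucc
    have hKK : 3 * K * (3 * K) ≤ 3 * n * (3 * n) :=
      Nat.mul_le_mul (Nat.mul_le_mul_left 3 hK) (Nat.mul_le_mul_left 3 hK)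
    have hpn : p * n + j < 3 * n * (3 * n) * n := mul_add_lt_mul (hlt.trans_le hKK) hjn
    have e9 : 3 * n * (3 * n) * n = 9 * (n * n * n) := by ring
    have e9' : 3 * n * (3 * n) = 9 * (n * n) := by ring
    simp at hT₁
    have hfab := hfit a b
    refine WP.seq (WP.cond ?_ ?_ (fun hc => ?_) fun hc => ?_)
    · simp [h7₁, hw₁.reg0, hw₁.reg3, hprod]
      refine ⟨ite_one_zero_lt (by omega) _, ⟨by omega, by omega⟩, ?_⟩
      by_cases hd : s₁.mem 8 (s₁.reg 13) = s₁.reg 8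
      · simpa [hd] using hfab
      · simp [hd]; omega
    · simp; omega
    · have hc : windowDistMatrix L hL hn K P j D a b ≠ 0 ∧
          (windowDistMatrix L hL hn K P j D * windowAdjMatrix L hL hn K j A) a b ≠ 0 := by
        rw [hdist]
        simpa [h13, hw₁.reg8, hw₁.dist, h7₁, hw₁.reg0, hw₁.reg3, hprod] using hc
      refine WP.asg 1 ?_ ?_ ?_ (WP.asg (p + 1) ?_ ?_ ?_ ⟨p + 1, hlt, ?_, ?_,
        (hu'.setReg (by simp)).setReg (by simp), ?_⟩)
      · simp
      · simp; omega
      · simp; omega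
      · simp [h7₁]
      · simp [h7₁]; omega
      · simp; omega
      · simp
      · simp [hsucc, hc.1, hc.2]
      · simp; omega
    · have hc : ¬ (windowDistMatrix L hL hn K P j D a b ≠ 0 ∧
          (windowDistMatrix L hL hn K P j D * windowAdjMatrix L hL hn K j A) a b ≠ 0) := by
        rw [hdist]
        simpa [h13, hw₁.reg8, hw₁.dist, h7₁, hw₁.reg0, hw₁.reg3, hprod] using hc
      refine WP.skip ?_ (WP.asg (p + 1) ?_ ?_ ?_ ⟨p + 1, hlt, ?_, ?_, hu'.setReg (by simp), ?_⟩)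
      · simp; omega
      · simp [h7₁]
      · simp [h7₁]; omega
      · simp; omega
      · simp
      · rw [hsucc, or_iff_left hc, ← h9]
        simp [h9₁]
      · simp; omega
  · have hp' : p = 3 * K * (3 * K) := by
      have : ¬ p < 3 * K * (3 * K) := by simpa [h7, hw.reg6] using he
      omega
    subst hp'
    refine hQ _ _ h9 hu ?_
    simp
    omega

/-- `P` multiplies `N × N` matrices with entries `0` and `1` in `t` steps with word size `w`. -/
def Multiplies (w : ℕ) (P : Program) (N t : ℕ) : Prop :=
  ∀ X Y : Matrix (Fin N) (Fin N) ℕ, (∀ a b, X a b ≤ 1) → (∀ a b, Y a b ≤ 1) →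
    ∃ t' ≤ t, ∃ s, Exec w P (matMulInput X Y) t' s ∧
      ∀ a b : Fin N, s.mem 2 (finProdFinEquiv (a, b)) = (X * Y) a b

/-- Look for an antipodal edge in the window `j`, where `M` multiplies matrices. -/
def searchWindow (M : Program) : Program :=
  asg 12 (.var 3 *ₑ .var 1) ;; fillWindow ;; embed 3 0 M ;; checkWindow

theorem matMulInput_boundedBy {N M : ℕ} {X Y : Matrix (Fin N) (Fin N) ℕ} (hX : ∀ a b, X a b ≤ 1)
    (hY : ∀ a b, Y a b ≤ 1) (hM : N + 1 < M) : (matMulInput X Y).BoundedBy M := by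
  refine ⟨fun r => ?_, fun x i => ?_⟩
  · simp only [matMulInput]
    split_ifs <;> omega
  · simp only [matMulInput]
    split_ifs
    · exact (hX _ _).trans_lt (by omega)
    · exact (hY _ _).trans_lt (by omega)
    · omega
    · omega

/-- Only the indices congruent to `j` modulo `n` in the arrays from `20` on are touched, so the
memory of all other runs is preserved, in particular the zeros that later runs rely on. -/
theorem wp_searchWindow {B w t : ℕ} {M : Program} (hM : Multiplies w M (3 * K) t)
    (hwB : (2 ^ w + 3 * K + 2) * n ≤ B) {s : State}
    (h0 : s.reg 0 = n) (h1 : s.reg 1 = K) (h3 : s.reg 3 = j) (h5 : s.reg 5 = 3 * K)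
    (h6 : s.reg 6 = 3 * K * (3 * K)) (h8 : s.reg 8 = P) (horder : HoldsList (s.mem 6) 0 L)
    (hdist : ∀ u v : Fin n, s.mem 8 (u * n + v) = D u v)
    (hmatrix : ∀ u v : Fin n, s.mem 5 (u * n + v) = A u v) (hA : ∀ u v, A u v ≤ 1)
    (hL : L.length = n) (hj : j * K ≤ n) (hjn : j < n) (hK : K ≤ n)
    (hB : 9 * (n * n * n) + 9 * (n * n) + 9 * n + 9 < B)
    (hz : ∀ x i, 20 ≤ x → i % n = j → s.mem x i = 0)
    {T : ℕ} (hT : 200 * (3 * K * (3 * K)) + 10 * t + 50 ≤ T) {Q : State → ℕ → Prop}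
    (hQ : ∀ s' T', (s'.reg 9 ≠ 0 ↔ s.reg 9 ≠ 0 ∨
        HasAntipodal L hL hn K P j D A (3 * K * (3 * K))) →
      (∀ x < 20, s'.mem x = s.mem x) → (∀ x i, i % n ≠ j → s'.mem x i = s.mem x i) →
      (∀ r ∉ [7, 9, 10, 11, 12, 13], s'.reg r = s.reg r) →
      T ≤ T' + (200 * (3 * K * (3 * K)) + 10 * t + 50) → Q s' T') :
    WP B (searchWindow M) Q s T := by
  have hX (a b) : windowDistMatrix L hL hn K P j D a b ≤ 1 := by
    rw [windowDistMatrix]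
    split_ifs <;> simp
  have hY (a b) : windowAdjMatrix L hL hn K j A a b ≤ 1 := hA _ _
  obtain ⟨t', ht', σ, hex, hσ⟩ := hM _ _ hX hY
  have hw : IsWindow hn L K P j D A (s.setReg 12 (j * K)) :=
    ⟨by simpa, by simpa, by simpa, by simpa, by simpa, by simpa, by simp, by simpa, by simpa,
    by simpa⟩
  refine WP.seq (WP.asg (j * K) ?_ ?_ ?_ (WP.seq (wp_fillWindow hw hL hj hjn hK hB ?_ ?_
    fun s₁ T₁ h20 h22 h21 hag hu hT₁ => WP.seq ?_)))
  · simp [h3, h1]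
  · simp [h3, h1]; omega
  · simp; omega
  · simpa using hz
  · simp; omega
  have hw₁ := hw.congr hu (by simp) (by simp)
  have hz₁ (x i) (hx : 20 ≤ x) (h20 : x ≠ 20) (h21 : x ≠ 21) (h22 : x ≠ 22) (hi : i % n = j) :
      s₁.mem x i = 0 := by
    rw [hu.mem x (by simp; omega)]
    simpa using hz x i hx hi
  have hjmod : j % n = j := Nat.mod_eq_of_lt hjn
  have hmod (i : ℕ) : (i * n + j) % n = j := by rw [mul_comm, Nat.mul_add_mod, hjmod]
  have hsim : Simulates 3 0 j n
      (matMulInput (windowDistMatrix L hL hn K P j D) (windowAdjMatrix L hL hn K j A)) s₁ := by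
    refine ⟨hw₁.reg3, hw₁.reg0, fun r => ?_, fun x i => ?_⟩
    · rcases r with _ | r
      · simpa [matMulInput] using h21
      · simpa [matMulInput] using hz₁ (2 * (r + 1) + 21) j (by omega) (by omega) (by omega)
          (by omega)
          hjmod
    · rcases x with _ | _ | x
      · rw [h20]
        simp [matMulInput, windowDistMatrix, windowDist, finProdFinEquiv]
        rfl
      · rw [h22]
        simp [matMulInput, windowAdjMatrix, windowAdj, finProdFinEquiv]
      · rw [hz₁ _ _ (by omega) (by omega) (by omega) (by omega) (hmod i)]
        simp [matMulInput]
  simp at hT₁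
  have h2w := Nat.two_pow_pos w
  -- The summand `3 * K + 2` is there because the size and the entries of the input need not fit
  -- into words of `w` bits.
  refine hex.wp_embed (matMulInput_boundedBy hX hY (M := 2 ^ w + 3 * K + 2) (by omega)) (by omega)
    hwB
    hjn hsim (by omega) fun s₂ hsim₂ hag₂ => ?_
  have hw₂ : IsWindow hn L K P j D A s₂ := by
    obtain ⟨g₁, g₂, g₃, g₄, g₅, g₆, g₇, g₈, g₉, g₁₀⟩ := hw₁
    refine ⟨?_, ?_, ?_, ?_, ?_, ?_, ?_, ?_, ?_, ?_⟩ <;>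
      simpa only [hag₂.reg, hag₂.low 6 (by simp), hag₂.low 8 (by simp), hag₂.low 5 (by simp)]
  refine wp_checkWindow hw₂ hL hj hjn hK hB (fun a b => ?_) (fun a b => ?_) (by omega)
    fun s₃ T₃ h9 hu₃ hT₃ => hQ _ _ ?_ (fun x hx => ?_) (fun x i hi => ?_) (fun r hr => ?_) ?_
  · have := hsim₂.mem 2 (a * (3 * K) + b)
    rw [this, ← hσ]
    simp [mul_comm, add_comm]
  · rw [← hσ]
    have hb := (hex.boundedBy (B := 2 ^ w + 3 * K + 2) (by omega)
      (matMulInput_boundedBy hX hY (by omega))).mem 2 (finProdFinEquiv (a, b))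
    exact hb.trans_le ((Nat.le_mul_of_pos_right _ hn).trans hwB)
  · rw [h9, hag₂.reg, hu.reg 9 (by simp)]
    simp
  · rw [hu₃.mem x (by simp), hag₂.low x hx]
    exact hag.low x hx
  · rw [hu₃.mem x (by simp), hag₂.high x i hi]
    exact hag.high x i hi
  · simp only [List.mem_cons, List.not_mem_nil, or_false, not_or] at hr
    rw [hu₃.reg r (by simp; tauto), hag₂.reg, hu.reg r (by simp; tauto), State.reg_setReg,
      if_neg hr.2.2.2.2.1]
  · omega

end

/-! ### Every antipodal edge lies in a window -/

section

open WordRAM SimpleGraph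

variable {n : ℕ} {G : SimpleGraph (Fin n)} {adj : Fin n → List (Fin n)} {S : Finset (Fin n)}
  {hn : 0 < n} {L : List (Fin n)} {K P : ℕ} {D A : Fin n → Fin n → ℕ}

theorem HasOrder.pos {s : State} (h : HasOrder G S s L K) (hn : 0 < n) : 0 < K := by
  have hL : 0 < L.length := by rw [h.length]; exact hn
  by_cases h0 : L[0] ∈ S
  · exact ((h.mem_iff 0 hL).1 h0).trans_le h.card_le
  · simpa using h.window 0 0 hL hL h0 (.refl _)

/-- Reduction modulo `n` does nothing at genuine positions. Window positions past the end wrap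
around to other vertices, which may repeat but can do no harm. -/
theorem exists_windowVertex_eq (hL : L.length = n) {j i : ℕ} (hi : i < L.length)
    (h : i < K ∨ j * K ≤ i ∧ i < j * K + 2 * K) :
    ∃ a : Fin (3 * K), windowVertex L hL hn K j a = L[i] := by
  have hmod : i % n = i := Nat.mod_eq_of_lt (by omega)
  by_cases hiK : i < K
  · refine ⟨⟨i, by omega⟩, ?_⟩
    simp [windowVertex, hiK, hmod]
  · refine ⟨⟨i + K - j * K, by omega⟩, ?_⟩
    have h₁ : ¬ i + K - j * K < K := by omega
    have h₂ : i + K - j * K + j * K - K = i := by omega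
    simp [windowVertex, h₁, h₂, hmod]

/-- The vertices of `T` in `S` are among the first `K`. The others lie in one component, so they are
within `K` positions after the first of them, and rounding its position down to a multiple of `K`
costs less than another `K`. -/
theorem HasOrder.exists_window {s : State} (h : HasOrder G S s L K) (T : Finset (Fin n))
    (hT : ∀ x ∈ T, ∀ y ∈ T, x ∉ S → y ∉ S → (G.modeGraph S 0).Reachable x y) :
    ∃ j, j * K < n ∧ ∀ x ∈ T, ∃ a : Fin (3 * K), windowVertex L h.length hn K j a = x := by
  have hpos (x : Fin n) : L.idxOf x < L.length := List.idxOf_lt_length_iff.2 (h.mem x)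
  have hget (x : Fin n) : L[L.idxOf x]'(hpos x) = x := List.getElem_idxOf (hpos x)
  have hS (x : Fin n) (hx : x ∈ S) : L.idxOf x < K := by
    have := (h.mem_iff _ (hpos x)).1 (by rwa [hget])
    exact this.trans_le h.card_le
  suffices ∃ j, j * K < n ∧ ∀ x ∈ T, x ∉ S → j * K ≤ L.idxOf x ∧ L.idxOf x < j * K + 2 * K by
    obtain ⟨j, hj, hj'⟩ := this
    refine ⟨j, hj, fun x hx => ?_⟩
    obtain ⟨a, ha⟩ := exists_windowVertex_eq (hn := hn) h.length (hpos x) (j := j)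
      (or_iff_not_imp_left.2 fun hK => hj' x hx fun hxS => hK (hS x hxS))
    exact ⟨a, ha.trans (hget x)⟩
  rcases (T.filter (· ∉ S)).eq_empty_or_nonempty with he | hne
  · refine ⟨0, by simpa using hn, fun x hx hxS => ?_⟩
    have : x ∈ T.filter (· ∉ S) := Finset.mem_filter.2 ⟨hx, hxS⟩
    simp [he] at this
  · obtain ⟨x₀, hx₀, hmin⟩ := Finset.exists_min_image _ (fun x => L.idxOf x) hne
    rw [Finset.mem_filter] at hx₀
    have h₁ := Nat.div_mul_le_self (L.idxOf x₀) K
    have h₂ := Nat.lt_div_mul_add (h.pos hn) (a := L.idxOf x₀)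
    have h₃ := hpos x₀
    rw [h.length] at h₃
    refine ⟨L.idxOf x₀ / K, by omega, fun x hx hxS => ?_⟩
    have h₄ := hmin x (Finset.mem_filter.2 ⟨hx, hxS⟩)
    have h₅ := h.window _ _ (hpos x₀) (hpos x) (by rw [hget]; exact hx₀.2)
      (by rw [hget, hget]; exact hT x₀ hx₀.1 x hx hx₀.2 hxS)
    omega

/-- A nonzero entry of the product exhibits a genuine triple, whatever vertices the window contains.
Conversely, the members of a triple outside `S` are pairwise connected in `G - S`: a search from `u
∉ S` stays in the component of `u`, and `v` and `w` are adjacent. -/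
theorem HasOrder.exists_hasAntipodal_iff {s : State} (h : HasOrder G S s L K) {b : ℕ}
    (hrow : ∀ u, G.IsBfsRow S b u (D u)) (hP : P ≠ 0) (hA : ∀ u v, A u v ≠ 0 ↔ G.Adj u v) :
    (∃ j, j * K < n ∧ HasAntipodal L h.length hn K P j D A (3 * K * (3 * K))) ↔
      ∃ u v w, D u v = P ∧ D u w = P ∧ G.Adj v w := by
  constructor
  · rintro ⟨j, -, a, c, -, h₁, h₂⟩
    rw [Matrix.mul_apply] at h₂
    obtain ⟨b, -, h₂⟩ := Finset.exists_ne_zero_of_sum_ne_zero h₂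
    obtain ⟨h₂, h₃⟩ := mul_ne_zero_iff.1 h₂
    simp only [windowDistMatrix, ne_eq, ite_eq_right_iff, one_ne_zero, imp_false, not_not] at h₁ h₂
    exact ⟨_, _, _, h₂, h₁, (hA _ _).1 h₃⟩
  · rintro ⟨u, v, w, hv, hw, hvw⟩
    have hu {v} (hv : D u v = P) (huS : u ∉ S) : (G.modeGraph S 0).Reachable u v :=
      ((hrow u).mem_of_ne_zero (by omega)).resolve_left huS
    have hvw' (hvS : v ∉ S) (hwS : w ∉ S) : (G.modeGraph S 0).Reachable v w :=
      SimpleGraph.Adj.reachable ⟨hvw, .inr ⟨hvS, hwS⟩⟩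
    obtain ⟨j, hj, hT⟩ := h.exists_window (hn := hn) {u, v, w} (by
      simp only [Finset.mem_insert, Finset.mem_singleton]
      rintro x (rfl | rfl | rfl) y (rfl | rfl | rfl) hx hy
      exacts [.refl _, hu hv hx, hu hw hx, (hu hv hy).symm, .refl _, hvw' hx hy, (hu hw hy).symm,
        (hvw' hy hx).symm, .refl _])
    simp only [Finset.mem_insert, Finset.mem_singleton, forall_eq_or_imp, forall_eq] at hT
    obtain ⟨⟨a, rfl⟩, ⟨b, rfl⟩, ⟨c, rfl⟩⟩ := hT
    refine ⟨j, hj, a, c, mul_add_lt_mul a.2 c.2, by simp [windowDistMatrix, hw], ?_⟩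
    rw [Matrix.mul_apply]
    refine fun h0 => ?_
    have := Finset.sum_eq_zero_iff.1 h0 b (Finset.mem_univ _)
    rw [windowDistMatrix, if_pos hv, one_mul] at this
    exact (hA _ _).2 hvw this

/-- Decrease variable `2` if there is an antipodal edge at half its value. -/
def refineGirth (M : Program) : Program :=
  asg 5 (.lit 3 *ₑ .var 1) ;; asg 6 (.var 5 *ₑ .var 5) ;; asg 8 (.var 2 /ₑ .lit 2) ;;
  asg 9 (.lit 0) ;; asg 3 (.lit 0) ;;
  loopWhile (.var 3 *ₑ .var 1 <ₑ .var 0) (searchWindow M ;; asg 3 (.var 3 +ₑ .lit 1)) ;;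
  cond (.var 9) (asg 2 (.var 2 -ₑ .lit 1)) .skip

/-- The windows are those with `j * K < n`. As `K ≤ n`, there are at most `2 * n / K` of them. -/
theorem wp_refineGirth {B w t : ℕ} {M : Program} (hM : Multiplies w M (3 * K) t)
    (hwB : (2 ^ w + 3 * K + 2) * n ≤ B) {s : State} (h : HasOrder G S s L K)
    (h0 : s.reg 0 = n) (hd : HasDist G S s n) (hb : s.reg 2 ≠ 0)
    (hb2 : s.reg 2 % 2 = 0) (hm : HasMatrix hn G s n)
    (hB : 9 * (n * n * n) + 9 * (n * n) + 9 * n + 9 < B)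
    (hz : ∀ x i, 20 ≤ x → s.mem x i = 0)
    {T : ℕ} (hT : (200 * (3 * K * (3 * K)) + 10 * t + 60) * (2 * n / K) + 60 ≤ T)
    {Q : State → ℕ → Prop}
    (hQ : ∀ s' T', s'.reg 2 = G.girth →
      T ≤ T' + ((200 * (3 * K * (3 * K)) + 10 * t + 60) * (2 * n / K) + 60) → Q s' T') :
    WP B (refineGirth M) Q s T := by
  have hK := h.pos hn
  have hKn : K ≤ n := h.le n isKSeparator_self
  have hKK : K * K ≤ n * n := Nat.mul_le_mul hKn hKn
  have e9 : 3 * K * (3 * K) = 9 * (K * K) := by ring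
  have h1 := h.reg1
  have hble := hd.le
  set D : Fin n → Fin n → ℕ := fun u v => s.mem 8 (u * n + v) with hD
  set A : Fin n → Fin n → ℕ := fun u v => s.mem 5 (u * n + v) with hAdef
  have hA (u v) : A u v ≠ 0 ↔ G.Adj u v := by
    refine ⟨hm.adj u v, fun huv => ?_⟩
    have hu : rowVertex hn u = u := Fin.ext (Nat.mod_eq_of_lt u.2)
    have := hm.row u u.2 v (by rwa [hu])
    rwa [hu] at this
  have hrow (u) : G.IsBfsRow S (s.reg 2) u (D u) := hd.row u u.2
  have hiff := h.exists_hasAntipodal_iff (hn := hn) (P := s.reg 2 / 2) hrow (by omega) hA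
  have hgirth := (girth_eq_of_isBfsRow hrow hd.cycle).2 hb hb2
  rw [← hiff] at hgirth
  set c := 200 * (3 * K * (3 * K)) + 10 * t + 60 with hc
  refine WP.seq (WP.asg (3 * K) ?_ ?_ ?_ (WP.seq (WP.asg (3 * K * (3 * K)) ?_ ?_ ?_ (WP.seq
    (WP.asg (s.reg 2 / 2) ?_ ?_ ?_ (WP.seq (WP.asg 0 ?_ ?_ ?_ (WP.seq (WP.asg 0 ?_ ?_ ?_
      (WP.seq ?_))))))))))
  · simp [h1]
  · simp [h1]; omega
  · simp; omega
  · simp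
  · simp; omega
  · simp; omega
  · simp
  · simp; omega
  · simp; omega
  · simp
  · simp; omega
  · simp; omega
  · simp
  · simp; omega
  · simp; omega
  -- Residue classes from `j` on are still zero, ready for the remaining runs. The final counter
  -- satisfies only `j * K < n + K`, which is at most `2 * n`.
  refine WP.loopWhile (fun s' T' => ∃ j, j * K < n + K ∧ s'.reg 3 = j ∧ s'.reg 5 = 3 * K ∧
      s'.reg 6 = 3 * K * (3 * K) ∧ s'.reg 8 = s.reg 2 / 2 ∧
      (s'.reg 9 ≠ 0 ↔ ∃ i < j, i * K < n ∧
        HasAntipodal L h.length hn K (s.reg 2 / 2) i D A (3 * K * (3 * K))) ∧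
      (∀ r < 3, s'.reg r = s.reg r) ∧ (∀ x < 20, s'.mem x = s.mem x) ∧
      (∀ x i, 20 ≤ x → j ≤ i % n → s'.mem x i = 0) ∧ T ≤ T' + c * j + 30)
    ⟨0, ?_, ?_, ?_, ?_, ?_, ?_, fun r hr => ?_, fun x hx => ?_, fun x i hx hi => ?_, ?_⟩ ?_
  · omega
  · simp
  · simp
  · simp
  · simp
  · simp
  · simp
    have : r ≠ 3 ∧ r ≠ 5 ∧ r ≠ 6 ∧ r ≠ 8 ∧ r ≠ 9 := by omega
    simp [this]
  · simp
  · simpa using hz x i hx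
  · simp; omega
  rintro s' T' ⟨j, hj, h3, h5, h6, h8, h9, hreg, hmem, hz', hT'⟩
  have hj2 : j ≤ 2 * n / K := (Nat.le_div_iff_mul_le hK).2 (by omega)
  have hcj := Nat.mul_le_mul_left c hj2
  have h0' := (hreg 0 (by simp)).trans h0
  have h1' := (hreg 1 (by simp)).trans h1
  refine ⟨?_, ?_, fun he => ?_, fun he => ?_⟩
  · simp [h3, h1', h0']
    refine ⟨?_, ite_one_zero_lt (by omega) _⟩
    omega
  · simp
    omega
  · have hlt : j * K < n := by simpa [h3, h1', h0'] using he
    have hjn : j < n := (Nat.le_mul_of_pos_right j hK).trans_lt hlt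
    have hj1 : (j + 1) * K < n + K := by rw [Nat.succ_mul]; omega
    have hj2 : j + 1 ≤ 2 * n / K := (Nat.le_div_iff_mul_le hK).2 (by omega)
    have hcj := Nat.mul_le_mul_left c hj2
    rw [Nat.mul_succ] at hcj
    refine WP.seq (wp_searchWindow (hn := hn) (D := D) (A := A) hM hwB h0' h1' h3 h5 h6 h8 ?_ ?_ ?_
      (fun u v => hm.le_one _) h.length hlt.le hjn hKn hB (fun x i hx hi => hz' x i hx hi.ge) ?_
      fun s₁ T₁ h9₁ hlow hhigh hreg₁ hT₁ => ?_)
    · rw [hmem 6 (by simp)]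
      exact h.list
    · simp [hmem 8, hD]
    · simp [hmem 5, hAdef]
    · simp; omega
    have h3₁ := (hreg₁ 3 (by simp)).trans h3
    refine WP.asg (j + 1) ?_ ?_ ?_ ⟨j + 1, hj1, ?_, ?_, ?_, ?_, ?_, fun r hr => ?_, fun x hx => ?_,
      fun x i hx hi => ?_, ?_⟩
    · simp [h3₁]
    · simp [h3₁]; omega
    · simp at hT₁ ⊢; omega
    · simp
    · simp [hreg₁, h5]
    · simp [hreg₁, h6]
    · simp [hreg₁, h8]
    · have : (∃ i < j + 1, i * K < n ∧
          HasAntipodal L h.length hn K (s.reg 2 / 2) i D A (3 * K * (3 * K))) ↔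
          (∃ i < j, i * K < n ∧
          HasAntipodal L h.length hn K (s.reg 2 / 2) i D A (3 * K * (3 * K))) ∨
          HasAntipodal L h.length hn K (s.reg 2 / 2) j D A (3 * K * (3 * K)) := by
        constructor
        · rintro ⟨i, hi, hi'⟩
          rcases Nat.lt_succ_iff_lt_or_eq.1 hi with hi | rfl
          exacts [.inl ⟨i, hi, hi'⟩, .inr hi'.2]
        · rintro (⟨i, hi, hi'⟩ | h')
          exacts [⟨i, by omega, hi'⟩, ⟨j, by omega, hlt, h'⟩]
      rw [this, ← h9, ← h9₁]
      simp
    · have h3r : r ≠ 3 := by omega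
      simp [h3r]
      rw [hreg₁ r (by simp; omega), hreg r hr]
    · simp [hlow x hx, hmem x hx]
    · simp
      rw [hhigh x i (by omega)]
      exact hz' x i hx (by omega)
    · rw [Nat.mul_succ]
      simp at hT₁ ⊢; omega
  · have hlt : n ≤ j * K := by simpa [h3, h1', h0'] using he
    have hall : (∃ i < j, i * K < n ∧
        HasAntipodal L h.length hn K (s.reg 2 / 2) i D A (3 * K * (3 * K))) ↔ ∃ i, i * K < n ∧
        HasAntipodal L h.length hn K (s.reg 2 / 2) i D A (3 * K * (3 * K)) :=
      ⟨fun ⟨i, _, hi⟩ => ⟨i, hi⟩, fun ⟨i, hi⟩ =>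
        ⟨i, lt_of_mul_lt_mul_right (hi.1.trans_le hlt) (Nat.zero_le _), hi⟩⟩
    rw [hall] at h9
    have h2' := hreg 2 (by simp)
    refine WP.cond ?_ ?_ (fun hf => ?_) fun hf => ?_
    · simp
    · simp; omega
    · replace hf : s'.reg 9 ≠ 0 := hf
      refine WP.asg (s.reg 2 - 1) ?_ ?_ ?_ (hQ _ _ ?_ ?_)
      · simp [h2']
      · simp [h2']; omega
      · simp; omega
      · simpa using (hgirth.1 (h9.1 hf)).symm
      · simp; omega
    · replace hf : s'.reg 9 = 0 := hf
      refine WP.skip ?_ (hQ _ _ ?_ ?_)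
      · simp; omega
      · rw [h2', hgirth.2 fun h => h9.2 h hf]
      · simp; omega

end

section

open WordRAM SimpleGraph

/-! ## The girth -/

variable {n : ℕ} {G : SimpleGraph (Fin n)} {adj : Fin n → List (Fin n)} {S : Finset (Fin n)}
  {hn : 0 < n} {k : ℕ}

/-- Leave the girth in variable `0`, where `M` multiplies matrices. -/
def girthProgram (M : Program) : Program :=
  buildLists ;; orderVertices ;; searchAll ;;
  -- The product is nonzero exactly if the bound is nonzero and even.
  cond (.var 2 *ₑ (.lit 1 -ₑ .var 2 %ₑ .lit 2)) (refineGirth M) .skip ;; asg 0 (.var 2)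

theorem IsKSeparator.length_modeNbrs_le (h : IsKSeparator G S k) (hadj : IsAdjLists G adj)
    (v : Fin n) : (modeNbrs adj S 0 v).length ≤ k := by
  by_cases hv : v ∈ S
  · simp [modeNbrs, hv]
  · have := h.length_add_card_le hv (hadj.modeNbrs (S := S) 0 v).1
      fun x hx => (((hadj.modeNbrs (S := S) 0 v).2 x).1 hx).reachable
    omega

/-- A bound on the number of neighbors of `v`, and on the number of vertices that a search from `v`
reaches. -/
def reachBound (S : Finset (Fin n)) (k : ℕ) (v : Fin n) : ℕ := if v ∈ S then n else k

theorem IsKSeparator.length_le_reachBound (h : IsKSeparator G S k) (v : Fin n)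
    (R : List (Fin n)) (hR : R.Nodup)
    (hreach : ∀ x ∈ R, (G.modeGraph S (mode S v)).Reachable v x) : R.length ≤ reachBound S k v := by
  by_cases hv : v ∈ S
  · simpa [reachBound, hv] using hR.length_le_card
  · simp only [mode, hv, if_false] at hreach
    have := h.length_add_card_le hv hR hreach
    simp only [reachBound, hv, if_false]
    omega

/-- A vertex outside `S` has at most `S.card` neighbors in `S`, and at most `k - S.card` in its own
component. -/
theorem IsKSeparator.length_adj_le (h : IsKSeparator G S k) (hadj : IsAdjLists G adj)
    (v : Fin n) : (adj v).length ≤ reachBound S k v := by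
  by_cases hv : v ∈ S
  · simpa [reachBound, hv] using hadj.length_le v
  · have h₁ := h.length_add_card_le hv (hadj.modeNbrs (S := S) 0 v).1
      fun x hx => (((hadj.modeNbrs (S := S) 0 v).2 x).1 hx).reachable
    have h₂ : ((adj v).filter (· ∈ S)).length ≤ S.card := by
      rw [← List.toFinset_card_of_nodup ((hadj v).1.filter _)]
      exact Finset.card_le_card fun x hx =>
        by simpa using (List.mem_filter.1 (List.mem_toFinset.1 hx)).2
    have h₃ : modeNbrs adj S 0 v = (adj v).filter (fun x => !decide (x ∈ S)) := by
      simp [modeNbrs, hv]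
    have h₄ := List.length_eq_length_filter_add (l := adj v) (fun x => decide (x ∈ S))
    simp only [reachBound, hv, if_false]
    rw [h₃] at h₁
    omega

/-- The at most `k` vertices of `S` contribute `n` each, and the others `k` each. -/
theorem sum_reachBound_le (hS : S.card ≤ k) : ∑ v, reachBound S k v ≤ 2 * (k * n) := by
  have h : ∀ v ∈ Finset.univ, reachBound S k v ≤ (if v ∈ S then n else 0) + k := fun v _ => by
    rw [reachBound]
    split_ifs <;> omega
  refine (Finset.sum_le_sum h).trans ?_
  rw [Finset.sum_add_distrib, Finset.sum_ite_mem]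
  simp
  have := Nat.mul_le_mul_right n hS
  rw [mul_comm n k]
  omega

theorem sum_rowVertex (hn : 0 < n) (f : Fin n → ℕ) :
    ∑ q ∈ Finset.range n, f (rowVertex hn q) = ∑ v, f v := by
  rw [Finset.sum_range]
  exact Finset.sum_congr rfl fun v _ => congrArg f (Fin.ext (Nat.mod_eq_of_lt v.2))

theorem buildCost_le (h : IsKSeparator G S k) (hadj : IsAdjLists G adj) :
    buildCost hn adj (2 * n) ≤ 280 * (k * n) + 140 * n := by
  have h₁ : ∑ q ∈ Finset.range n, (70 * (adj (rowVertex hn q)).length + 70) ≤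
      140 * (k * n) + 70 * n := by
    rw [sum_rowVertex hn fun v => 70 * (adj v).length + 70, Finset.sum_add_distrib,
      ← Finset.mul_sum]
    have := (Finset.sum_le_sum fun v _ => h.length_adj_le hadj v).trans (sum_reachBound_le h.1)
    simp
    omega
  rw [buildCost, two_mul, Finset.sum_range_add]
  simp only [rowVertex, Nat.add_mod_left] at h₁ ⊢
  omega

theorem searchCost_le (hS : S.card ≤ k) :
    searchCost hn (reachBound S k) n ≤ 420 * (k * n) + 220 * n := by
  rw [searchCost, sum_rowVertex hn fun v => 210 * reachBound S k v + 220, Finset.sum_add_distrib,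
    ← Finset.mul_sum]
  have := sum_reachBound_le hS
  simp
  omega

/-- The hypotheses range over all `K` because `K` is only computed at run time; it is at most `k`
for every `k` for which `S` is a `k`-separator. -/
theorem wp_girthProgram {B : ℕ} {M : Program} {w t : ℕ → ℕ}
    (hM : ∀ K, 0 < K → Multiplies (w K) M (3 * K) (t K))
    (hwB : ∀ K, 0 < K → K ≤ n → (2 ^ w K + 3 * K + 2) * n ≤ B) (hB : 64 * (n + 1) ^ 4 ≤ B)
    (hn : 0 < n)
    (hadj : IsAdjLists G adj) (h : IsKSeparator G S k) {R : ℕ}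
    (hR : ∀ K, 0 < K → K ≤ k →
      (200 * (3 * K * (3 * K)) + 10 * t K + 60) * (2 * n / K) + 60 ≤ R) :
    WP B (girthProgram M) (fun s _ => s.reg 0 = G.girth) (graphInput adj S)
      (800 * (k * n) + 800 * n + 400 + R) := by
  have hB' : 9 * (n * n * n) + 9 * (n * n) + 9 * n + 9 < B := by
    refine lt_of_lt_of_le ?_ hB
    have e : 64 * (n + 1) ^ 4 = 64 * (n * n * n * n) + 256 * (n * n * n) + 384 * (n * n)
      + 256 * n + 64 := by
      ring
    omega
  have hBn : 4 * (n * n) + 4 * n + 4 < B := by omega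
  have hbuild := buildCost_le (hn := hn) h hadj
  have hsearch := searchCost_le (hn := hn) h.1
  have hz {x i : ℕ} (hx : 3 ≤ x) : (graphInput adj S).mem x i = 0 := by
    have : x ≠ 0 ∧ x ≠ 1 ∧ x ≠ 2 := by omega
    simp [graphInput, this]
  have hin := hasInput_graphInput (S := S) hadj
  refine WP.seq (wp_buildLists (hn := hn) hadj hB hin (fun i => hz (by simp)) ?_
    fun s₁ T₁ hl h0 hm₁ hT₁ => WP.seq ?_)
  · omega
  have hin₁ : HasInput adj S s₁ := hin.congr (h0.trans hin.reg_zero.symm)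
    fun x hx => hm₁ x (by omega) (by omega) (by omega)
  have hc : (30 * k + 60) * n = 30 * (k * n) + 60 * n := by ring
  refine wp_orderVertices hadj hBn hin₁ hl.rows (fun i => ?_) (c := 30 * k + 60) (fun x => ?_) ?_
    fun s₂ T₂ L K ho hu₂ hT₂ => WP.seq ?_
  · rw [hm₁ 7 (by simp) (by simp) (by simp)]
    exact hz (by simp)
  · have := h.length_modeNbrs_le hadj x
    omega
  · omega
  have hin₂ : HasInput adj S s₂ := hin₁.congr (hu₂.reg 0 (by simp)) fun x hx =>
    hu₂.mem x (by simp; omega)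
  refine wp_searchAll hadj hBn hin₂ (hl.rows.congr (hu₂.mem 3 (by simp)) (hu₂.mem 4 (by simp)))
    (fun i => ?_) h.length_le_reachBound ?_ fun s₃ T₃ hd hu₃ hT₃ => WP.seq ?_
  · rw [hu₂.mem 8 (by simp), hm₁ 8 (by simp) (by simp) (by simp)]
    exact hz (by simp)
  · omega
  have h0₃ : s₃.reg 0 = n := (hu₃.reg 0 (by simp)).trans hin₂.reg_zero
  have ho₃ : HasOrder G S s₃ L K :=
    ⟨by rw [hu₃.mem 6 (by simp)]; exact ho.list, (hu₃.reg 1 (by simp)).trans ho.reg1, ho.length,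
    ho.card_le,
      ho.mem_iff, ho.mem, ho.window, ho.le⟩
  have hm₃ : HasMatrix hn G s₃ n := by
    have : s₃.mem 5 = s₁.mem 5 := (hu₃.mem 5 (by simp)).trans (hu₂.mem 5 (by simp))
    exact ⟨by simpa only [this] using hl.matrix.le_one, by simpa only [this] using hl.matrix.adj,
      by simpa only [this] using hl.matrix.row⟩
  have hK := ho₃.pos hn
  have hR := hR K hK (ho₃.le k h)
  have hble := hd.le
  have hgirth := girth_eq_of_isBfsRow (fun u => hd.row u u.2) hd.cycle
  have hfinal (s₄ : State) (T₄ : ℕ) (h2 : s₄.reg 2 = G.girth) (hle : G.girth ≤ 2 * n)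
    (hT₄ : 1 ≤ T₄) :
      WP B (asg 0 (.var 2)) (fun s _ => s.reg 0 = G.girth) s₄ T₄ := by
    refine WP.asg G.girth ?_ ?_ ?_ ?_
    · simp [h2]
    · simp [h2]; omega
    · simpa using hT₄
    · simp
  refine WP.cond ?_ ?_ (fun hc => ?_) fun hc => ?_
  · have := Nat.mul_le_mul_left (s₃.reg 2) (Nat.sub_le 1 (s₃.reg 2 % 2))
    simp
    omega
  · simp
    omega
  · have hc : s₃.reg 2 ≠ 0 ∧ s₃.reg 2 % 2 = 0 := by
      have : s₃.reg 2 * (1 - s₃.reg 2 % 2) ≠ 0 := by simpa using hc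
      rw [mul_ne_zero_iff] at this
      omega
    refine wp_refineGirth (hM K hK) (hwB K hK (ho₃.le n isKSeparator_self))
      ho₃ h0₃ hd hc.1 hc.2 hm₃ hB'
      (fun x i hx => ?_) ?_ fun s₄ T₄ h2 hT₄ => hfinal s₄ T₄ h2 ?_ ?_
    · rw [hu₃.mem x (by simp; omega), hu₂.mem x (by simp; omega),
        hm₁ x (by omega) (by omega) (by omega)]
      exact hz (by omega)
    · simp; omega
    · by_cases hex : ∃ u v w : Fin n, s₃.mem 8 (u * n + v) = s₃.reg 2 / 2 ∧
          s₃.mem 8 (u * n + w) = s₃.reg 2 / 2 ∧ G.Adj v w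
      · have := (hgirth.2 hc.1 hc.2).1 hex
        omega
      · have := (hgirth.2 hc.1 hc.2).2 hex
        omega
    · simp at hT₄
      omega
  · have hc : s₃.reg 2 = 0 ∨ s₃.reg 2 % 2 = 1 := by
      have : s₃.reg 2 * (1 - s₃.reg 2 % 2) = 0 := by simpa using hc
      rw [mul_eq_zero] at this
      omega
    have := hgirth.1 hc
    refine WP.skip ?_ (hfinal _ _ this.symm (by omega) ?_)
    · simp; omega
    · simp; omega

end

/-! ### Running time and word size -/

section

open WordRAM SimpleGraph

theorem IsKSeparator.pos {n k : ℕ} {G : SimpleGraph (Fin n)} {S : Finset (Fin n)}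
    (h : IsKSeparator G S k) (hn : 0 < n) : 0 < k := by
  by_cases hv : (⟨0, hn⟩ : Fin n) ∈ S
  · exact (Finset.card_pos.2 ⟨_, hv⟩).trans_le h.1
  · have := h.length_add_card_le hv (R := [⟨0, hn⟩]) (by simp) (by simp)
    simp at this
    omega

/-- Per window `K ^ 2` and `K ^ τ`, times `n / K`, give at most `K ^ (τ - 1) * n` because `τ ≥ 2`.
The constant is `3780 = 3600 + 120 + 60` with `3600 = 200 * 9 * 2`. -/
theorem cast_windowCost_le {τ C : ℝ} (hτ : 2 ≤ τ) (hC : 0 ≤ C) {n k K : ℕ} (hK : 0 < K)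
    (hKk : K ≤ k) (hn : 0 < n) :
    ((200 * (3 * K * (3 * K)) + 10 * ⌊C * ((3 * K : ℕ) : ℝ) ^ τ⌋₊ + 60) * (2 * n / K) + 60 : ℕ) ≤
      (3780 + 20 * (C * 3 ^ τ)) * ((k : ℝ) ^ (τ - 1) * n) := by
  have hK0 : (0 : ℝ) < K := by exact_mod_cast hK
  have hK1 : (1 : ℝ) ≤ K := by exact_mod_cast hK
  have hn1 : (1 : ℝ) ≤ n := by exact_mod_cast hn
  have hle : (K : ℝ) ^ (τ - 1) ≤ (k : ℝ) ^ (τ - 1) :=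
    Real.rpow_le_rpow hK0.le (by exact_mod_cast hKk) (by linarith)
  have hKle : (K : ℝ) ≤ (K : ℝ) ^ (τ - 1) := by
    simpa using Real.rpow_le_rpow_of_exponent_le hK1 (show (1 : ℝ) ≤ τ - 1 by linarith)
  have hpow : (K : ℝ) ^ τ = (K : ℝ) ^ (τ - 1) * K := by
    rw [← Real.rpow_add_one hK0.ne', sub_add_cancel]
  have ht : (⌊C * ((3 * K : ℕ) : ℝ) ^ τ⌋₊ : ℝ) ≤ C * 3 ^ τ * ((K : ℝ) ^ (τ - 1) * K) := by
    refine (Nat.floor_le (by positivity)).trans_eq ?_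
    rw [← hpow, Nat.cast_mul, Nat.cast_ofNat, Real.mul_rpow (by norm_num) hK0.le, mul_assoc]
  have hdiv : ((2 * n / K : ℕ) : ℝ) ≤ 2 * n / K := by
    simpa using Nat.cast_div_le (α := ℝ) (m := 2 * n) (n := K)
  set X := (k : ℝ) ^ (τ - 1)
  set Y := (K : ℝ) ^ (τ - 1)
  generalize ⌊C * ((3 * K : ℕ) : ℝ) ^ τ⌋₊ = t at ht ⊢
  have hCτ : 0 ≤ C * (3 : ℝ) ^ τ := by positivity
  push_cast
  calc (200 * (3 * (K : ℝ) * (3 * K)) + 10 * t + 60) * ((2 * n / K : ℕ) : ℝ) + 60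
      ≤ (200 * (3 * K * (3 * K)) + 10 * (C * 3 ^ τ * (Y * K)) + 60 * K) * (2 * n / K) + 60 := by
        gcongr
        linarith
    _ = (3600 * K + 20 * (C * 3 ^ τ) * Y + 120) * n + 60 := by
        field_simp
        ring
    _ ≤ (3600 * X + 20 * (C * 3 ^ τ) * X + 120 * X) * n + 60 * (X * n) := by
        have hX : 1 ≤ X := by linarith
        have : 1 ≤ X * n := one_le_mul_of_one_le_of_one_le hX hn1
        gcongr <;> linarith
    _ = (3780 + 20 * (C * 3 ^ τ)) * (X * n) := by ring

theorem sixty_four_mul_pow_le {n : ℕ} (hn : 0 < n) (c : ℕ) :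
    64 * (n + 1) ^ 4 ≤ 2 ^ wordSize (c + 10) n := by
  refine le_trans ?_ (pow_le_two_pow_wordSize _ _)
  have h₁ : 2 ^ 6 ≤ (n + 1) ^ 6 := Nat.pow_le_pow_left (by omega) 6
  calc 64 * (n + 1) ^ 4 ≤ (n + 1) ^ 6 * (n + 1) ^ 4 := Nat.mul_le_mul_right _ h₁
    _ = (n + 1) ^ 10 := by ring
    _ ≤ (n + 1) ^ (c + 10) := Nat.pow_le_pow_right (by omega) (by omega)

/-- From `6 * K ≤ 6 * n ≤ (n + 1) ^ 4` the words of the inner machine are below `(n + 1) ^ (4 * c)`;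
the rest of the exponent pays for the interleaving of `n` runs and for the size of the input. -/
theorem two_pow_wordSize_mul_le (c : ℕ) {n K : ℕ} (hK : 0 < K) (hKn : K ≤ n) :
    (2 ^ wordSize c (3 * K) + 3 * K + 2) * n ≤ 2 ^ wordSize (4 * c + 10) n := by
  refine le_trans ?_ (pow_le_two_pow_wordSize _ _)
  have h₁ : 6 * n ≤ (n + 1) ^ 4 := by
    have e : (n + 1) ^ 4 = n * n * n * n + 4 * (n * n * n) + 6 * (n * n) + 4 * n + 1 := by ring
    have := Nat.le_mul_self n
    omega
  have h₂ : 2 ^ wordSize c (3 * K) ≤ (n + 1) ^ (4 * c + 4) := by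
    refine (two_pow_wordSize_le c (by omega)).trans ?_
    calc (2 * (3 * K)) ^ c ≤ ((n + 1) ^ 4) ^ c := Nat.pow_le_pow_left (by omega) c
      _ = (n + 1) ^ (4 * c) := (pow_mul ..).symm
      _ ≤ _ := Nat.pow_le_pow_right (by omega) (by omega)
  have h₃ : 3 * K + 2 ≤ (n + 1) ^ (4 * c + 4) :=
    (show 3 * K + 2 ≤ (n + 1) ^ 4 by omega).trans (Nat.pow_le_pow_right (by omega) (by omega))
  calc (2 ^ wordSize c (3 * K) + 3 * K + 2) * n
      ≤ ((n + 1) ^ (4 * c + 4) * (n + 1)) * (n + 1) :=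
        Nat.mul_le_mul ((by omega : _ ≤ (n + 1) ^ (4 * c + 4) * 2).trans
          (Nat.mul_le_mul_left _ (by omega))) (by omega)
    _ = (n + 1) ^ (4 * c + 6) := by ring
    _ ≤ _ := Nat.pow_le_pow_right (by omega) (by omega)

theorem MatMulInTime.girthInTime {τ : ℝ} (h : MatMulInTime τ) : GirthInTime τ := by
  -- All matrices have entries `0` and `1`, so `d = 0` suffices.
  obtain ⟨M, c, C, hM⟩ := h 0
  -- Here `5780 = 3780 + 2000`, where `2000 = 800 + 800 + 400` comes from everything except the
  -- windows; `max C 0` makes the constant nonnegative.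
  refine ⟨girthProgram M, 4 * c + 10, 5780 + 20 * (max C 0 * 3 ^ τ), fun n hn G adj hadj S k hS =>
    ?_⟩
  have hτ := h.two_le
  set C' := max C 0
  have hC' : 0 ≤ C' := le_max_right _ _
  have hk : (1 : ℝ) ≤ k := by exact_mod_cast hS.pos hn
  have hn1 : (1 : ℝ) ≤ n := by exact_mod_cast hn
  have hM' (K : ℕ) (hK : 0 < K) : Multiplies (wordSize c (3 * K)) M (3 * K)
      ⌊C' * ((3 * K : ℕ) : ℝ) ^ τ⌋₊ := fun X Y hX hY => by
    obtain ⟨t, s, hex, ht, hs⟩ := hM (3 * K) (by omega) X Y (by simpa using hX) (by simpa using hY)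
    refine ⟨t, Nat.le_floor (ht.trans ?_), s, hex, hs⟩
    gcongr
    exact le_max_left _ _
  obtain ⟨t, s, T, hex, ht, hs⟩ := WP.exec view_graphInput (wp_girthProgram (G := G) (S := S) hM'
    (fun K => two_pow_wordSize_mul_le c) (sixty_four_mul_pow_le hn _) hn hadj hS
    (R := ⌊(3780 + 20 * (C' * 3 ^ τ)) * ((k : ℝ) ^ (τ - 1) * n)⌋₊)
    fun K hK hKk => Nat.le_floor (cast_windowCost_le hτ hC' hK hKk hn))
  refine ⟨t, s, hex, ?_, hs⟩
  have hR : (⌊(3780 + 20 * (C' * 3 ^ τ)) * ((k : ℝ) ^ (τ - 1) * n)⌋₊ : ℝ) ≤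
      (3780 + 20 * (C' * 3 ^ τ)) * ((k : ℝ) ^ (τ - 1) * n) := Nat.floor_le (by positivity)
  have hkX : (k : ℝ) ≤ (k : ℝ) ^ (τ - 1) := by
    simpa using Real.rpow_le_rpow_of_exponent_le hk (show (1 : ℝ) ≤ τ - 1 by linarith)
  have h₁ : (k : ℝ) * n ≤ (k : ℝ) ^ (τ - 1) * n := by gcongr
  have h₂ : (n : ℝ) ≤ k * n := le_mul_of_one_le_left (by linarith) hk
  have ht' : (t : ℝ) ≤ 800 * (k * n) + 800 * n + 400 +
      ⌊(3780 + 20 * (C' * 3 ^ τ)) * ((k : ℝ) ^ (τ - 1) * n)⌋₊ := by exact_mod_cast ht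
  rw [show 5780 + 20 * (C' * (3 : ℝ) ^ τ) = 2000 + (3780 + 20 * (C' * 3 ^ τ)) by ring, add_mul]
  linarith

theorem GirthInTime.mono {τ τ' : ℝ} (h : GirthInTime τ) (hτ : τ ≤ τ') : GirthInTime τ' := by
  obtain ⟨P, c, C, hP⟩ := h
  refine ⟨P, c, max C 0, fun n hn G adj hadj S k hS => ?_⟩
  obtain ⟨t, s, hex, ht, hs⟩ := hP n hn G adj hadj S k hS
  refine ⟨t, s, hex, ht.trans ?_, hs⟩
  have hk : (1 : ℝ) ≤ k := by exact_mod_cast hS.pos hn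
  have : (k : ℝ) ^ (τ - 1) ≤ (k : ℝ) ^ (τ' - 1) :=
    Real.rpow_le_rpow_of_exponent_le hk (by linarith)
  have hC : C ≤ max C 0 := le_max_left _ _
  have hC' : 0 ≤ max C 0 := le_max_right _ _
  gcongr

end

theorem mainTheorem3 :
    (∀ ω : ℝ, MatMulInTime ω → GirthInTime ω) ∧
      ∀ ε : ℝ, 0 < ε → GirthInTime (matMulExponent + ε) := by
  refine ⟨fun _ h => h.girthInTime, fun ε hε => ?_⟩
  -- The infimum need not be attained, so an exponent below `matMulExponent + ε` is used, and the
  -- bound is relaxed by monotonicity in the exponent, as `k ≥ 1`.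
  obtain ⟨τ, hτ, hlt⟩ := exists_lt_of_csInf_lt (s := {τ : ℝ | MatMulInTime τ})
    ⟨3, matMulInTime_three⟩
    (lt_add_of_pos_right (sInf {τ : ℝ | MatMulInTime τ}) hε)
  exact (MatMulInTime.girthInTime hτ).mono hlt.le
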